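/- **Setting.** Let $T^a$ ($a=1,\dots,N^2-1$) be Hermitian traceless generators of $SU(N)$ with $\mathrm{Tr}(T^aT^b)=\tfrac12\delta^{ab}$, $[T^a,T^b]=if^{abc}T^c$. Let $\Omega\subset\mathbb R^d$ be a bounded open set with Lebesgue-null frontier, $\mathcal F$ the algebra of functions on $\Omega$ that are restrictions of $C^\infty$ functions on $\mathbb R^d$, and $\mathcal D\subset\mathcal F$ those vanishing on $\partial\Omega$. Let $\kappa\in\mathbb R$ and assume that $-\partial^2:\mathcal D\to\mathcal F$ and $-\partial^2+\kappa:\mathcal D\to\mathcal F$ are bijective. All fields are formal power series in the coupling $g$ whose coefficients are Grassmann-valued functions (in $\mathcal F\otimes\Lambda$, $\Lambda$ the real Grassmann algebra on countably many generators): $A^a_\mu$, $b^a$, $\varphi^{ab}_\mu$, $\bar\varphi^{ab}_\mu$ are even, $c^a$, $\bar c^a$, $\omega^{ab}_\mu$, $\bar\omega^{ab}_\mu$ are odd, and $c,\varphi,\bar\varphi,\omega,\bar\omega$ vanish on $\partial\Omega$. All $\int d^dx$ are over $\Omega$. Put $D^{ab}_\mu(A)=\delta^{ab}\partial_\mu-gf^{abc}A^c_\mu$,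 $\mathcal M^{ab}(A)=-\partial_\mu D^{ab}_\mu(A)$, $F^a_{\mu\nu}=\partial_\mu A^a_\nu-\partial_\nu A^a_\mu+gf^{abc}A^b_\mu A^c_\nu$. The field $A^h_\mu=h^\dagger A_\mu h+\frac ig h^\dagger\partial_\mu h$, $h=e^{ig\xi^aT^a}$, is defined by the even $\xi^a$, vanishing on $\partial\Omega$, for which $\partial_\mu A^h_\mu=0$. The horizon function is $H(A)=g^2\int d^dx\,d^dy\,f^{abc}A^b_\mu(x)[\mathcal M^{-1}(A)]^{ad}(x,y)f^{dec}A^e_\mu(y)$. Here $\gamma^2$, $\alpha$, $m^2$ denote arbitrary real numbers, and $\gamma^4=(\gamma^2)^2$. An odd vector field $Q$ on the fields acts on a functional $X$ by $X(\Phi+\theta Q\Phi)=X(\Phi)+\theta\,(QX)(\Phi)$ for all odd $\theta\in\Lambda$. The BRST operator $s$ is $$sA^a_\mu=-D^{ab}_\mu c^b,\quad sc^a=\tfrac g2f^{abc}c^bc^c,\quad s\bar c^a=b^a,\quad sb^a=0,\quad s\varphi=\omega,\quad s\omega=0,\quad s\bar\omega=\bar\varphi,\quad s\bar\varphi=0.$$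 With $b^h$ in place of $b$, define $s_{\gamma^2}$ (with parameter $\kappa'\in\{0,\kappa\}$) by the same formulas on $A,c,\varphi,\omega,\bar\varphi$, by $s_{\gamma^2}\bar c^a=b^{h,a}$, $s_{\gamma^2}b^{h,a}=0$, and $$s_{\gamma^2}\bar\omega^{ab}_\mu=\bar\varphi^{ab}_\mu-\gamma^2gf^{cdb}\int d^dy\,A^{h,c}_\mu(y)\big[(\mathcal M(A^h)+\kappa')^{-1}\big]^{da}(y,x).$$ The actions are, with $S_{\rm YM}=\frac14\int F^a_{\mu\nu}F^a_{\mu\nu}$, $$S_{\rm GZ}=S_{\rm YM}+\int\!\big(b^{h,a}\partial_\mu A^a_\mu+\bar c^a\partial_\mu D^{ab}_\mu c^b\big)-\int\!\big(\bar\varphi^{ac}_\mu\mathcal M^{ab}(A^h)\varphi^{bc}_\mu-\bar\omega^{ac}_\mu\mathcal M^{ab}(A^h)\omega^{bc}_\mu\big)+\gamma^2g\int f^{abc}A^{h,a}_\mu(\varphi+\bar\varphi)^{bc}_\mu ,$$ $S^{\rm LCG}_{\rm GZ}=S_{\rm GZ}-\frac\alpha2\int b^{h,a}b^{h,a}$,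 $S^{\rm CF}_{\rm GZ}=S^{\rm LCG}_{\rm GZ}+\int\big(\frac\alpha2gf^{abc}b^{h,a}\bar c^bc^c+\frac\alpha8g^2f^{abc}f^{cde}\bar c^a\bar c^bc^dc^e\big)$, and the refined actions $S^{\rm LCG/CF}_{\rm RGZ}=S^{\rm LCG/CF}_{\rm GZ}+\frac{m^2}2\int A^{h,a}_\mu A^{h,a}_\mu-\kappa\int(\bar\varphi^{ab}_\mu\varphi^{ab}_\mu-\bar\omega^{ab}_\mu\omega^{ab}_\mu)$ (so $\kappa=M^2$ in the usual notation). **Statement.** 1. $\xi$, hence $A^h$, exists and is unique for every even $A$, and $\mathcal M(A)$ and $\mathcal M(A)+\kappa$ are invertible (from series with coefficients in $\mathcal D\otimes\Lambda$ onto series with coefficients in $\mathcal F\otimes\Lambda$). 2. $s_{\gamma^2}S_{\rm GZ}=s_{\gamma^2}S^{\rm LCG}_{\rm GZ}=s_{\gamma^2}S^{\rm CF}_{\rm GZ}=0$ for $\kappa'=0$, and $s_{\gamma^2}S^{\rm LCG}_{\rm RGZ}=s_{\gamma^2}S^{\rm CF}_{\rm RGZ}=0$ for $\kappa'=\kappa$.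 3. $s_{\gamma^2}$ is an odd vector field on the space of fields and $s_{\gamma^2}^2=0$ on all fields (for $\kappa'=0$ and $\kappa'=\kappa$). 4. $s_{\gamma^2}=s$ at $\gamma^2=0$, and $s_{\gamma^2}\Phi\to s\Phi$ as $\gamma\to0$ for every $\Phi$ (after applying any linear functional to any coefficient of $g^n$ of any component). 5. There is a non-local formal power series $R^a[A](x)=\int d^dy\,R^a(y,x)$ in $A$ with $H(A)=H(A^h)-\int d^dx\,R^a[A]\,\partial_\mu A^a_\mu$, and every such $R$ has a BRST variation $sR$. For every such $R$, let $b^{h,a}=b^a-\gamma^4R^a[A]$. In the variables with $b^h$ the operator $s$ reads $s\bar c^a=b^{h,a}+\gamma^4R^a$, $sb^{h,a}=-\gamma^4sR^a$ (other fields as above), and with $$\delta_{\gamma^2}\bar c^a=-\gamma^4R^a,\quad \delta_{\gamma^2}b^{h,a}=\gamma^4sR^a,\quad \delta_{\gamma^2}\bar\omega^{ab}_\mu=-\gamma^2gf^{cdb}\int d^dy\,A^{h,c}_\mu(y)\big[(\mathcal M(A^h)+\kappa')^{-1}\big]^{da}(y,x)$$ and $\delta_{\gamma^2}=0$ on the other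 fields, one has $s_{\gamma^2}=s+\delta_{\gamma^2}$, $s^2=0$, $\delta_{\gamma^2}^2=0$ and $\{s,\delta_{\gamma^2}\}=0$ on all fields; moreover $\delta_{\gamma^2}=0$ at $\gamma^2=0$ and $\delta_{\gamma^2}\to0$ as $\gamma\to0$. -/

import Mathlib

open Filter MeasureTheory
open scoped TensorProduct ContDiff Topology

noncomputable section

namespace GribovZwanziger

/-! ### Functions on a region of Euclidean space -/

/-- Euclidean `d`-dimensional space. -/
abbrev Space (d : ℕ) := EuclideanSpace ℝ (Fin d)

/-- The part of Euclidean space on which the fields live: a bounded open set with negligible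
frontier (finite volume). -/
structure Region (d : ℕ) where
  carrier : Set (Space d)
  isOpen : IsOpen carrier
  isBounded : Bornology.IsBounded carrier
  frontier_null : volume (frontier carrier) = 0

variable {d : ℕ}

/-- `C^∞` functions up to the boundary: restrictions to the region of smooth functions on the
whole space. -/
def smoothFun (Ω : Region d) : Subalgebra ℝ (Ω.carrier → ℝ) where
  carrier := {f | ∃ F : Space d → ℝ, ContDiff ℝ ∞ F ∧ ∀ x, f x = F x}
  mul_mem' := by
    rintro f g ⟨F, hF, hf⟩ ⟨G, hG, hg⟩
    exact ⟨fun x => F x * G x, hF.mul hG, fun x => by simp [hf, hg]⟩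
  add_mem' := by
    rintro f g ⟨F, hF, hf⟩ ⟨G, hG, hg⟩
    exact ⟨fun x => F x + G x, hF.add hG, fun x => by simp [hf, hg]⟩
  algebraMap_mem' := fun r => ⟨fun _ => r, contDiff_const, fun _ => rfl⟩

/-- The functions in `C^∞` up to the boundary which vanish on the boundary. -/
def dirichlet (Ω : Region d) : Submodule ℝ (smoothFun Ω) where
  carrier := {f | ∃ F : Space d → ℝ, ContDiff ℝ ∞ F ∧ (∀ x, f.1 x = F x) ∧
    ∀ y ∈ frontier Ω.carrier, F y = 0}
  add_mem' := by
    rintro f g ⟨F, hF, hf, hf0⟩ ⟨G, hG, hg, hg0⟩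
    exact ⟨fun x => F x + G x, hF.add hG, fun x => by simp [hf, hg],
      fun y hy => by simp [hf0 y hy, hg0 y hy]⟩
  zero_mem' := ⟨fun _ => 0, contDiff_const, fun _ => rfl, fun _ _ => rfl⟩
  smul_mem' := by
    rintro r f ⟨F, hF, hf, hf0⟩
    exact ⟨fun x => r * F x, contDiff_const.mul hF, fun x => by simp [hf],
      fun y hy => by simp [hf0 y hy]⟩

/-- A smooth function on the whole space with the given restriction. -/
def ext {Ω : Region d} (f : smoothFun Ω) : Space d → ℝ := f.2.choose

theorem ext_smooth {Ω : Region d} (f : smoothFun Ω) : ContDiff ℝ ∞ (ext f) := f.2.choose_spec.1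

theorem ext_eq {Ω : Region d} (f : smoothFun Ω) (x : Ω.carrier) : f.1 x = ext f x :=
  f.2.choose_spec.2 x

theorem fderiv_eq_of_eqOn {Ω : Region d} {F G : Space d → ℝ} (h : ∀ x : Ω.carrier, F x = G x)
    (x : Ω.carrier) : fderiv ℝ F x = fderiv ℝ G x := by
  apply Filter.EventuallyEq.fderiv_eq
  filter_upwards [Ω.isOpen.mem_nhds x.2] with y hy using h ⟨y, hy⟩

/-- The partial derivative `∂_μ`. -/
def pdFun (Ω : Region d) (μ : Fin d) : smoothFun Ω →ₗ[ℝ] smoothFun Ω where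
  toFun f := ⟨fun x => fderiv ℝ (ext f) x (EuclideanSpace.single μ 1),
    fun x => fderiv ℝ (ext f) x (EuclideanSpace.single μ 1),
    ((ext_smooth f).fderiv_right (m := ∞) (by simp)).clm_apply contDiff_const, fun _ => rfl⟩
  map_add' f g := by
    ext x
    have h : fderiv ℝ (ext (f + g)) x = fderiv ℝ (fun y => ext f y + ext g y) x :=
      fderiv_eq_of_eqOn (fun y => by rw [← ext_eq, ← ext_eq, ← ext_eq]; rfl) x
    have hf := ((ext_smooth f).differentiable (by simp)).differentiableAt (x := (x : Space d))
    have hg := ((ext_smooth g).differentiable (by simp)).differentiableAt (x := (x : Space d))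
    simp only [Subalgebra.coe_add, Pi.add_apply, h]
    rw [fderiv_fun_add hf hg]
    rfl
  map_smul' r f := by
    ext x
    have h : fderiv ℝ (ext (r • f)) x = fderiv ℝ (fun y => r • ext f y) x :=
      fderiv_eq_of_eqOn (fun y => by rw [← ext_eq, ← ext_eq]; rfl) x
    have hf := ((ext_smooth f).differentiable (by simp)).differentiableAt (x := (x : Space d))
    simp only [h, RingHom.id_apply]
    rw [fderiv_fun_const_smul hf]
    rfl

theorem integrableOn_ext {Ω : Region d} (f : smoothFun Ω) : IntegrableOn (ext f) Ω.carrier :=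
  ((ext_smooth f).continuous.continuousOn.integrableOn_compact
    Ω.isBounded.isCompact_closure).mono_set subset_closure

/-- The integral `∫ d^dx` over the region (Lebesgue measure). -/
def intFun (Ω : Region d) : smoothFun Ω →ₗ[ℝ] ℝ where
  toFun f := ∫ x in Ω.carrier, ext f x
  map_add' f g := by
    rw [← integral_add (integrableOn_ext f) (integrableOn_ext g)]
    refine setIntegral_congr_fun Ω.isOpen.measurableSet fun x hx => ?_
    have h1 := ext_eq (f + g) ⟨x, hx⟩
    have h2 := ext_eq f ⟨x, hx⟩
    have h3 := ext_eq g ⟨x, hx⟩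
    simp only at h1 h2 h3 ⊢
    rw [← h1, ← h2, ← h3]
    rfl
  map_smul' r f := by
    rw [RingHom.id_apply, smul_eq_mul, ← integral_const_mul]
    refine setIntegral_congr_fun Ω.isOpen.measurableSet fun x hx => ?_
    have h1 := ext_eq (r • f) ⟨x, hx⟩
    have h2 := ext_eq f ⟨x, hx⟩
    simp only at h1 h2 ⊢
    rw [← h1, ← h2]
    rfl

/-- The operator `-∂² + κ` with vanishing boundary values is invertible on functions which are
smooth up to the boundary. -/
def Region.DirichletSolvable (Ω : Region d) (κ : ℝ) : Prop :=
  ∀ f : smoothFun Ω, ∃! u : smoothFun Ω, u ∈ dirichlet Ω ∧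
    -(∑ μ, pdFun Ω μ (pdFun Ω μ u)) + κ • u = f

/-! ### Grassmann-valued functions and formal power series in the coupling -/

/-- The Grassmann algebra on countably many generators. -/
abbrev Grassmann := ExteriorAlgebra ℝ (ℕ →₀ ℝ)

/-- Even (`i = 0`) and odd (`i = 1`) elements of the Grassmann algebra. -/
def grade (i : ZMod 2) : Submodule ℝ Grassmann :=
  CliffordAlgebra.evenOdd (0 : QuadraticForm ℝ (ℕ →₀ ℝ)) i

/-- Grassmann-valued smooth functions on the region. -/
abbrev GFun (Ω : Region d) := smoothFun Ω ⊗[ℝ] Grassmann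

/-- Formal power series in the coupling constant `g` of Grassmann-valued functions. -/
abbrev Ser (Ω : Region d) := PowerSeries (GFun Ω)

/-- Formal power series in `g` of Grassmann numbers: the values of integrated functionals. -/
abbrev Num := PowerSeries Grassmann

/-- The coupling constant. -/
def g {Ω : Region d} : Ser Ω := PowerSeries.X

/-- A constant Grassmann number as a function. -/
def cst (Ω : Region d) (θ : Grassmann) : Ser Ω := PowerSeries.C ((1 : smoothFun Ω) ⊗ₜ[ℝ] θ)

/-- A linear operator on functions, acting on Grassmann-valued series coefficientwise. -/
def op {Ω : Region d} (L : smoothFun Ω →ₗ[ℝ] smoothFun Ω) (u : Ser Ω) : Ser Ω :=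
  PowerSeries.mk fun n => L.rTensor Grassmann (PowerSeries.coeff n u)

/-- The partial derivative of a field. -/
def pd {Ω : Region d} (μ : Fin d) (u : Ser Ω) : Ser Ω := op (pdFun Ω μ) u

/-- The integral of a density. -/
def integ {Ω : Region d} (u : Ser Ω) : Num :=
  PowerSeries.mk fun n =>
    TensorProduct.lid ℝ Grassmann ((intFun Ω).rTensor Grassmann (PowerSeries.coeff n u))

/-- Fields of Grassmann parity `i`. -/
def HasParity {Ω : Region d} (i : ZMod 2) (u : Ser Ω) : Prop :=
  ∀ n, PowerSeries.coeff n u ∈ (grade i).baseChange (smoothFun Ω)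

/-- Fields which vanish on the boundary. -/
def InDirichlet {Ω : Region d} (u : Ser Ω) : Prop :=
  ∀ n, PowerSeries.coeff n u ∈ LinearMap.range ((dirichlet Ω).subtype.rTensor Grassmann)

/-! ### The gauge group -/

/-- The colour index. -/
abbrev Colour (N : ℕ) := Fin (N ^ 2 - 1)

/-- Hermitian traceless generators of `SU(N)` with their structure constants. -/
structure SUGenerators (N : ℕ) where
  T : Colour N → Matrix (Fin N) (Fin N) ℂ
  f : Colour N → Colour N → Colour N → ℝ
  hermitian : ∀ a, (T a).IsHermitian
  traceless : ∀ a, (T a).trace = 0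
  trace_mul : ∀ a b, (T a * T b).trace = if a = b then 1 / 2 else 0
  comm : ∀ a b, T a * T b - T b * T a = ∑ c, (Complex.I * (f a b c : ℂ)) • T c

section

variable {N : ℕ} (T : SUGenerators N) {Ω : Region d}

/-- The bracket `(u × v)^a = f^{abc} u^b v^c`, that is, `-i [u, v] = (u × v)^a T^a` for matrices
`u = u^a T^a`, `v = v^a T^a` with `u` even. -/
def cross (u v : Colour N → Ser Ω) : Colour N → Ser Ω :=
  fun a => ∑ b, ∑ c, T.f a b c • (u b * v c)

/-- A gauge potential `A_μ^a`. -/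
abbrev Potential (Ω : Region d) (N : ℕ) := Fin d → Colour N → Ser Ω

/-- Gauge potentials are Grassmann even. -/
def IsPotential (A : Potential Ω N) : Prop := ∀ μ a, HasParity 0 (A μ a)

/-- The covariant derivative `D_μ^{ab} u^b = ∂_μ u^a - g f^{abc} A_μ^c u^b`. -/
def covD (A : Potential Ω N) (μ : Fin d) (u : Colour N → Ser Ω) : Colour N → Ser Ω :=
  fun a => pd μ (u a) - ∑ b, ∑ c, T.f a b c • (g * (A μ c * u b))

/-- The Faddeev-Popov operator `M^{ab}(A) = -∂_μ D_μ^{ab}(A)`. -/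
def fp (A : Potential Ω N) (u : Colour N → Ser Ω) : Colour N → Ser Ω :=
  fun a => -∑ μ, pd μ (covD T A μ u a)

/-- `u` solves `(M(A) + κ) u = J` and vanishes on the boundary. -/
def IsFPSolution (κ : ℝ) (A : Potential Ω N) (J u : Colour N → Ser Ω) : Prop :=
  (∀ a, InDirichlet (u a)) ∧ ∀ a, fp T A u a + κ • u a = J a

/-- `(M(A) + κ)⁻¹ J`. -/
def fpInv (κ : ℝ) (A : Potential Ω N) (J : Colour N → Ser Ω) : Colour N → Ser Ω :=
  Classical.epsilon (IsFPSolution T κ A J)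

/-- The field strength `F_{μν}^a = ∂_μ A_ν^a - ∂_ν A_μ^a + g f^{abc} A_μ^b A_ν^c`. -/
def fieldStrength (A : Potential Ω N) (μ ν : Fin d) : Colour N → Ser Ω :=
  fun a => pd μ (A ν a) - pd ν (A μ a) + g * cross T (A μ) (A ν) a

/-! ### The gauge invariant transverse field -/

/-- The gauge transform `h† A_μ h + (i/g) h† ∂_μ h` with `h = exp(i g ξ)`, `ξ = ξ^a T^a`, in colour
components:
`∑ₖ (-i g ad ξ)^k A_μ / k! - ∑ₖ (-i g ad ξ)^k ∂_μ ξ / (k+1)!`, where `-i ad ξ = ξ × ·`. The `k`-th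
term carries the factor `g ^ k`, so each coefficient of the series is a finite sum. -/
def gaugeTransform (ξ : Colour N → Ser Ω) (A : Potential Ω N) : Potential Ω N :=
  fun μ a => PowerSeries.mk fun n => ∑ k ∈ Finset.range (n + 1), PowerSeries.coeff n
    (g ^ k * ((1 / (k.factorial : ℝ)) • ((cross T ξ)^[k] (A μ)) a
      - (1 / ((k + 1).factorial : ℝ)) • ((cross T ξ)^[k] (fun b => pd μ (ξ b))) a))

/-- `ξ` is an even gauge parameter, trivial on the boundary, which makes `A` transverse. -/
def IsDressing (A : Potential Ω N) (ξ : Colour N → Ser Ω) : Prop :=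
  (∀ a, HasParity 0 (ξ a)) ∧ (∀ a, InDirichlet (ξ a)) ∧
    ∀ a, ∑ μ, pd μ (gaugeTransform T ξ A μ a) = 0

/-- The field `A^h`: the transverse representative of the gauge orbit of `A`. -/
def Ah (A : Potential Ω N) : Potential Ω N :=
  gaugeTransform T (Classical.epsilon (IsDressing T A)) A

/-- The source `J_μ^{dc} = f^{dec} A_μ^e` as a function of the colour `d`. -/
def source (A : Potential Ω N) (μ : Fin d) (c : Colour N) : Colour N → Ser Ω :=
  fun a => ∑ e, T.f a e c • A μ e

/-- The horizon function
`H(A) = g² ∫ d^dx d^dy f^{abc} A_μ^b(x) [M⁻¹(A)]^{ad}(x,y) f^{dec} A_μ^e(y)`. -/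
def horizon (A : Potential Ω N) : Num :=
  integ (∑ μ, ∑ c, ∑ a, g ^ 2 * (source T A μ c a * fpInv T 0 A (source T A μ c) a))

/-! ### The fields and the BRST transformations -/

/-- The components of the fields `A, c, c̄, b, φ, φ̄, ω, ω̄`. -/
inductive Comp (d N : ℕ)
  | A (μ : Fin d) (a : Colour N)
  | c (a : Colour N)
  | cbar (a : Colour N)
  | b (a : Colour N)
  | phi (μ : Fin d) (a b : Colour N)
  | phibar (μ : Fin d) (a b : Colour N)
  | om (μ : Fin d) (a b : Colour N)
  | ombar (μ : Fin d) (a b : Colour N)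

/-- Grassmann parity of the fields. -/
def Comp.parity : Comp d N → ZMod 2
  | .A _ _ | .b _ | .phi _ _ _ | .phibar _ _ _ => 0
  | .c _ | .cbar _ | .om _ _ _ | .ombar _ _ _ => 1

/-- The fields which vanish on the boundary: the ghost and the localizing fields. -/
def Comp.vanishes : Comp d N → Prop
  | .A _ _ | .b _ | .cbar _ => False
  | .c _ | .phi _ _ _ | .phibar _ _ _ | .om _ _ _ | .ombar _ _ _ => True

/-- Families of field components. -/
abbrev Fields (Ω : Region d) (N : ℕ) := Comp d N → Ser Ω

/-- Field configurations. -/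
def IsConfig (Φ : Fields Ω N) : Prop :=
  ∀ i, HasParity i.parity (Φ i) ∧ (i.vanishes → InDirichlet (Φ i))

/-- The gauge potential of a field configuration. -/
def pot (Φ : Fields Ω N) : Potential Ω N := fun μ a => Φ (.A μ a)

/-- The ghost of a field configuration. -/
def ghost (Φ : Fields Ω N) : Colour N → Ser Ω := fun a => Φ (.c a)

/-- The infinitesimal transformation of the fields `Φ ↦ Φ + θ Q(Φ)` with odd parameter `θ`, for
an odd vector field `Q` (the list of the values of `Q` on the fields). -/
def flow (Q : Fields Ω N → Fields Ω N) (θ : Grassmann) (Φ : Fields Ω N) : Fields Ω N :=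
  Φ + cst Ω θ • Q Φ

/-- `Q` maps fields to functions of the opposite parity with the right boundary values: the
transformations that it generates act on the space of field configurations. -/
def IsOddVectorField (Q : Fields Ω N → Fields Ω N) : Prop :=
  (∀ Φ, IsConfig Φ → ∀ i, HasParity (i.parity + 1) (Q Φ i) ∧ (i.vanishes → InDirichlet (Q Φ i))) ∧
    ∀ Φ, IsConfig Φ → ∀ θ ∈ grade 1, IsConfig (flow Q θ Φ)

/-- `Q X = Y` for the odd derivation `Q` acting on a family `X` of functionals of the fields:
`X(Φ + θ Q(Φ)) = X(Φ) + θ Y(Φ)` for all odd `θ`. As there are infinitely many Grassmann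
generators, this determines `Y`. For `X = P`, a vector field, `Y(Φ)` lists the values `Q P Φ` on
the fields. -/
def Acts {ι : Type} (Q : Fields Ω N → Fields Ω N) (X Y : Fields Ω N → ι → Ser Ω) : Prop :=
  ∀ Φ, IsConfig Φ → ∀ θ ∈ grade 1, X (flow Q θ Φ) = X Φ + cst Ω θ • Y Φ

/-- `Q S = Y` for an integrated functional `S`. -/
def ActsInt (Q : Fields Ω N → Fields Ω N) (S Y : Fields Ω N → Num) : Prop :=
  ∀ Φ, IsConfig Φ → ∀ θ ∈ grade 1, S (flow Q θ Φ) = S Φ + PowerSeries.C θ * Y Φ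

/-- The BRST operator:
`s A = -D c`, `s c^a = (g/2) f^{abc} c^b c^c`, `s c̄ = b`, `s b = 0`, `s φ = ω`, `s ω = 0`,
`s ω̄ = φ̄`, `s φ̄ = 0`. -/
def brst (Φ : Fields Ω N) : Fields Ω N
  | .A μ a => -covD T (pot Φ) μ (ghost Φ) a
  | .c a => (1 / 2 : ℝ) • (g * cross T (ghost Φ) (ghost Φ) a)
  | .cbar a => Φ (.b a)
  | .b _ => 0
  | .phi μ a b => Φ (.om μ a b)
  | .phibar _ _ _ => 0
  | .om _ _ _ => 0
  | .ombar μ a b => Φ (.phibar μ a b)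

/-- The shift
`-γ² g f^{cdb} ∫ d^dy A_μ^{h,c}(y) [(M(A^h) + κ)⁻¹]^{da}(y,x)` of `ω̄_μ^{ab}`. The kernel of the
hermitian operator `M(A^h) + κ` is symmetric, so this is
`-γ² g ((M(A^h) + κ)⁻¹)^{ad} (f^{cdb} A_μ^{h,c})`. -/
def omShift (G κ : ℝ) (A : Potential Ω N) (μ : Fin d) (a b : Colour N) : Ser Ω :=
  -(G • (g * fpInv T κ (Ah T A) (fun e => ∑ c, T.f c e b • Ah T A μ c) a))

/-- The non-perturbative BRST operator `s_{γ²}`, with `G = γ²`, on the fields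
`A, c, c̄, b^h, φ, φ̄, ω, ω̄`; the component `b` of a configuration stands for `b^h`. -/
def sGamma (G κ : ℝ) (Φ : Fields Ω N) : Fields Ω N
  | .A μ a => -covD T (pot Φ) μ (ghost Φ) a
  | .c a => (1 / 2 : ℝ) • (g * cross T (ghost Φ) (ghost Φ) a)
  | .cbar a => Φ (.b a)
  | .b _ => 0
  | .phi μ a b => Φ (.om μ a b)
  | .phibar _ _ _ => 0
  | .om _ _ _ => 0
  | .ombar μ a b => Φ (.phibar μ a b) + omShift T G κ (pot Φ) μ a b

/-- Non-local polynomial functionals of the gauge potential: generated by the components of `A`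
and fixed functions through sums, products and linear operators on functions. -/
inductive IsNonlocalPoly : (Potential Ω N → Ser Ω) → Prop
  | const (u : PowerSeries (smoothFun Ω)) :
      IsNonlocalPoly fun _ =>
        PowerSeries.map (Algebra.TensorProduct.includeLeft (R := ℝ) (S := ℝ)
          (A := smoothFun Ω) (B := Grassmann)).toRingHom u
  | comp (μ : Fin d) (a : Colour N) : IsNonlocalPoly fun A => A μ a
  | add {P Q : Potential Ω N → Ser Ω} :
      IsNonlocalPoly P → IsNonlocalPoly Q → IsNonlocalPoly fun A => P A + Q A
  | mul {P Q : Potential Ω N → Ser Ω} :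
      IsNonlocalPoly P → IsNonlocalPoly Q → IsNonlocalPoly fun A => P A * Q A
  | linear (L : smoothFun Ω →ₗ[ℝ] smoothFun Ω) {P : Potential Ω N → Ser Ω} :
      IsNonlocalPoly P → IsNonlocalPoly fun A => op L (P A)

/-- Non-local formal power series in the gauge potential: up to every order in `g` a non-local
polynomial. -/
def IsNonlocalSeries (P : Potential Ω N → Ser Ω) : Prop :=
  ∀ n : ℕ, ∃ P' : Potential Ω N → Ser Ω, IsNonlocalPoly P' ∧ ∀ A, IsPotential A → ∀ k ≤ n,
    PowerSeries.coeff k (P A) = PowerSeries.coeff k (P' A)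

/-- `R^a[A](x) = ∫ d^dy R^a(y,x)`, a formal power series in `A` with
`H(A) = H(A^h) - ∫ d^dx d^dy R^a(x,y) ∂_μ A_μ^a(y)`. -/
def IsHorizonRemainder (R : Potential Ω N → Colour N → Ser Ω) : Prop :=
  (∀ a, IsNonlocalSeries fun A => R A a) ∧
    ∀ A, IsPotential A →
      horizon T A = horizon T (Ah T A) - integ (∑ a, R A a * ∑ μ, pd μ (A μ a))

/-- The change of variable `b^h = b - γ⁴ R[A]`. -/
def toBh (G : ℝ) (R : Potential Ω N → Colour N → Ser Ω) (Φ : Fields Ω N) : Fields Ω N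
  | .b a => Φ (.b a) - G ^ 2 • R (pot Φ) a
  | i => Φ i

/-- The BRST operator `s` in the variables with `b^h`:
`s c̄ = b = b^h + γ⁴ R` and `s b^h = -γ⁴ s R`. -/
def sBh (G : ℝ) (R : Potential Ω N → Colour N → Ser Ω) (sR : Fields Ω N → Colour N → Ser Ω)
    (Φ : Fields Ω N) : Fields Ω N
  | .A μ a => -covD T (pot Φ) μ (ghost Φ) a
  | .c a => (1 / 2 : ℝ) • (g * cross T (ghost Φ) (ghost Φ) a)
  | .cbar a => Φ (.b a) + G ^ 2 • R (pot Φ) a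
  | .b a => -(G ^ 2 • sR Φ a)
  | .phi μ a b => Φ (.om μ a b)
  | .phibar _ _ _ => 0
  | .om _ _ _ => 0
  | .ombar μ a b => Φ (.phibar μ a b)

/-- The deformation `δ_{γ²}`. -/
def deltaGamma (G κ : ℝ) (R : Potential Ω N → Colour N → Ser Ω)
    (sR : Fields Ω N → Colour N → Ser Ω) (Φ : Fields Ω N) : Fields Ω N
  | .A _ _ => 0
  | .c _ => 0
  | .cbar a => -(G ^ 2 • R (pot Φ) a)
  | .b a => G ^ 2 • sR Φ a
  | .phi _ _ _ => 0
  | .phibar _ _ _ => 0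
  | .om _ _ _ => 0
  | .ombar μ a b => omShift T G κ (pot Φ) μ a b

/-! ### The actions -/

/-- The Yang-Mills action `(1/4) ∫ F_{μν}^a F_{μν}^a`. -/
def actionYM (Φ : Fields Ω N) : Num :=
  integ ((1 / 4 : ℝ) • ∑ μ, ∑ ν, ∑ a,
    fieldStrength T (pot Φ) μ ν a * fieldStrength T (pot Φ) μ ν a)

/-- `∫ (b^{h,a} ∂_μ A_μ^a + c̄^a ∂_μ D_μ^{ab} c^b)`. -/
def actionLandau (Φ : Fields Ω N) : Num :=
  integ (∑ a, (Φ (.b a) * ∑ μ, pd μ (Φ (.A μ a))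
    + Φ (.cbar a) * ∑ μ, pd μ (covD T (pot Φ) μ (ghost Φ) a)))

/-- `-(α/2) ∫ b^{h,a} b^{h,a}`. -/
def actionAlpha (α : ℝ) (Φ : Fields Ω N) : Num :=
  integ (-((α / 2) • ∑ a, Φ (.b a) * Φ (.b a)))

/-- `∫ ((α/2) g f^{abc} b^{h,a} c̄^b c^c + (α/8) g² f^{abc} f^{cde} c̄^a c̄^b c^d c^e)`. -/
def actionGhostInt (α : ℝ) (Φ : Fields Ω N) : Num :=
  integ ((α / 2) • (g * ∑ a, ∑ b, ∑ c, T.f a b c • (Φ (.b a) * Φ (.cbar b) * Φ (.c c)))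
    + (α / 8) • (g ^ 2 * ∑ a, ∑ b, ∑ c, ∑ e, ∑ e', (T.f a b c * T.f c e e') •
      (Φ (.cbar a) * Φ (.cbar b) * Φ (.c e) * Φ (.c e'))))

/-- The localizing part, with `G = γ²`:
`-∫ (φ̄_μ^{ac} M^{ab}(A^h) φ_μ^{bc} - ω̄_μ^{ac} M^{ab}(A^h) ω_μ^{bc})
  + γ² ∫ g f^{abc} A_μ^{h,a} (φ + φ̄)_μ^{bc}`. -/
def actionLoc (G : ℝ) (Φ : Fields Ω N) : Num :=
  integ (-(∑ μ, ∑ c, ∑ a,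
      (Φ (.phibar μ a c) * fp T (Ah T (pot Φ)) (fun b => Φ (.phi μ b c)) a
        - Φ (.ombar μ a c) * fp T (Ah T (pot Φ)) (fun b => Φ (.om μ b c)) a))
    + G • (g * ∑ μ, ∑ a, ∑ b, ∑ c, T.f a b c •
        (Ah T (pot Φ) μ a * (Φ (.phi μ b c) + Φ (.phibar μ b c)))))

/-- The refinement `(m²/2) ∫ A_μ^{h,a} A_μ^{h,a} - κ ∫ (φ̄_μ^{ab} φ_μ^{ab} - ω̄_μ^{ab} ω_μ^{ab})`,
with `m2 = m²` and `κ = M²`. -/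
def actionRef (m2 κ : ℝ) (Φ : Fields Ω N) : Num :=
  integ ((m2 / 2) • (∑ μ, ∑ a, Ah T (pot Φ) μ a * Ah T (pot Φ) μ a)
    - κ • ∑ μ, ∑ a, ∑ b, (Φ (.phibar μ a b) * Φ (.phi μ a b)
        - Φ (.ombar μ a b) * Φ (.om μ a b)))

/-- The Gribov-Zwanziger action in the Landau gauge, written with `A^h` and `b^h`. -/
def actionGZ (G : ℝ) (Φ : Fields Ω N) : Num :=
  actionYM T Φ + actionLandau T Φ + actionLoc T G Φ

/-- The Gribov-Zwanziger action in linear covariant gauges. -/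
def actionGZ_LCG (G α : ℝ) (Φ : Fields Ω N) : Num :=
  actionYM T Φ + (actionLandau T Φ + actionAlpha α Φ) + actionLoc T G Φ

/-- The refined Gribov-Zwanziger action in linear covariant gauges. -/
def actionRGZ_LCG (G α m2 κ : ℝ) (Φ : Fields Ω N) : Num :=
  actionGZ_LCG T G α Φ + actionRef T m2 κ Φ

/-- The Gribov-Zwanziger action in Curci-Ferrari gauges. -/
def actionGZ_CF (G α : ℝ) (Φ : Fields Ω N) : Num :=
  actionYM T Φ + (actionLandau T Φ + actionAlpha α Φ + actionGhostInt T α Φ) + actionLoc T G Φ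

/-- The refined Gribov-Zwanziger action in Curci-Ferrari gauges. -/
def actionRGZ_CF (G α m2 κ : ℝ) (Φ : Fields Ω N) : Num :=
  actionGZ_CF T G α Φ + actionRef T m2 κ Φ

end

end GribovZwanziger

end

open GribovZwanziger

/-! Everything is perturbative in `g`, and at order zero every operator to be inverted is `-∂² + κ`
with vanishing boundary values. The dressing equation, the Faddeev-Popov equation, its transpose and
the equation for the remainder `R` all have the form `(-∂² + κ) u = N(u)`, where `N` improves the
order of agreement of two series by one (`IsContraction`). Composed with the Green operator, `N` has
a unique fixed point, the limit of its iterates (`IsGreen.existsUnique`). Parity, boundary values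
and non-local dependence on `A` pass from the iterates to the limit.

The central fact is that `A^h` is BRST invariant (`IsGreen.dressed_invariant`). The BRST variation
of `A` is the infinitesimal gauge transformation `A - D(θc)`. With `φ(x) = (exp x - 1)/x`, there is
an odd `ζ` vanishing on the boundary with `exp(g ad ξ) c + φ(g ad ξ) ζ = 0`, and then transforming
`A - D(θc)` by `ξ + θζ` gives the same potential as transforming `A` by `ξ`. This potential is
transverse, so by uniqueness `ξ + θζ` is the dressing of the varied potential.

Nilpotency says that the components of `s_{γ²}` are themselves invariant: `D c` and `c × c` by the
Jacobi identity, the shift of `ω̄` because it depends on `A^h` only. In the actions, the gauge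
fixing terms cancel in pairs and the Yang-Mills term is gauge invariant. The horizon source `γ² g f
A^h φ` varies into a term with `ω`, which the shift of `ω̄` cancels: `A^h` is transverse, hence
`M(A^h) + κ` is symmetric under the integral and may be moved from `ω` onto the shift, where it
meets its own inverse.

For the remainder, a resolvent identity (`horizon_sub`) gives `H(A^h) - H(A) = ∫ (A^h - A)_ν k_ν`
with an explicit kernel `k`, and `A^h - A = -φ(g ad ξ) D ξ`. Choose `r`, zero on the boundary, with
`∑ D_ν φ(-g ad ξ)(∂_ν r - k_ν) = 0`. Transposing `φ` and integrating by parts against `ξ` shows that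
`k_ν` may be replaced by `∂_ν r`. Since `∂A^h = 0`, what remains is `∫ r ∂A`, so `R = r` works.

Any admissible `R` is a limit of non-local polynomials and so varies linearly in odd parameters,
which gives `sR`. Because there are infinitely many Grassmann generators, a series killed by all odd
constants is zero; hence `sR` is unique, depends on `A` and `c` only, and satisfies `s(sR) = 0`. The
relations between `s` and `δ_{γ²}` follow component by component, since `δ_{γ²}` does not move `A`
and `c`.

The argument is carried out over an abstract `Calculus`, of which Grassmann-valued functions on the
region are an instance. -/

noncomputable section

namespace GribovZwanziger

/-! ### Structure constants -/

/-- Totally antisymmetric real structure constants satisfying the Jacobi identity. -/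
structure IsStructureConst {C : Type} [Fintype C] (f : C → C → C → ℝ) : Prop where
  swap_left : ∀ a b c, f a b c = -f b a c
  swap_right : ∀ a b c, f a b c = -f a c b
  jacobi : ∀ a b c d, ∑ e, (f a b e * f e c d + f a c e * f e d b + f a d e * f e b c) = 0

theorem SUGenerators.trace_comm_mul {N : ℕ} (T : SUGenerators N) (a b c : Colour N) :
    ((T.T a * T.T b - T.T b * T.T a) * T.T c).trace = Complex.I * (T.f a b c : ℂ) * (1 / 2) := by
  rw [T.comm, Finset.sum_mul, Matrix.trace_sum]
  simp [T.trace_mul]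

/-- The trace form extracts `f` from traces of triple products. Antisymmetry is then the cyclicity
of the trace, and the Jacobi identity for `f` is that of matrix commutators, expanded in the
generators. -/
theorem SUGenerators.isStructureConst {N : ℕ} (T : SUGenerators N) : IsStructureConst T.f := by
  have key : ∀ a b c a' b' c' : Colour N,
      ((T.T a * T.T b - T.T b * T.T a) * T.T c).trace
        = -((T.T a' * T.T b' - T.T b' * T.T a') * T.T c').trace → T.f a b c = -T.f a' b' c' := by
    intro a b c a' b' c' h
    rw [T.trace_comm_mul, T.trace_comm_mul] at h
    have h2 : (T.f a b c : ℂ) = -(T.f a' b' c' : ℂ) := by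
      have hI : Complex.I * (1 / 2) ≠ 0 := by simp
      apply mul_left_cancel₀ hI
      linear_combination h
    exact_mod_cast h2
  have h1 : ∀ a b c, T.f a b c = -T.f b a c := by
    intro a b c
    apply key
    rw [← Matrix.trace_neg, ← neg_mul, neg_sub]
  have h2 : ∀ a b c, T.f a b c = -T.f a c b := by
    intro a b c
    apply key
    simp only [sub_mul, Matrix.trace_sub]
    rw [Matrix.trace_mul_cycle (T.T a) (T.T b) (T.T c),
      Matrix.trace_mul_cycle (T.T b) (T.T a) (T.T c),
      Matrix.trace_mul_cycle (T.T a) (T.T c) (T.T b),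
      Matrix.trace_mul_cycle (T.T c) (T.T a) (T.T b),
      Matrix.trace_mul_cycle (T.T b) (T.T c) (T.T a),
      Matrix.trace_mul_cycle (T.T c) (T.T b) (T.T a),
      Matrix.trace_mul_cycle (T.T a) (T.T c) (T.T b),
      Matrix.trace_mul_cycle (T.T a) (T.T b) (T.T c)]
    ring
  refine ⟨h1, h2, fun a b c d => ?_⟩
  -- A double commutator expanded in the generators; the sign comes from `i² = -1`.
  have hcc : ∀ x y z : Colour N,
      T.T x * (T.T y * T.T z - T.T z * T.T y) - (T.T y * T.T z - T.T z * T.T y) * T.T x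
        = -∑ w, ((∑ e, T.f w x e * T.f e y z : ℝ) : ℂ) • T.T w := by
    intro x y z
    have e1 : T.T x * (T.T y * T.T z - T.T z * T.T y) - (T.T y * T.T z - T.T z * T.T y) * T.T x
        = ∑ e, (Complex.I * (T.f y z e : ℂ)) • (T.T x * T.T e - T.T e * T.T x) := by
      rw [T.comm, Finset.mul_sum, Finset.sum_mul, ← Finset.sum_sub_distrib]
      refine Finset.sum_congr rfl fun e _ => ?_
      rw [Matrix.mul_smul, Matrix.smul_mul, smul_sub]
    rw [e1]
    simp only [T.comm, Finset.smul_sum, smul_smul]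
    rw [Finset.sum_comm, ← Finset.sum_neg_distrib]
    refine Finset.sum_congr rfl fun w _ => ?_
    rw [← neg_smul, ← Finset.sum_smul]
    congr 1
    push_cast
    rw [← Finset.sum_neg_distrib]
    refine Finset.sum_congr rfl fun e _ => ?_
    have : T.f x e w = T.f w x e := by rw [h2, h1 x w e]; ring
    have h' : T.f y z e = T.f e y z := by rw [h2, h1 y e z]; ring
    rw [this, h']
    linear_combination (T.f w x e * T.f e y z : ℂ) * Complex.I_mul_I
  have hj : ∑ w, ((∑ e, T.f w b e * T.f e c d + ∑ e, T.f w c e * T.f e d b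
      + ∑ e, T.f w d e * T.f e b c : ℝ) : ℂ) • T.T w = 0 := by
    have e := congrArg₂ (· + ·) (congrArg₂ (· + ·) (hcc b c d) (hcc c d b)) (hcc d b c)
    rw [← neg_add, ← neg_add, ← Finset.sum_add_distrib, ← Finset.sum_add_distrib] at e
    rw [← neg_eq_zero]
    refine Eq.trans ?_ (e.symm.trans ?_)
    · congr 1
      refine Finset.sum_congr rfl fun w _ => ?_
      rw [← add_smul, ← add_smul]
      push_cast
      rfl
    · noncomm_ring
  -- The trace against `T a` isolates the coefficient of `T a`, up to the factor `1/2`.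
  have ht := congrArg (fun M => (M * T.T a).trace) hj
  simp only [Finset.sum_mul, Matrix.trace_sum, Matrix.smul_mul, Matrix.trace_smul, T.trace_mul,
    Matrix.zero_mul, Matrix.trace_zero, smul_eq_mul, mul_ite, mul_zero, Finset.sum_ite_eq',
    Finset.mem_univ, if_true] at ht
  have h3 : ((∑ e, T.f a b e * T.f e c d + ∑ e, T.f a c e * T.f e d b
      + ∑ e, T.f a d e * T.f e b c : ℝ) : ℂ) = 0 := by
    rcases mul_eq_zero.1 ht with h | h
    · exact h
    · norm_num at h
  rw [Finset.sum_add_distrib, Finset.sum_add_distrib]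
  exact_mod_cast h3

/-! ### The bracket defined by structure constants -/

section Bracket

variable {C : Type} [Fintype C] {S : Type*} [Ring S] [Algebra ℝ S] (f : C → C → C → ℝ)

/-- The bracket `f^{abc} u^b v^c` with values in an algebra. -/
def bracket (u v : C → S) : C → S := fun a => ∑ b, ∑ c, f a b c • (u b * v c)

/-- The invariant pairing `u^a v^a`. -/
def pair (u v : C → S) : S := ∑ a, u a * v a

theorem bracket_add_left (u u' v : C → S) :
    bracket f (u + u') v = bracket f u v + bracket f u' v := by
  ext a; simp [bracket, add_mul, Finset.sum_add_distrib]

theorem bracket_add_right (u v v' : C → S) :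
    bracket f u (v + v') = bracket f u v + bracket f u v' := by
  ext a; simp [bracket, mul_add, Finset.sum_add_distrib]

theorem bracket_neg_left (u v : C → S) : bracket f (-u) v = -bracket f u v := by
  ext a; simp [bracket]

theorem bracket_neg_right (u v : C → S) : bracket f u (-v) = -bracket f u v := by
  ext a; simp [bracket]

theorem bracket_sub_left (u u' v : C → S) :
    bracket f (u - u') v = bracket f u v - bracket f u' v := by
  rw [sub_eq_add_neg, bracket_add_left, bracket_neg_left, sub_eq_add_neg]

theorem bracket_sub_right (u v v' : C → S) :
    bracket f u (v - v') = bracket f u v - bracket f u v' := by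
  rw [sub_eq_add_neg, bracket_add_right, bracket_neg_right, sub_eq_add_neg]

theorem bracket_zero_left (v : C → S) : bracket f 0 v = 0 := by
  ext a; simp [bracket]

theorem bracket_zero_right (u : C → S) : bracket f u 0 = 0 := by
  ext a; simp [bracket]

theorem bracket_smul_left (r : ℝ) (u v : C → S) : bracket f (r • u) v = r • bracket f u v := by
  ext a
  simp only [bracket, Pi.smul_apply, Finset.smul_sum, smul_mul_assoc]
  exact Finset.sum_congr rfl fun b _ => Finset.sum_congr rfl fun c _ => smul_comm _ _ _

theorem bracket_smul_right (r : ℝ) (u v : C → S) : bracket f u (r • v) = r • bracket f u v := by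
  ext a
  simp only [bracket, Pi.smul_apply, Finset.smul_sum, mul_smul_comm]
  exact Finset.sum_congr rfl fun b _ => Finset.sum_congr rfl fun c _ => smul_comm _ _ _

theorem bracket_mul_left (r : S) (u v : C → S) : bracket f (r • u) v = r • bracket f u v := by
  ext a
  simp only [bracket, Pi.smul_apply, smul_eq_mul, Finset.mul_sum, mul_smul_comm, mul_assoc]

theorem bracket_mul_right (r : S) (u v : C → S) (h : ∀ b, r * u b = u b * r) :
    bracket f u (r • v) = r • bracket f u v := by
  ext a
  simp only [bracket, Pi.smul_apply, smul_eq_mul, Finset.mul_sum, mul_smul_comm]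
  refine Finset.sum_congr rfl fun b _ => Finset.sum_congr rfl fun c _ => ?_
  rw [← mul_assoc, ← h, mul_assoc]

theorem bracket_sum_left {ι : Type*} (s : Finset ι) (u : ι → C → S) (v : C → S) :
    bracket f (∑ i ∈ s, u i) v = ∑ i ∈ s, bracket f (u i) v :=
  map_sum (AddMonoidHom.mk' (fun u => bracket f u v) fun a b => bracket_add_left f a b v) u s

theorem bracket_sum_right {ι : Type*} (s : Finset ι) (u : C → S) (v : ι → C → S) :
    bracket f u (∑ i ∈ s, v i) = ∑ i ∈ s, bracket f u (v i) :=
  map_sum (AddMonoidHom.mk' (fun v => bracket f u v) fun a b => bracket_add_right f u a b) v s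

/-- A derivation of the algebra is a derivation of the bracket. -/
theorem bracket_leibniz (D : S →ₗ[ℝ] S) (hD : ∀ x y, D (x * y) = D x * y + x * D y)
    (u v : C → S) (a : C) : D (bracket f u v a)
      = bracket f (fun b => D (u b)) v a + bracket f u (fun b => D (v b)) a := by
  simp [bracket, hD, Finset.sum_add_distrib]

variable {f}

theorem IsStructureConst.rot (hf : IsStructureConst f) (a b c : C) : f a b c = f b c a := by
  rw [hf.swap_left, hf.swap_right, neg_neg]

theorem IsStructureConst.swap_outer (hf : IsStructureConst f) (a b c : C) :
    f a b c = -f c b a := by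
  rw [hf.rot, hf.swap_left, hf.rot, hf.rot]

theorem bracket_anticomm (hf : IsStructureConst f) {u v : C → S}
    (h : ∀ b c, u b * v c = v c * u b) : bracket f u v = -bracket f v u := by
  ext a
  simp only [bracket, Pi.neg_apply, ← Finset.sum_neg_distrib]
  rw [Finset.sum_comm]
  refine Finset.sum_congr rfl fun c _ => Finset.sum_congr rfl fun b _ => ?_
  rw [h, hf.swap_right, neg_smul]

/-- `u × v` for anticommuting entries is symmetric. -/
theorem bracket_symm (hf : IsStructureConst f) {u v : C → S}
    (h : ∀ b c, u b * v c = -(v c * u b)) : bracket f u v = bracket f v u := by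
  ext a
  simp only [bracket]
  rw [Finset.sum_comm]
  refine Finset.sum_congr rfl fun c _ => Finset.sum_congr rfl fun b _ => ?_
  rw [h, hf.swap_right, smul_neg, neg_smul, neg_neg]

/-- Here and in the next lemma nested brackets are expanded over the ordered monomials `u v w`
without commuting anything. Jacobi-type identities then reduce to identities of structure constants
once the entries are brought to a common order. -/
theorem bracket_bracket_right (u v w : C → S) (a : C) :
    bracket f u (bracket f v w) a
      = ∑ b, ∑ c, ∑ d, (∑ e, f a b e * f e c d) • (u b * (v c * w d)) := by
  simp only [bracket, Finset.mul_sum, Finset.smul_sum, mul_smul_comm, smul_smul, Finset.sum_smul]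
  refine Finset.sum_congr rfl fun b _ => ?_
  rw [Finset.sum_comm]
  refine Finset.sum_congr rfl fun c _ => ?_
  rw [Finset.sum_comm]

theorem bracket_bracket_left (u v w : C → S) (a : C) :
    bracket f (bracket f u v) w a
      = ∑ b, ∑ c, ∑ d, (∑ e, f a e d * f e b c) • (u b * (v c * w d)) := by
  simp only [bracket, Finset.sum_mul, Finset.smul_sum, smul_mul_assoc, smul_smul, Finset.sum_smul,
    mul_assoc]
  rw [Finset.sum_comm]
  refine Eq.trans (Finset.sum_congr rfl fun d _ => Finset.sum_comm) ?_
  rw [Finset.sum_comm]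
  refine Finset.sum_congr rfl fun b _ => ?_
  refine Eq.trans (Finset.sum_congr rfl fun d _ => Finset.sum_comm) ?_
  rw [Finset.sum_comm]

theorem IsStructureConst.jacobi' (hf : IsStructureConst f) (a b c d : C) :
    ∑ e, f a b e * f e c d = ∑ e, f a e d * f e b c + ∑ e, f a c e * f e b d := by
  have h := hf.jacobi a b c d
  rw [Finset.sum_add_distrib, Finset.sum_add_distrib] at h
  have h1 : ∑ e, f a e d * f e b c = -∑ e, f a d e * f e b c := by
    rw [← Finset.sum_neg_distrib]
    exact Finset.sum_congr rfl fun e _ => by rw [hf.swap_right a e d]; ring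
  have h2 : ∑ e, f a c e * f e b d = -∑ e, f a c e * f e d b := by
    rw [← Finset.sum_neg_distrib]
    exact Finset.sum_congr rfl fun e _ => by rw [hf.swap_right e b d]; ring
  linarith

/-- The Jacobi identity `u × (v × w) = (u × v) × w + v × (u × w)`. -/
theorem bracket_jacobi (hf : IsStructureConst f) {u v : C → S} (w : C → S)
    (h : ∀ b c, u b * v c = v c * u b) :
    bracket f u (bracket f v w) = bracket f (bracket f u v) w + bracket f v (bracket f u w) := by
  ext a
  rw [Pi.add_apply, bracket_bracket_right, bracket_bracket_left, bracket_bracket_right v u w,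
    Finset.sum_comm (s := Finset.univ) (t := Finset.univ) (f := fun b c => ∑ d,
      (∑ e, f a b e * f e c d) • (v b * (u c * w d)))]
  simp only [← Finset.sum_add_distrib]
  refine Finset.sum_congr rfl fun b _ => Finset.sum_congr rfl fun c _ =>
    Finset.sum_congr rfl fun d _ => ?_
  rw [← mul_assoc (v c), ← h, mul_assoc, ← add_smul, hf.jacobi']

/-- `2 (u × c) × c = u × (c × c)` for anticommuting `c`. -/
theorem bracket_odd_right (hf : IsStructureConst f) (u : C → S) {c : C → S}
    (h : ∀ a b, c a * c b = -(c b * c a)) :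
    bracket f u (bracket f c c) = (2 : ℝ) • bracket f (bracket f u c) c := by
  ext a
  have key : bracket f (bracket f u c) c a
      = ∑ b, ∑ i, ∑ d, (-∑ e, f a e i * f e b d) • (u b * (c i * c d)) := by
    rw [bracket_bracket_left]
    refine Finset.sum_congr rfl fun b _ => ?_
    rw [Finset.sum_comm]
    refine Finset.sum_congr rfl fun i _ => Finset.sum_congr rfl fun d _ => ?_
    rw [h, mul_neg, smul_neg, neg_smul]
  rw [Pi.smul_apply, two_smul]
  -- Only one of the two copies has its ghosts exchanged, at the cost of a sign. The two copies then
  -- supply the two terms of the Jacobi identity for the left side.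
  nth_rw 2 [key]
  rw [bracket_bracket_left, bracket_bracket_right]
  simp only [← Finset.sum_add_distrib]
  refine Finset.sum_congr rfl fun b _ => Finset.sum_congr rfl fun i _ =>
    Finset.sum_congr rfl fun d _ => ?_
  rw [← add_smul, hf.jacobi', ← Finset.sum_neg_distrib]
  congr 2
  exact Finset.sum_congr rfl fun e _ => by rw [hf.swap_right a i e]; ring

/-- `c × (c × c) = 0` for anticommuting `c`. -/
theorem bracket_odd_self (hf : IsStructureConst f) {c : C → S}
    (h : ∀ a b, c a * c b = -(c b * c a)) : bracket f c (bracket f c c) = 0 := by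
  have h1 := bracket_odd_right hf c h
  -- Entries of `c × c` commute with those of `c`, so the bracket of the two is antisymmetric.
  -- Combined with `h1` this makes three times `(c × c) × c` vanish.
  have h2 : bracket f c (bracket f c c) = -bracket f (bracket f c c) c := by
    apply bracket_anticomm hf
    intro b d
    simp only [bracket, Finset.mul_sum, Finset.sum_mul]
    refine Finset.sum_congr rfl fun i _ => Finset.sum_congr rfl fun j _ => ?_
    rw [mul_smul_comm, smul_mul_assoc, ← mul_assoc, h b i, neg_mul, mul_assoc, h b j, mul_neg,
      neg_neg, mul_assoc]
  rw [h2] at h1 ⊢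
  rw [neg_eq_zero]
  have h3 : (3 : ℝ) • bracket f (bracket f c c) c = 0 := by
    have : (3 : ℝ) = 2 + 1 := by norm_num
    rw [this, add_smul, ← h1, one_smul, neg_add_cancel]
  simpa using h3

/-- Invariance of the pairing: `(u × v) · w = - v · (u × w)`. -/
theorem pair_bracket_left (hf : IsStructureConst f) {u v : C → S} (w : C → S)
    (h : ∀ b c, u b * v c = v c * u b) :
    pair (bracket f u v) w = -pair v (bracket f u w) := by
  simp only [pair, bracket, Finset.sum_mul, Finset.mul_sum, ← Finset.sum_neg_distrib]
  rw [Finset.sum_comm]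
  conv_rhs => rw [Finset.sum_comm]
  refine Finset.sum_congr rfl fun b _ => ?_
  rw [Finset.sum_comm]
  refine Finset.sum_congr rfl fun c _ => Finset.sum_congr rfl fun a _ => ?_
  rw [smul_mul_assoc, mul_smul_comm, h, mul_assoc, hf.swap_outer a b c, neg_smul]

end Bracket

end GribovZwanziger

end

noncomputable section

namespace GribovZwanziger

/-! ### Tensor products with an algebra carrying a parity automorphism -/

section Tensor

variable {F E : Type*} [CommRing F] [Algebra ℝ F] [Ring E] [Algebra ℝ E]

/-- The parity automorphism of `F ⊗ E` induced by one of `E`. -/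
def tensorPar (F : Type*) [CommRing F] [Algebra ℝ F] (τ : E →ₐ[ℝ] E) :
    F ⊗[ℝ] E →ₐ[ℝ] F ⊗[ℝ] E :=
  Algebra.TensorProduct.map (AlgHom.id ℝ F) τ

@[simp] theorem tensorPar_tmul (τ : E →ₐ[ℝ] E) (f : F) (x : E) :
    tensorPar F τ (f ⊗ₜ x) = f ⊗ₜ τ x := rfl

theorem mem_baseChange_induction {V : Submodule ℝ E} {p : F ⊗[ℝ] E → Prop}
    (h0 : p 0) (hadd : ∀ a b, p a → p b → p (a + b))
    (ht : ∀ f, ∀ x ∈ V, p (f ⊗ₜ x)) {u : F ⊗[ℝ] E} (hu : u ∈ V.baseChange F) : p u := by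
  rw [Submodule.baseChange_eq_span] at hu
  -- The predicate is not assumed stable under multiplication by `F`, so the span induction runs on
  -- all multiples of `u` at once.
  have h : ∀ f : F, p (f • u) := by
    induction hu using Submodule.span_induction with
    | mem x hx =>
      obtain ⟨x, hx, rfl⟩ := hx
      intro f
      have := ht f x hx
      rwa [TensorProduct.mk_apply, TensorProduct.smul_tmul', smul_eq_mul, mul_one]
    | zero => intro f; rwa [smul_zero]
    | add a b _ _ ha hb => intro f; rw [smul_add]; exact hadd _ _ (ha f) (hb f)
    | smul f a _ ha => intro f'; rw [smul_smul]; exact ha _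
  simpa using h 1

theorem tensorPar_of_mem {τ : E →ₐ[ℝ] E} {V : Submodule ℝ E} (ε : ℝ)
    (hV : ∀ x ∈ V, τ x = ε • x) {u : F ⊗[ℝ] E} (hu : u ∈ V.baseChange F) :
    tensorPar F τ u = ε • u := by
  refine mem_baseChange_induction (p := fun u => tensorPar F τ u = ε • u) ?_ ?_ ?_ hu
  · simp
  · intro a b ha hb; rw [map_add, ha, hb, smul_add]
  · intro f x hx; rw [tensorPar_tmul, hV x hx, TensorProduct.tmul_smul]

theorem exists_baseChange_add {V W : Submodule ℝ E}
    (h : ∀ x, ∃ y ∈ V, ∃ z ∈ W, x = y + z) (u : F ⊗[ℝ] E) :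
    ∃ u₀ ∈ V.baseChange F, ∃ u₁ ∈ W.baseChange F, u = u₀ + u₁ := by
  induction u using TensorProduct.induction_on with
  | zero => exact ⟨0, Submodule.zero_mem _, 0, Submodule.zero_mem _, (add_zero _).symm⟩
  | tmul f x =>
    obtain ⟨x₀, h₀, x₁, h₁, rfl⟩ := h x
    exact ⟨_, Submodule.tmul_mem_baseChange_of_mem f h₀, _,
      Submodule.tmul_mem_baseChange_of_mem f h₁, TensorProduct.tmul_add _ _ _⟩
  | add a b ha hb =>
    obtain ⟨a₀, ha₀, a₁, ha₁, rfl⟩ := ha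
    obtain ⟨b₀, hb₀, b₁, hb₁, rfl⟩ := hb
    exact ⟨_, Submodule.add_mem _ ha₀ hb₀, _, Submodule.add_mem _ ha₁ hb₁, by abel⟩

/-- Split `u` into its `V` and `W` parts. If `u` has eigenvalue `ε`, the `W` part is an eigenvector
for both `ε` and `-ε`, hence zero. Being of given parity thus becomes an equation. -/
theorem mem_baseChange_iff {τ : E →ₐ[ℝ] E} {V W : Submodule ℝ E} (ε : ℝ) (hε : ε ≠ 0)
    (h : ∀ x, ∃ y ∈ V, ∃ z ∈ W, x = y + z) (hV : ∀ x ∈ V, τ x = ε • x)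
    (hW : ∀ x ∈ W, τ x = (-ε) • x) {u : F ⊗[ℝ] E} :
    u ∈ V.baseChange F ↔ tensorPar F τ u = ε • u := by
  refine ⟨tensorPar_of_mem ε hV, fun hu => ?_⟩
  obtain ⟨u₀, h₀, u₁, h₁, rfl⟩ := exists_baseChange_add h u
  rw [map_add, tensorPar_of_mem ε hV h₀, tensorPar_of_mem (-ε) hW h₁, smul_add, add_right_inj,
    neg_smul] at hu
  have h2 : (2 * ε) • u₁ = 0 := by
    rw [two_mul, add_smul]
    nth_rw 1 [← hu]
    rw [neg_add_cancel]
  rcases smul_eq_zero.1 h2 with h3 | h3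
  · exact absurd h3 (by simpa using hε)
  · rwa [h3, add_zero]

theorem tensor_mul_comm {τ : E →ₐ[ℝ] E} {V : Submodule ℝ E}
    (hV : ∀ x ∈ V, ∀ y, x * y = τ y * x) {u : F ⊗[ℝ] E} (hu : u ∈ V.baseChange F)
    (v : F ⊗[ℝ] E) : u * v = tensorPar F τ v * u := by
  refine mem_baseChange_induction (p := fun u => u * v = tensorPar F τ v * u) ?_ ?_ ?_ hu
  · rw [zero_mul, mul_zero]
  · intro a b ha hb; rw [add_mul, ha, hb, mul_add]
  · intro f x hx
    induction v using TensorProduct.induction_on with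
    | zero => rw [map_zero, zero_mul, mul_zero]
    | tmul h y =>
      rw [tensorPar_tmul, Algebra.TensorProduct.tmul_mul_tmul,
        Algebra.TensorProduct.tmul_mul_tmul, hV x hx, mul_comm]
    | add a b ha hb => rw [mul_add, ha, hb, map_add, add_mul]

theorem tensorPar_rTensor (τ : E →ₐ[ℝ] E) (L : F →ₗ[ℝ] F) (u : F ⊗[ℝ] E) :
    tensorPar F τ (L.rTensor E u) = L.rTensor E (tensorPar F τ u) := by
  induction u using TensorProduct.induction_on with
  | zero => simp
  | tmul f x => simp
  | add a b ha hb => simp only [map_add, ha, hb]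

theorem rTensor_one_tmul_mul (L : F →ₗ[ℝ] F) (θ : E) (u : F ⊗[ℝ] E) :
    L.rTensor E (((1 : F) ⊗ₜ[ℝ] θ) * u) = ((1 : F) ⊗ₜ[ℝ] θ) * L.rTensor E u := by
  induction u using TensorProduct.induction_on with
  | zero => simp
  | tmul f x => simp [Algebra.TensorProduct.tmul_mul_tmul]
  | add a b ha hb => simp only [mul_add, map_add, ha, hb]

theorem rTensor_leibniz {D : F →ₗ[ℝ] F} (hD : ∀ x y, D (x * y) = D x * y + x * D y)
    (u v : F ⊗[ℝ] E) :
    D.rTensor E (u * v) = D.rTensor E u * v + u * D.rTensor E v := by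
  induction u using TensorProduct.induction_on with
  | zero => simp
  | tmul f x =>
    induction v using TensorProduct.induction_on with
    | zero => simp
    | tmul h y => simp [Algebra.TensorProduct.tmul_mul_tmul, hD, TensorProduct.add_tmul]
    | add a b ha hb => simp only [mul_add, map_add, ha, hb]; abel
  | add a b ha hb => simp only [add_mul, map_add, ha, hb]; abel

theorem rTensor_mul_mem {D : Submodule ℝ F} (hD : ∀ f ∈ D, ∀ h, h * f ∈ D) {u : F ⊗[ℝ] E}
    (v : F ⊗[ℝ] E) (hu : u ∈ LinearMap.range (D.subtype.rTensor E)) :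
    v * u ∈ LinearMap.range (D.subtype.rTensor E) ∧
    u * v ∈ LinearMap.range (D.subtype.rTensor E) := by
  obtain ⟨w, rfl⟩ := hu
  induction w using TensorProduct.induction_on with
  | zero => simp
  | tmul f x =>
    induction v using TensorProduct.induction_on with
    | zero => simp
    | tmul h y =>
      refine ⟨⟨⟨h * f, hD f f.2 h⟩ ⊗ₜ (y * x), ?_⟩, ⟨⟨h * f, hD f f.2 h⟩ ⊗ₜ (x * y), ?_⟩⟩
      · simp [Algebra.TensorProduct.tmul_mul_tmul]
      · simp [Algebra.TensorProduct.tmul_mul_tmul, mul_comm]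
    | add a b ha hb =>
      rw [add_mul, mul_add]
      exact ⟨Submodule.add_mem _ ha.1 hb.1, Submodule.add_mem _ ha.2 hb.2⟩
  | add a b ha hb =>
    rw [map_add, add_mul, mul_add]
    exact ⟨Submodule.add_mem _ ha.1 hb.1, Submodule.add_mem _ ha.2 hb.2⟩

theorem rTensor_mem_range {D : Submodule ℝ F} {L : F →ₗ[ℝ] F} (hL : ∀ f, L f ∈ D)
    (u : F ⊗[ℝ] E) : L.rTensor E u ∈ LinearMap.range (D.subtype.rTensor E) := by
  refine ⟨(L.codRestrict D hL).rTensor E u, ?_⟩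
  rw [← LinearMap.comp_apply, ← LinearMap.rTensor_comp]
  rfl

theorem rTensor_eq_of_mem_range {D : Submodule ℝ F} {H : Type*} [AddCommGroup H] [Module ℝ H]
    {L L' : F →ₗ[ℝ] H} (h : ∀ f ∈ D, L f = L' f) {u : F ⊗[ℝ] E}
    (hu : u ∈ LinearMap.range (D.subtype.rTensor E)) : L.rTensor E u = L'.rTensor E u := by
  obtain ⟨w, rfl⟩ := hu
  rw [← LinearMap.comp_apply, ← LinearMap.rTensor_comp, ← LinearMap.comp_apply,
    ← LinearMap.rTensor_comp]
  congr 2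
  ext f : 1
  exact h f f.2

/-- In the application `e m` is the `m`-th Grassmann generator and `κ m` the contraction with it. A
given `u` involves finitely many generators; contracting `e m * u` for a fresh generator gives back
`u`. -/
theorem eq_zero_of_one_tmul_mul {u : F ⊗[ℝ] E} (P : Set E) (e : ℕ → E) (he : ∀ m, e m ∈ P)
    (κ : ℕ → E →ₗ[ℝ] E) (hκ : ∀ x, ∃ M, ∀ m ≥ M, κ m x = 0)
    (hκe : ∀ m x, κ m (e m * x) = x - e m * κ m x)
    (h : ∀ θ ∈ P, ((1 : F) ⊗ₜ[ℝ] θ) * u = 0) : u = 0 := by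
  have h1 : ∃ M, ∀ m ≥ M, (κ m).lTensor F u = 0 := by
    clear h
    induction u using TensorProduct.induction_on with
    | zero => exact ⟨0, fun m _ => map_zero _⟩
    | tmul f x =>
      obtain ⟨M, hM⟩ := hκ x
      exact ⟨M, fun m hm => by rw [LinearMap.lTensor_tmul, hM m hm, TensorProduct.tmul_zero]⟩
    | add a b ha hb =>
      obtain ⟨M, hM⟩ := ha
      obtain ⟨M', hM'⟩ := hb
      exact ⟨max M M', fun m hm => by
        rw [map_add, hM m (le_of_max_le_left hm), hM' m (le_of_max_le_right hm), add_zero]⟩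
  obtain ⟨M, hM⟩ := h1
  have h2 : ∀ w : F ⊗[ℝ] E, (κ M).lTensor F (((1 : F) ⊗ₜ[ℝ] e M) * w)
      = w - ((1 : F) ⊗ₜ[ℝ] e M) * (κ M).lTensor F w := by
    intro w
    induction w using TensorProduct.induction_on with
    | zero => simp
    | tmul f x =>
      simp only [Algebra.TensorProduct.tmul_mul_tmul, one_mul, LinearMap.lTensor_tmul, hκe,
        TensorProduct.tmul_sub]
    | add a b ha hb => simp only [mul_add, map_add, ha, hb]; abel
  have h3 := h2 u
  rw [h _ (he M), hM M le_rfl, mul_zero, sub_zero, map_zero] at h3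
  exact h3.symm

end Tensor

/-! ### Graded commutativity of the Grassmann algebra -/

/-- The parity automorphism of the Grassmann algebra. -/
abbrev gpar : Grassmann →ₐ[ℝ] Grassmann :=
  CliffordAlgebra.involute (Q := (0 : QuadraticForm ℝ (ℕ →₀ ℝ)))

theorem gpar_ι (w : ℕ →₀ ℝ) : gpar (ExteriorAlgebra.ι ℝ w) = -ExteriorAlgebra.ι ℝ w :=
  CliffordAlgebra.involute_ι w

theorem ι_mul_eq (v : ℕ →₀ ℝ) (x : Grassmann) :
    ExteriorAlgebra.ι ℝ v * x = gpar x * ExteriorAlgebra.ι ℝ v := by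
  induction x using ExteriorAlgebra.induction with
  | algebraMap r => simp [Algebra.commutes]
  | ι w =>
    rw [gpar_ι, neg_mul, eq_neg_iff_add_eq_zero]
    exact ExteriorAlgebra.ι_add_mul_swap v w
  | mul a b ha hb => rw [← mul_assoc, ha, mul_assoc, hb, map_mul, mul_assoc]
  | add a b ha hb => rw [mul_add, ha, hb, map_add, add_mul]

theorem mul_comm_of_gpar_eq {x : Grassmann} (hx : gpar x = x) (y : Grassmann) :
    x * y = y * x := by
  induction y using ExteriorAlgebra.induction with
  | algebraMap r => exact (Algebra.commutes r x).symm
  | ι w => rw [ι_mul_eq, hx]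
  | mul a b ha hb => rw [← mul_assoc, ha, mul_assoc, hb, mul_assoc]
  | add a b ha hb => rw [mul_add, ha, hb, add_mul]

theorem mul_comm_of_gpar_eq_neg {x : Grassmann} (hx : gpar x = -x) (y : Grassmann) :
    x * y = gpar y * x := by
  induction y using ExteriorAlgebra.induction with
  | algebraMap r => simp [Algebra.commutes]
  | ι w => rw [gpar_ι, neg_mul, ι_mul_eq, hx, neg_mul, neg_neg]
  | mul a b ha hb => rw [← mul_assoc, ha, mul_assoc, hb, map_mul, mul_assoc]
  | add a b ha hb => rw [mul_add, ha, hb, map_add, add_mul]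

theorem gpar_of_mem_zero {x : Grassmann} (hx : x ∈ grade 0) : gpar x = x :=
  CliffordAlgebra.involute_eq_of_mem_even hx

theorem gpar_of_mem_one {x : Grassmann} (hx : x ∈ grade 1) : gpar x = -x :=
  CliffordAlgebra.involute_eq_of_mem_odd hx

theorem exists_grade_add (x : Grassmann) :
    ∃ x₀ ∈ grade 0, ∃ x₁ ∈ grade 1, x = x₀ + x₁ := by
  have h : x ∈ (grade 0 ⊔ grade 1 : Submodule ℝ Grassmann) := by
    rw [grade, grade, (CliffordAlgebra.evenOdd_isCompl
      (0 : QuadraticForm ℝ (ℕ →₀ ℝ))).sup_eq_top]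
    trivial
  obtain ⟨a, ha, b, hb, h⟩ := Submodule.mem_sup.1 h
  exact ⟨a, ha, b, hb, h.symm⟩

theorem mul_self_of_mem_one {θ : Grassmann} (hθ : θ ∈ grade 1) : θ * θ = 0 := by
  have h := mul_comm_of_gpar_eq_neg (gpar_of_mem_one hθ) θ
  rw [gpar_of_mem_one hθ, neg_mul, eq_neg_iff_add_eq_zero, ← two_smul ℝ] at h
  exact (smul_eq_zero.1 h).resolve_left two_ne_zero

/-- Contraction with the `m`-th basis covector. -/
def contr (m : ℕ) : Grassmann →ₗ[ℝ] Grassmann :=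
  CliffordAlgebra.contractLeft (Q := (0 : QuadraticForm ℝ (ℕ →₀ ℝ))) (Finsupp.lapply m)

theorem contr_ι_mul (m : ℕ) (v : ℕ →₀ ℝ) (x : Grassmann) :
    contr m (ExteriorAlgebra.ι ℝ v * x) = v m • x - ExteriorAlgebra.ι ℝ v * contr m x :=
  CliffordAlgebra.contractLeft_ι_mul (Q := (0 : QuadraticForm ℝ (ℕ →₀ ℝ))) (Finsupp.lapply m) v x

theorem exists_contr_eq_zero (x : Grassmann) : ∃ M, ∀ m ≥ M, contr m x = 0 := by
  induction x using CliffordAlgebra.left_induction with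
  | algebraMap r =>
    exact ⟨0, fun m _ => CliffordAlgebra.contractLeft_algebraMap
      (Q := (0 : QuadraticForm ℝ (ℕ →₀ ℝ))) (Finsupp.lapply m) r⟩
  | add a b ha hb =>
    obtain ⟨M, hM⟩ := ha
    obtain ⟨M', hM'⟩ := hb
    exact ⟨max M M', fun m hm => by
      rw [map_add, hM m (le_of_max_le_left hm), hM' m (le_of_max_le_right hm), add_zero]⟩
  | ι_mul x v hx =>
    obtain ⟨M, hM⟩ := hx
    -- Strictly beyond the support of `v`, so that the contraction does not see `v`.
    refine ⟨max M (v.support.sup id + 1), fun m hm => ?_⟩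
    have hv : v m = 0 := by
      by_contra h
      have h1 := Finset.le_sup (f := id) (Finsupp.mem_support_iff.2 h)
      have h2 := le_of_max_le_right hm
      simp only [id] at h1
      omega
    refine (contr_ι_mul m v x).trans ?_
    rw [hv, hM m (le_of_max_le_left hm), zero_smul, mul_zero, sub_zero]

theorem ι_mem_grade_one (v : ℕ →₀ ℝ) : ExteriorAlgebra.ι ℝ v ∈ grade 1 :=
  CliffordAlgebra.ι_mem_evenOdd_one _ _

end GribovZwanziger

end

noncomputable section

namespace GribovZwanziger

variable {d : ℕ} {Ω : Region d}

/-! ### Calculus on a region -/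

/-- The region is open, so derivatives inside it do not depend on the extension picked by `ext`; any
convenient representative may be used. -/
theorem pdFun_apply_of_eqOn {F : Space d → ℝ} {f : smoothFun Ω} (hf : ∀ x : Ω.carrier, f.1 x = F x)
    (μ : Fin d) (x : Ω.carrier) :
    (pdFun Ω μ f).1 x = fderiv ℝ F x (EuclideanSpace.single μ 1) := by
  change fderiv ℝ (ext f) x (EuclideanSpace.single μ 1) = _
  rw [fderiv_eq_of_eqOn fun y => by rw [← ext_eq, hf]]

theorem intFun_eq_of_eqOn {F : Space d → ℝ} {f : smoothFun Ω}
    (hf : ∀ x : Ω.carrier, f.1 x = F x) : intFun Ω f = ∫ x in Ω.carrier, F x :=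
  setIntegral_congr_fun Ω.isOpen.measurableSet fun x hx => by
    have h1 := ext_eq f ⟨x, hx⟩
    have h2 := hf ⟨x, hx⟩
    simp only at h1 h2 ⊢
    rw [← h1, h2]

theorem pdFun_mul (μ : Fin d) (f h : smoothFun Ω) :
    pdFun Ω μ (f * h) = pdFun Ω μ f * h + f * pdFun Ω μ h := by
  ext x
  have hF := ((ext_smooth f).differentiable (by simp)).differentiableAt (x := (x : Space d))
  have hH := ((ext_smooth h).differentiable (by simp)).differentiableAt (x := (x : Space d))
  have e := pdFun_apply_of_eqOn (F := fun y => ext f y * ext h y) (f := f * h)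
    (fun y => by rw [← ext_eq, ← ext_eq]; rfl) μ x
  rw [e, fderiv_fun_mul hF hH]
  change ext f x * fderiv ℝ (ext h) x _ + ext h x * fderiv ℝ (ext f) x _
    = fderiv ℝ (ext f) x _ * h.1 x + f.1 x * fderiv ℝ (ext h) x _
  rw [ext_eq f, ext_eq h]
  ring

theorem pdFun_comm (μ ν : Fin d) (f : smoothFun Ω) :
    pdFun Ω μ (pdFun Ω ν f) = pdFun Ω ν (pdFun Ω μ f) := by
  have key : ∀ (μ ν : Fin d) (x : Ω.carrier), (pdFun Ω μ (pdFun Ω ν f)).1 x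
      = fderiv ℝ (fderiv ℝ (ext f)) x (EuclideanSpace.single μ 1) (EuclideanSpace.single ν 1) := by
    intro μ ν x
    rw [pdFun_apply_of_eqOn (F := fun y => fderiv ℝ (ext f) y (EuclideanSpace.single ν 1))
      (fun y => rfl)]
    have h : DifferentiableAt ℝ (fderiv ℝ (ext f)) (x : Space d) :=
      ((ext_smooth f).fderiv_right (m := ∞) (by simp)).differentiable (by simp) _
    rw [fderiv_clm_apply h (differentiableAt_const _)]
    simp
  ext x
  rw [key, key]
  exact ((ext_smooth f).contDiffAt.isSymmSndFDerivAt (by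
    rw [minSmoothness_of_isRCLikeNormedField]; exact WithTop.coe_le_coe.2 le_top)) _ _

theorem mul_mem_dirichlet {f : smoothFun Ω} (hf : f ∈ dirichlet Ω) (h : smoothFun Ω) :
    h * f ∈ dirichlet Ω := by
  obtain ⟨F, hF, hf, hf0⟩ := hf
  obtain ⟨H, hH, hh⟩ := h.2
  exact ⟨fun x => H x * F x, hH.mul hF, fun x => by simp [hf, hh], fun y hy => by simp [hf0 y hy]⟩

/-- The extension by zero of a smooth function which vanishes on the frontier of a bounded open
set is Lipschitz. -/
theorem exists_lipschitz_indicator {U : Set (Space d)} (hUo : IsOpen U)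
    (hU : Bornology.IsBounded U) {F : Space d → ℝ} (hF : ContDiff ℝ ∞ F)
    (h0 : ∀ y ∈ frontier U, F y = 0) :
    ∃ C, LipschitzWith C (U.indicator F) := by
  obtain ⟨r, hr⟩ := hU.subset_closedBall 0
  have hcl : closure U ⊆ Metric.closedBall 0 r := closure_minimal hr Metric.isClosed_closedBall
  -- The derivative is bounded on a ball, rather than on `U`, because the mean value inequality
  -- needs a convex set.
  obtain ⟨C, hC⟩ := (isCompact_closedBall (0 : Space d) r).exists_bound_of_continuousOn
    (hF.continuous_fderiv (by simp)).continuousOn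
  have hL : LipschitzOnWith C.toNNReal F (Metric.closedBall 0 r) :=
    (convex_closedBall 0 r).lipschitzOnWith_of_nnnorm_fderiv_le
      (fun x _ => hF.differentiable (by simp) x) fun x hx => by
        rw [← NNReal.coe_le_coe, coe_nnnorm]
        exact (hC x hx).trans (Real.le_coe_toNNReal C)
  refine ⟨C.toNNReal, LipschitzWith.of_dist_le_mul fun x y => ?_⟩
  have key : ∀ x ∈ U, ∀ y ∉ U, dist (F x) 0 ≤ C.toNNReal * dist x y := by
    intro x hx y hy
    -- The segment is connected, so on its way out of `U` it meets the frontier, where `F` vanishes.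
    obtain ⟨z, hz, hzU⟩ : ∃ z ∈ segment ℝ x y, z ∈ frontier U := by
      by_contra! h
      refine hy ((convex_segment x y).isPreconnected.subset_of_closure_inter_subset hUo
        ⟨x, left_mem_segment ℝ x y, hx⟩ (fun z hz => ?_) (right_mem_segment ℝ x y))
      by_contra hzU
      exact h z hz.2 ⟨hz.1, fun h => hzU (interior_subset h)⟩
    rw [← h0 z hzU]
    refine (hL.dist_le_mul x (hr hx) z (hcl hzU.1)).trans ?_
    have := dist_add_dist_of_mem_segment hz
    have h2 : dist x z ≤ dist x y := by linarith [dist_nonneg (x := z) (y := y)]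
    gcongr
  by_cases hx : x ∈ U <;> by_cases hy : y ∈ U
  · rw [Set.indicator_of_mem hx, Set.indicator_of_mem hy]
    exact hL.dist_le_mul x (hr hx) y (hr hy)
  · rw [Set.indicator_of_mem hx, Set.indicator_of_notMem hy]
    exact key x hx y hy
  · rw [Set.indicator_of_notMem hx, Set.indicator_of_mem hy, dist_comm, dist_comm x]
    exact key y hy x hx
  · rw [Set.indicator_of_notMem hx, Set.indicator_of_notMem hy, dist_self]
    positivity

theorem lineDeriv_fun_const (c : ℝ) (x v : Space d) : lineDeriv ℝ (fun _ => c) x v = 0 := by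
  rw [(differentiableAt_const c).lineDeriv_eq_fderiv]
  simp

/-- The frontier is only assumed null, so no divergence theorem with a boundary term is used. The
extension by zero is Lipschitz with compact support, hence its directional derivative has integral
zero. Off the frontier this derivative is that of `F` inside and zero outside. -/
theorem intFun_pdFun (μ : Fin d) {f : smoothFun Ω} (hf : f ∈ dirichlet Ω) :
    intFun Ω (pdFun Ω μ f) = 0 := by
  obtain ⟨F, hF, hf, hf0⟩ := hf
  obtain ⟨C, hC⟩ := exists_lipschitz_indicator Ω.isOpen Ω.isBounded hF hf0
  set v : Space d := EuclideanSpace.single μ 1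
  have hsupp : HasCompactSupport (Ω.carrier.indicator F) :=
    HasCompactSupport.intro Ω.isBounded.isCompact_closure fun x hx =>
      Set.indicator_of_notMem (fun h => hx (subset_closure h)) _
  -- Integration by parts against the constant `1`; the direction `-v` makes the derivative of the
  -- indicator appear along `v`.
  have h := LipschitzWith.integral_lineDeriv_mul_eq (μ := volume)
    (LipschitzWith.const (α := Space d) (1 : ℝ)) hC hsupp (-v)
  simp only [lineDeriv_fun_const, zero_mul, integral_zero, neg_neg, mul_one] at h
  rw [intFun_eq_of_eqOn (F := fun x => fderiv ℝ F x v)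
    (fun x => pdFun_apply_of_eqOn hf μ x), ← integral_indicator
    Ω.isOpen.measurableSet, h]
  refine integral_congr_ae ?_
  have hfr : ∀ᵐ x : Space d, x ∉ frontier Ω.carrier := measure_eq_zero_iff_ae_notMem.1 Ω.frontier_null
  filter_upwards [hfr] with x hx
  by_cases hxU : x ∈ Ω.carrier
  · rw [Set.indicator_of_mem hxU]
    have he : Ω.carrier.indicator F =ᶠ[𝓝 x] F := by
      filter_upwards [Ω.isOpen.mem_nhds hxU] with y hy using Set.indicator_of_mem hy _
    rw [he.lineDeriv_eq, ((hF.differentiable (by simp)) x).lineDeriv_eq_fderiv]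
  · rw [Set.indicator_of_notMem hxU]
    have hxc : x ∉ closure Ω.carrier := fun h => hx ⟨h, by rwa [Ω.isOpen.interior_eq]⟩
    have he : Ω.carrier.indicator F =ᶠ[𝓝 x] fun _ => 0 := by
      filter_upwards [isClosed_closure.isOpen_compl.mem_nhds hxc] with y hy using
        Set.indicator_of_notMem (fun h => hy (subset_closure h)) _
    rw [he.lineDeriv_eq, lineDeriv_fun_const]

/-! ### The Green operator -/

/-- `(-∂² + κ)⁻¹` with vanishing boundary values. -/
def greenFun {κ : ℝ} (h : Ω.DirichletSolvable κ) : smoothFun Ω →ₗ[ℝ] smoothFun Ω where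
  toFun f := (h f).choose
  map_add' f f' := by
    refine ((h (f + f')).choose_spec.2 _ ⟨Submodule.add_mem _ (h f).choose_spec.1.1
      (h f').choose_spec.1.1, ?_⟩).symm
    have e1 := (h f).choose_spec.1.2
    have e2 := (h f').choose_spec.1.2
    simp only [map_add, Finset.sum_add_distrib, smul_add] at e1 e2 ⊢
    conv_rhs => rw [← e1, ← e2]
    abel
  map_smul' r f := by
    refine ((h (r • f)).choose_spec.2 _ ⟨Submodule.smul_mem _ r (h f).choose_spec.1.1, ?_⟩).symm
    have e1 := (h f).choose_spec.1.2
    simp only [map_smul, ← Finset.smul_sum, smul_comm κ r] at e1 ⊢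
    conv_rhs => rw [← e1]
    rw [smul_add, smul_neg]

theorem greenFun_mem {κ : ℝ} (h : Ω.DirichletSolvable κ) (f : smoothFun Ω) :
    greenFun h f ∈ dirichlet Ω := (h f).choose_spec.1.1

theorem greenFun_spec {κ : ℝ} (h : Ω.DirichletSolvable κ) (f : smoothFun Ω) :
    -(∑ μ, pdFun Ω μ (pdFun Ω μ (greenFun h f))) + κ • greenFun h f = f :=
  (h f).choose_spec.1.2

theorem greenFun_left {κ : ℝ} (h : Ω.DirichletSolvable κ) {f : smoothFun Ω}
    (hf : f ∈ dirichlet Ω) :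
    greenFun h (-(∑ μ, pdFun Ω μ (pdFun Ω μ f)) + κ • f) = f :=
  ((h _).choose_spec.2 f ⟨hf, rfl⟩).symm

end GribovZwanziger

end

noncomputable section

namespace GribovZwanziger

/-! ### Formal power series with noncommutative coefficients -/

section Series

variable {G : Type*} [Ring G]

open PowerSeries (coeff X)

theorem X_comm (u : PowerSeries G) : X * u = u * X := (PowerSeries.commute_X u).symm.eq

theorem coeff_X_mul (n : ℕ) (u : PowerSeries G) :
    coeff (n + 1) (X * u) = coeff n u := PowerSeries.coeff_succ_X_mul n u

theorem coeff_zero_X_mul' (u : PowerSeries G) : coeff 0 (X * u) = 0 := by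
  rw [PowerSeries.coeff_zero_X_mul]

theorem coeff_C_mul' (n : ℕ) (θ : G) (u : PowerSeries G) :
    coeff n (PowerSeries.C θ * u) = θ * coeff n u := PowerSeries.coeff_C_mul _ _ _

theorem X_mul_cancel {u v : PowerSeries G} (h : X * u = X * v) : u = v := by
  ext n
  rw [← coeff_X_mul, h, coeff_X_mul]

/-- Agreement of two series up to order `m`. -/
def TruncEq (m : ℕ) (u v : PowerSeries G) : Prop := ∀ k < m, coeff k u = coeff k v

theorem TruncEq.refl (m : ℕ) (u : PowerSeries G) : TruncEq m u u := fun _ _ => rfl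

theorem TruncEq.symm {m : ℕ} {u v : PowerSeries G} (h : TruncEq m u v) : TruncEq m v u :=
  fun k hk => (h k hk).symm

theorem TruncEq.trans {m : ℕ} {u v w : PowerSeries G} (h : TruncEq m u v) (h' : TruncEq m v w) :
    TruncEq m u w := fun k hk => (h k hk).trans (h' k hk)

theorem TruncEq.mono {m n : ℕ} {u v : PowerSeries G} (h : TruncEq n u v) (hmn : m ≤ n) :
    TruncEq m u v := fun k hk => h k (hk.trans_le hmn)

theorem eq_of_truncEq {u v : PowerSeries G} (h : ∀ m, TruncEq m u v) : u = v := by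
  ext n; exact h (n + 1) n n.lt_succ_self

theorem TruncEq.add {m : ℕ} {u v u' v' : PowerSeries G} (h : TruncEq m u v)
    (h' : TruncEq m u' v') : TruncEq m (u + u') (v + v') :=
  fun k hk => by rw [map_add, map_add, h k hk, h' k hk]

theorem TruncEq.neg {m : ℕ} {u v : PowerSeries G} (h : TruncEq m u v) : TruncEq m (-u) (-v) :=
  fun k hk => by rw [map_neg, map_neg, h k hk]

theorem TruncEq.sub {m : ℕ} {u v u' v' : PowerSeries G} (h : TruncEq m u v)
    (h' : TruncEq m u' v') : TruncEq m (u - u') (v - v') :=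
  fun k hk => by rw [map_sub, map_sub, h k hk, h' k hk]

theorem TruncEq.sum {m : ℕ} {ι : Type*} {s : Finset ι} {u v : ι → PowerSeries G}
    (h : ∀ i ∈ s, TruncEq m (u i) (v i)) : TruncEq m (∑ i ∈ s, u i) (∑ i ∈ s, v i) :=
  fun k hk => by rw [map_sum, map_sum]; exact Finset.sum_congr rfl fun i hi => h i hi k hk

theorem TruncEq.mul {m : ℕ} {u v u' v' : PowerSeries G} (h : TruncEq m u v)
    (h' : TruncEq m u' v') : TruncEq m (u * u') (v * v') := fun k hk => by
  rw [PowerSeries.coeff_mul, PowerSeries.coeff_mul]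
  refine Finset.sum_congr rfl fun p hp => ?_
  have hp := Finset.HasAntidiagonal.mem_antidiagonal.1 hp
  rw [h p.1 (by omega), h' p.2 (by omega)]

theorem TruncEq.X_mul {m : ℕ} {u v : PowerSeries G} (h : TruncEq m u v) :
    TruncEq (m + 1) (X * u) (X * v) := fun k hk => by
  cases k with
  | zero => rw [coeff_zero_X_mul', coeff_zero_X_mul']
  | succ k => rw [coeff_X_mul, coeff_X_mul, h k (by omega)]

/-- A map which improves the order of agreement of families of series. -/
def IsContraction {ι : Type*} (Ψ : (ι → PowerSeries G) → ι → PowerSeries G) : Prop :=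
  ∀ m u v, (∀ i, TruncEq m (u i) (v i)) → ∀ i, TruncEq (m + 1) (Ψ u i) (Ψ v i)

/-- Each application of `Ψ` fixes one more coefficient, whatever the starting point. A fixed point
is therefore the limit of the iterates, and properties preserved by `Ψ` and by limits hold for it.
-/
theorem IsContraction.truncEq_iterate {ι : Type*} {Ψ : (ι → PowerSeries G) → ι → PowerSeries G}
    (hΨ : IsContraction Ψ) {u : ι → PowerSeries G} (hu : Ψ u = u) (v : ι → PowerSeries G) (m : ℕ) :
    ∀ i, TruncEq m (u i) (Ψ^[m] v i) := by
  induction m with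
  | zero => exact fun i k hk => absurd hk k.not_lt_zero
  | succ m ih =>
    intro i
    have := hΨ m _ _ ih i
    rwa [hu, ← Function.iterate_succ_apply' Ψ] at this

theorem IsContraction.eq_of_fixed {ι : Type*} {Ψ : (ι → PowerSeries G) → ι → PowerSeries G}
    (hΨ : IsContraction Ψ) {u v : ι → PowerSeries G} (hu : Ψ u = u) (hv : Ψ v = v) : u = v :=
  funext fun i => eq_of_truncEq fun m =>
    (hΨ.truncEq_iterate hu u m i).trans (hΨ.truncEq_iterate hv u m i).symm

theorem IsContraction.exists_fixed {ι : Type*} {Ψ : (ι → PowerSeries G) → ι → PowerSeries G}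
    (hΨ : IsContraction Ψ) : ∃ u, Ψ u = u := by
  have h : ∀ m j, ∀ i, TruncEq m (Ψ^[m] 0 i) (Ψ^[m + j] 0 i) := by
    intro m
    induction m with
    | zero => exact fun j i k hk => absurd hk k.not_lt_zero
    | succ m ih =>
      intro j i
      rw [show m + 1 + j = (m + j) + 1 by omega, Function.iterate_succ_apply',
        Function.iterate_succ_apply']
      exact hΨ m _ _ (ih j) i
  -- The coefficient of order `n` no longer changes from iterate `n + 1` on.
  refine ⟨fun i => PowerSeries.mk fun n => coeff n (Ψ^[n + 1] 0 i), ?_⟩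
  have h2 : ∀ m i, TruncEq m (PowerSeries.mk fun n => coeff n (Ψ^[n + 1] 0 i)) (Ψ^[m] 0 i) := by
    intro m i k hk
    rw [PowerSeries.coeff_mk, h (k + 1) (m - (k + 1)) i k k.lt_succ_self]
    congr 2
    rw [show k + 1 + (m - (k + 1)) = m by omega]
  funext i
  refine eq_of_truncEq fun m => ?_
  refine ((hΨ m _ _ (h2 m) i).mono m.le_succ).trans ?_
  rw [← Function.iterate_succ_apply' Ψ]
  exact ((h2 (m + 1) i).mono m.le_succ).symm

/-- The sum `∑ₖ g^k tₖ`. -/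
def gsum (t : ℕ → PowerSeries G) : PowerSeries G :=
  PowerSeries.mk fun n => ∑ k ∈ Finset.range (n + 1), coeff n (X ^ k * t k)

theorem gsum_succ (t : ℕ → PowerSeries G) : gsum t = t 0 + X * gsum fun k => t (k + 1) := by
  ext n
  rw [gsum, PowerSeries.coeff_mk, Finset.sum_range_succ', map_add, pow_zero, one_mul, add_comm]
  congr 1
  cases n with
  | zero => rw [coeff_zero_X_mul', Finset.sum_range_zero]
  | succ n =>
    rw [coeff_X_mul, gsum, PowerSeries.coeff_mk]
    exact Finset.sum_congr rfl fun k _ => by rw [pow_succ', mul_assoc, coeff_X_mul]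

/-- Iterating the hypothesis, `T 0` is divisible by every power of the variable. -/
theorem eq_zero_of_eq_X_mul {T : ℕ → PowerSeries G} (h : ∀ k, T k = X * T (k + 1)) :
    T 0 = 0 := by
  have key : ∀ n k, coeff n (T k) = 0 := by
    intro n
    induction n with
    | zero => intro k; rw [h, coeff_zero_X_mul']
    | succ n ih => intro k; rw [h, coeff_X_mul, ih]
  ext n; rw [key, map_zero]

theorem gsum_shift (t : ℕ → PowerSeries G) (k : ℕ) :
    gsum (fun j => t (k + j)) = t k + X * gsum fun j => t (k + 1 + j) := by
  rw [gsum_succ]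
  congr 3
  funext j
  congr 1
  omega

/-- The tails of `gsum t` obey a one-step recursion, and the recursion determines them. Linearity,
compatibility with maps and the Cauchy product are all reduced to this recursion, without
coefficient formulas. -/
theorem eq_gsum_of_rec {t T : ℕ → PowerSeries G} (h : ∀ k, T k = t k + X * T (k + 1)) :
    T 0 = gsum t := by
  have h0 := eq_zero_of_eq_X_mul (T := fun k => T k - gsum fun j => t (k + j)) fun k => by
    rw [h k, gsum_shift, mul_sub, add_sub_add_left_eq_sub]
  simp only [zero_add] at h0
  exact sub_eq_zero.1 h0

theorem map_gsum (φ : PowerSeries G →+ PowerSeries G) (hφ : ∀ u, φ (X * u) = X * φ u)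
    (t : ℕ → PowerSeries G) : φ (gsum t) = gsum fun k => φ (t k) := by
  have := eq_gsum_of_rec (t := fun k => φ (t k)) (T := fun k => φ (gsum fun j => t (k + j)))
    fun k => by rw [gsum_shift, map_add, hφ]
  simpa only [zero_add] using this

theorem gsum_add (s t : ℕ → PowerSeries G) : gsum (fun k => s k + t k) = gsum s + gsum t := by
  have := eq_gsum_of_rec (t := fun k => s k + t k)
    (T := fun k => gsum (fun j => s (k + j)) + gsum fun j => t (k + j)) fun k => by
      rw [gsum_shift s, gsum_shift t, mul_add]
      abel
  simpa only [zero_add] using this.symm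

theorem mul_gsum (r : PowerSeries G) (t : ℕ → PowerSeries G) :
    r * gsum t = gsum fun k => r * t k :=
  map_gsum (AddMonoidHom.mulLeft r) (fun u => by
    simp only [AddMonoidHom.coe_mulLeft]; rw [← mul_assoc, ← X_comm, mul_assoc]) t

theorem gsum_neg (t : ℕ → PowerSeries G) : gsum (fun k => -t k) = -gsum t :=
  (map_gsum (-AddMonoidHom.id _) (fun u => by simp) t).symm

theorem gsum_sub (s t : ℕ → PowerSeries G) : gsum (fun k => s k - t k) = gsum s - gsum t := by
  simp only [sub_eq_add_neg, gsum_add, gsum_neg]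

theorem gsum_sum {ι : Type*} (s : Finset ι) (t : ι → ℕ → PowerSeries G) :
    gsum (fun k => ∑ i ∈ s, t i k) = ∑ i ∈ s, gsum (t i) := by
  classical
  induction s using Finset.induction_on with
  | empty =>
    simp only [Finset.sum_empty]
    exact (map_gsum (0 : PowerSeries G →+ PowerSeries G) (by simp) 0).symm
  | insert i s hi ih =>
    simp only [Finset.sum_insert hi]
    rw [gsum_add, ih]

theorem TruncEq.gsum {m : ℕ} {s t : ℕ → PowerSeries G} (h : ∀ k, TruncEq m (s k) (t k)) :
    TruncEq m (gsum s) (gsum t) := fun n hn => by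
  rw [GribovZwanziger.gsum, GribovZwanziger.gsum, PowerSeries.coeff_mk, PowerSeries.coeff_mk]
  exact Finset.sum_congr rfl fun k _ => TruncEq.mul (TruncEq.refl _ _) (h k) n hn

theorem gsum_truncEq (t : ℕ → PowerSeries G) (m : ℕ) :
    TruncEq m (gsum t) (∑ k ∈ Finset.range m, X ^ k * t k) := by
  induction m generalizing t with
  | zero => exact fun k hk => absurd hk k.not_lt_zero
  | succ m ih =>
    rw [gsum_succ, Finset.sum_range_succ', pow_zero, one_mul, add_comm (t 0)]
    refine TruncEq.add ?_ (TruncEq.refl _ _)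
    have := (ih fun k => t (k + 1)).X_mul
    rw [Finset.mul_sum] at this
    simpa only [pow_succ', mul_assoc] using this

/-- The Cauchy product. -/
theorem gsum_mul_gsum (s t : ℕ → PowerSeries G) :
    gsum s * gsum t
      = gsum fun k => ∑ p ∈ Finset.HasAntidiagonal.antidiagonal k, s p.1 * t p.2 := by
  -- The defect of the product formula for `s` shifted by `i` is `X` times the defect for the shift
  -- by `i + 1`.
  have h0 := eq_zero_of_eq_X_mul (T := fun i => gsum (fun j => s (i + j)) * gsum t
    - gsum fun k => ∑ p ∈ Finset.HasAntidiagonal.antidiagonal k, s (i + p.1) * t p.2)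
    fun i => by
      have e1 : gsum (fun k => ∑ p ∈ Finset.HasAntidiagonal.antidiagonal k, s (i + p.1) * t p.2)
          = s i * gsum t + X * gsum fun k =>
            ∑ p ∈ Finset.HasAntidiagonal.antidiagonal k, s (i + 1 + p.1) * t p.2 := by
        rw [mul_gsum, gsum_succ
          (fun k => ∑ p ∈ Finset.HasAntidiagonal.antidiagonal k, s (i + p.1) * t p.2),
          gsum_succ (fun k => s i * t k), add_assoc, ← mul_add, ← gsum_add]
        simp only [Finset.HasAntidiagonal.antidiagonal_zero, Finset.sum_singleton, add_zero]
        congr 3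
        funext k
        rw [Finset.Nat.sum_antidiagonal_succ]
        simp only [add_zero, add_assoc, add_comm 1]
      rw [e1, gsum_shift s, add_mul, mul_sub, mul_assoc]
      abel
  simp only [zero_add] at h0
  exact sub_eq_zero.1 h0

/-- Multiples of a constant. -/
def IsMul (θ : G) (u : PowerSeries G) : Prop := ∃ v, u = PowerSeries.C θ * v

theorem isMul_zero (θ : G) : IsMul θ 0 := ⟨0, (mul_zero _).symm⟩

theorem IsMul.add {θ : G} {u v : PowerSeries G} (hu : IsMul θ u) (hv : IsMul θ v) :
    IsMul θ (u + v) := by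
  obtain ⟨u, rfl⟩ := hu
  obtain ⟨v, rfl⟩ := hv
  exact ⟨u + v, (mul_add _ _ _).symm⟩

theorem IsMul.sum {θ : G} {ι : Type*} {s : Finset ι} {u : ι → PowerSeries G}
    (h : ∀ i ∈ s, IsMul θ (u i)) : IsMul θ (∑ i ∈ s, u i) := by
  classical
  induction s using Finset.induction_on with
  | empty => exact isMul_zero θ
  | insert i s hi ih =>
    rw [Finset.sum_insert hi]
    exact (h i (Finset.mem_insert_self i s)).add
      (ih fun j hj => h j (Finset.mem_insert_of_mem hj))

variable [Algebra ℝ G]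

theorem IsMul.smul {θ : G} {u : PowerSeries G} (hu : IsMul θ u) (r : ℝ) : IsMul θ (r • u) := by
  obtain ⟨u, rfl⟩ := hu
  exact ⟨r • u, (mul_smul_comm _ _ _).symm⟩

theorem coeff_real_smul (n : ℕ) (r : ℝ) (u : PowerSeries G) :
    coeff n (r • u) = r • coeff n u := rfl

theorem TruncEq.smul {m : ℕ} {u v : PowerSeries G} (h : TruncEq m u v) (r : ℝ) :
    TruncEq m (r • u) (r • v) :=
  fun k hk => by rw [coeff_real_smul, coeff_real_smul, h k hk]

/-- A linear operator acting on series coefficientwise. -/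
def lift {H : Type*} [Ring H] [Algebra ℝ H] (L : G →ₗ[ℝ] H) :
    PowerSeries G →ₗ[ℝ] PowerSeries H where
  toFun u := PowerSeries.mk fun n => L (coeff n u)
  map_add' u v := by ext n; simp
  map_smul' r u := by ext n; simp

@[simp] theorem coeff_lift {H : Type*} [Ring H] [Algebra ℝ H] (L : G →ₗ[ℝ] H) (n : ℕ)
    (u : PowerSeries G) : coeff n (lift L u) = L (coeff n u) := by
  change coeff n (PowerSeries.mk fun n => L (coeff n u)) = _
  rw [PowerSeries.coeff_mk]

theorem lift_X_mul {H : Type*} [Ring H] [Algebra ℝ H] (L : G →ₗ[ℝ] H) (u : PowerSeries G) :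
    lift L (X * u) = X * lift L u := by
  ext n
  cases n with
  | zero => rw [coeff_lift, coeff_zero_X_mul', coeff_zero_X_mul', map_zero]
  | succ n => rw [coeff_lift, coeff_X_mul, coeff_X_mul, coeff_lift]

theorem TruncEq.lift {m : ℕ} {u v : PowerSeries G} (h : TruncEq m u v) (L : G →ₗ[ℝ] G) :
    TruncEq m (lift L u) (lift L v) :=
  fun k hk => by rw [coeff_lift, coeff_lift, h k hk]

theorem lift_gsum (L : G →ₗ[ℝ] G) (t : ℕ → PowerSeries G) :
    lift L (gsum t) = gsum fun k => lift L (t k) :=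
  map_gsum (lift L).toAddMonoidHom (lift_X_mul L) t

theorem gsum_smul (r : ℝ) (t : ℕ → PowerSeries G) : gsum (fun k => r • t k) = r • gsum t :=
  (map_gsum (DistribSMul.toAddMonoidHom (PowerSeries G) r)
    (fun u => (mul_smul_comm r X u).symm) t).symm

variable {C : Type} [Fintype C] (f : C → C → C → ℝ)

theorem TruncEq.brk {m : ℕ} {u v u' v' : C → PowerSeries G} (h : ∀ a, TruncEq m (u a) (v a))
    (h' : ∀ a, TruncEq m (u' a) (v' a)) (a : C) :
    TruncEq m (bracket f u u' a) (bracket f v v' a) :=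
  TruncEq.sum fun _ _ => TruncEq.sum fun _ _ => ((h _).mul (h' _)).smul _

theorem TruncEq.iterate_bracket {m : ℕ} {u v u' v' : C → PowerSeries G}
    (h : ∀ a, TruncEq m (u a) (v a)) (h' : ∀ a, TruncEq m (u' a) (v' a)) (k : ℕ) (a : C) :
    TruncEq m ((bracket f u)^[k] u' a) ((bracket f v)^[k] v' a) := by
  induction k generalizing a with
  | zero => exact h' a
  | succ k ih =>
    rw [Function.iterate_succ_apply', Function.iterate_succ_apply']
    exact TruncEq.brk f h ih a

theorem bracket_gsum_gsum (s t : ℕ → C → PowerSeries G) (a : C) :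
    bracket f (fun b => gsum fun k => s k b) (fun b => gsum fun k => t k b) a
      = gsum fun k => ∑ p ∈ Finset.HasAntidiagonal.antidiagonal k, bracket f (s p.1) (t p.2) a := by
  have e : ∀ k, ∑ p ∈ Finset.HasAntidiagonal.antidiagonal k, bracket f (s p.1) (t p.2) a
      = ∑ b, ∑ c, f a b c • ∑ p ∈ Finset.HasAntidiagonal.antidiagonal k, s p.1 b * t p.2 c := by
    intro k
    simp only [bracket, Finset.smul_sum]
    rw [Finset.sum_comm]
    exact Finset.sum_congr rfl fun b _ => Finset.sum_comm
  simp only [e, gsum_sum, gsum_smul]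
  simp only [bracket, gsum_mul_gsum]

end Series

end GribovZwanziger

end

noncomputable section

namespace GribovZwanziger

/-! ### Graded differential calculus -/

/-- An algebra of Grassmann-valued functions with commuting derivations `∂_μ`, a parity
automorphism, odd constants, an ideal of functions with vanishing boundary values, and an
integral with values in `E`. -/
structure Calculus (d : ℕ) (G E : Type*) [Ring G] [Algebra ℝ G] [Ring E] [Algebra ℝ E] where
  pd : Fin d → G →ₗ[ℝ] G
  leibniz : ∀ μ x y, pd μ (x * y) = pd μ x * y + x * pd μ y
  pd_comm : ∀ μ ν x, pd μ (pd ν x) = pd ν (pd μ x)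
  σ : G →ₐ[ℝ] G
  σ_pd : ∀ μ x, σ (pd μ x) = pd μ (σ x)
  even_comm : ∀ x y, σ x = x → x * y = y * x
  odd_comm : ∀ x y, σ x = -x → x * y = σ y * x
  odd : Set G
  odd_add : ∀ θ ∈ odd, ∀ θ' ∈ odd, θ + θ' ∈ odd
  σ_odd : ∀ θ ∈ odd, σ θ = -θ
  odd_sq : ∀ θ ∈ odd, θ * θ = 0
  pd_odd_mul : ∀ μ, ∀ θ ∈ odd, ∀ x, pd μ (θ * x) = θ * pd μ x
  odd_sep : ∀ x, (∀ θ ∈ odd, θ * x = 0) → x = 0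
  dir : Submodule ℝ G
  mul_dir : ∀ x ∈ dir, ∀ y, y * x ∈ dir
  dir_mul : ∀ x ∈ dir, ∀ y, x * y ∈ dir
  int : G →ₗ[ℝ] E
  int_pd : ∀ μ, ∀ x ∈ dir, int (pd μ x) = 0

namespace Calculus

open PowerSeries (coeff X)

variable {d : ℕ} {G E : Type*} [Ring G] [Algebra ℝ G] [Ring E] [Algebra ℝ E] (K : Calculus d G E)

/-- The partial derivatives of series. -/
def D (μ : Fin d) : PowerSeries G →ₗ[ℝ] PowerSeries G := lift (K.pd μ)

/-- The integral of series. -/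
def integ : PowerSeries G →ₗ[ℝ] PowerSeries E := lift K.int

/-- The parity automorphism of series. -/
def par : PowerSeries G →+* PowerSeries G := PowerSeries.map K.σ.toRingHom

/-- Series of parity `ε = ±1`. -/
def HasPar (ε : ℝ) (u : PowerSeries G) : Prop := K.par u = ε • u

/-- Series with vanishing boundary values. -/
def Dir (u : PowerSeries G) : Prop := ∀ n, coeff n u ∈ K.dir

theorem coeff_par (n : ℕ) (u : PowerSeries G) : coeff n (K.par u) = K.σ (coeff n u) :=
  PowerSeries.coeff_map _ _ _

theorem par_smul (r : ℝ) (u : PowerSeries G) : K.par (r • u) = r • K.par u := by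
  ext n; rw [coeff_par, coeff_real_smul, coeff_real_smul, coeff_par, map_smul]

theorem par_D (μ : Fin d) (u : PowerSeries G) : K.par (K.D μ u) = K.D μ (K.par u) := by
  ext n; simp only [D, coeff_par, coeff_lift, K.σ_pd]

theorem par_lift {L : G →ₗ[ℝ] G} (hL : ∀ x, K.σ (L x) = L (K.σ x)) (u : PowerSeries G) :
    K.par (lift L u) = lift L (K.par u) := by
  ext n; simp only [coeff_par, coeff_lift, hL]

theorem par_X : K.par X = X := PowerSeries.map_X _

theorem D_mul (μ : Fin d) (u v : PowerSeries G) : K.D μ (u * v) = K.D μ u * v + u * K.D μ v := by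
  ext n
  simp only [D, map_add, coeff_lift, PowerSeries.coeff_mul, map_sum, K.leibniz,
    Finset.sum_add_distrib]

theorem D_comm (μ ν : Fin d) (u : PowerSeries G) : K.D μ (K.D ν u) = K.D ν (K.D μ u) := by
  ext n; simp only [D, coeff_lift]; exact K.pd_comm _ _ _

theorem D_X_mul (μ : Fin d) (u : PowerSeries G) : K.D μ (X * u) = X * K.D μ u := lift_X_mul _ _

variable {K}

theorem HasPar.mul {ε ε' : ℝ} {u v : PowerSeries G} (hu : K.HasPar ε u) (hv : K.HasPar ε' v) :
    K.HasPar (ε * ε') (u * v) := by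
  rw [HasPar, map_mul, hu, hv, smul_mul_assoc, mul_smul_comm, smul_smul]

theorem hasPar_zero (ε : ℝ) : K.HasPar ε 0 := by rw [HasPar, map_zero, smul_zero]

theorem HasPar.add {ε : ℝ} {u v : PowerSeries G} (hu : K.HasPar ε u) (hv : K.HasPar ε v) :
    K.HasPar ε (u + v) := by rw [HasPar, map_add, hu, hv, smul_add]

theorem HasPar.neg {ε : ℝ} {u : PowerSeries G} (hu : K.HasPar ε u) : K.HasPar ε (-u) := by
  rw [HasPar, map_neg, hu, smul_neg]

theorem HasPar.sub {ε : ℝ} {u v : PowerSeries G} (hu : K.HasPar ε u) (hv : K.HasPar ε v) :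
    K.HasPar ε (u - v) := by rw [HasPar, map_sub, hu, hv, smul_sub]

theorem HasPar.smul {ε : ℝ} {u : PowerSeries G} (hu : K.HasPar ε u) (r : ℝ) :
    K.HasPar ε (r • u) := by rw [HasPar, par_smul, hu, smul_comm]

theorem HasPar.sum {ε : ℝ} {ι : Type*} {s : Finset ι} {u : ι → PowerSeries G}
    (hu : ∀ i ∈ s, K.HasPar ε (u i)) : K.HasPar ε (∑ i ∈ s, u i) := by
  rw [HasPar, map_sum, Finset.smul_sum]; exact Finset.sum_congr rfl hu

theorem HasPar.D {ε : ℝ} {u : PowerSeries G} (hu : K.HasPar ε u) (μ : Fin d) :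
    K.HasPar ε (K.D μ u) := by rw [HasPar, par_D, hu, map_smul]

theorem HasPar.lift {ε : ℝ} {u : PowerSeries G} (hu : K.HasPar ε u) {L : G →ₗ[ℝ] G}
    (hL : ∀ x, K.σ (L x) = L (K.σ x)) : K.HasPar ε (lift L u) := by
  rw [HasPar, K.par_lift hL, hu, map_smul]

theorem hasPar_X : K.HasPar 1 X := by rw [HasPar, par_X, one_smul]

theorem HasPar.X_mul {ε : ℝ} {u : PowerSeries G} (hu : K.HasPar ε u) : K.HasPar ε (X * u) := by
  simpa using hasPar_X.mul hu

theorem HasPar.even_mul {ε : ℝ} {u v : PowerSeries G} (hu : K.HasPar 1 u) (hv : K.HasPar ε v) :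
    K.HasPar ε (u * v) := by simpa using hu.mul hv

theorem HasPar.odd_mul_odd {u v : PowerSeries G} (hu : K.HasPar (-1) u)
    (hv : K.HasPar (-1) v) : K.HasPar 1 (u * v) := by simpa using hu.mul hv

theorem hasPar_of_truncEq {ε : ℝ} {u : PowerSeries G}
    (h : ∀ m, ∃ v, K.HasPar ε v ∧ TruncEq m u v) : K.HasPar ε u := by
  ext n
  obtain ⟨v, hv, h⟩ := h (n + 1)
  have := congrArg (coeff n) hv
  rw [coeff_par, coeff_real_smul] at this ⊢
  rw [h n n.lt_succ_self, this]

theorem HasPar.comm {u : PowerSeries G} (hu : K.HasPar 1 u) (v : PowerSeries G) :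
    u * v = v * u := by
  ext n
  rw [PowerSeries.coeff_mul, PowerSeries.coeff_mul, ← Finset.Nat.sum_antidiagonal_swap]
  refine Finset.sum_congr rfl fun p _ => K.even_comm _ _ ?_
  rw [← coeff_par, hu, one_smul]

theorem HasPar.comm_odd {u : PowerSeries G} (hu : K.HasPar (-1) u) (v : PowerSeries G) :
    u * v = K.par v * u := by
  ext n
  rw [PowerSeries.coeff_mul, PowerSeries.coeff_mul, ← Finset.Nat.sum_antidiagonal_swap]
  refine Finset.sum_congr rfl fun p _ => ?_
  rw [coeff_par]
  refine K.odd_comm _ _ ?_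
  rw [← coeff_par, hu, neg_one_smul, map_neg]

theorem HasPar.anticomm {u v : PowerSeries G} (hu : K.HasPar (-1) u) (hv : K.HasPar (-1) v) :
    u * v = -(v * u) := by
  rw [hu.comm_odd, hv, neg_one_smul, neg_mul]

theorem HasPar.gsum {ε : ℝ} {t : ℕ → PowerSeries G} (h : ∀ k, K.HasPar ε (t k)) :
    K.HasPar ε (gsum t) := by
  have := map_gsum K.par.toAddMonoidHom (fun u => by
    change K.par (X * u) = X * K.par u
    rw [map_mul, par_X]) t
  rw [HasPar]
  refine this.trans ?_
  rw [← gsum_smul]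
  congr 1
  funext k
  exact h k

theorem dir_zero : K.Dir 0 := fun n => by rw [map_zero]; exact Submodule.zero_mem _

theorem Dir.add {u v : PowerSeries G} (hu : K.Dir u) (hv : K.Dir v) : K.Dir (u + v) :=
  fun n => by rw [map_add]; exact Submodule.add_mem _ (hu n) (hv n)

theorem Dir.neg {u : PowerSeries G} (hu : K.Dir u) : K.Dir (-u) :=
  fun n => by rw [map_neg]; exact Submodule.neg_mem _ (hu n)

theorem Dir.smul {u : PowerSeries G} (hu : K.Dir u) (r : ℝ) : K.Dir (r • u) :=
  fun n => by rw [coeff_real_smul]; exact Submodule.smul_mem _ r (hu n)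

theorem Dir.sum {ι : Type*} {s : Finset ι} {u : ι → PowerSeries G} (hu : ∀ i ∈ s, K.Dir (u i)) :
    K.Dir (∑ i ∈ s, u i) :=
  fun n => by rw [map_sum]; exact Submodule.sum_mem _ fun i hi => hu i hi n

theorem Dir.mul_left {u : PowerSeries G} (hu : K.Dir u) (v : PowerSeries G) : K.Dir (v * u) :=
  fun n => by
    rw [PowerSeries.coeff_mul]; exact Submodule.sum_mem _ fun p _ => K.mul_dir _ (hu _) _

theorem Dir.mul_right {u : PowerSeries G} (hu : K.Dir u) (v : PowerSeries G) : K.Dir (u * v) :=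
  fun n => by
    rw [PowerSeries.coeff_mul]; exact Submodule.sum_mem _ fun p _ => K.dir_mul _ (hu _) _

theorem dir_of_truncEq {u : PowerSeries G} (h : ∀ m, ∃ v, K.Dir v ∧ TruncEq m u v) : K.Dir u :=
  fun n => by
    obtain ⟨v, hv, h⟩ := h (n + 1)
    rw [h n n.lt_succ_self]
    exact hv n

theorem Dir.gsum {t : ℕ → PowerSeries G} (h : ∀ k, K.Dir (t k)) : K.Dir (gsum t) :=
  dir_of_truncEq fun m => ⟨_, Dir.sum fun k _ => (h k).mul_left (X ^ k), gsum_truncEq t m⟩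

variable (K)

theorem integ_D (μ : Fin d) {u : PowerSeries G} (hu : K.Dir u) : K.integ (K.D μ u) = 0 := by
  ext n
  rw [integ, D, coeff_lift, coeff_lift, K.int_pd μ _ (hu n), map_zero]

/-- Integration by parts. -/
theorem integ_D_mul_left (μ : Fin d) {u : PowerSeries G} (hu : K.Dir u) (v : PowerSeries G) :
    K.integ (K.D μ u * v) = -K.integ (u * K.D μ v) := by
  rw [eq_neg_iff_add_eq_zero, ← map_add, ← D_mul, integ_D K μ (hu.mul_right v)]

theorem integ_D_mul_right (μ : Fin d) (u : PowerSeries G) {v : PowerSeries G} (hv : K.Dir v) :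
    K.integ (K.D μ u * v) = -K.integ (u * K.D μ v) := by
  rw [eq_neg_iff_add_eq_zero, ← map_add, ← D_mul, integ_D K μ (hv.mul_left u)]

/-! ### Odd parameters -/

variable {K}

theorem hasPar_C {θ : G} (hθ : θ ∈ K.odd) : K.HasPar (-1) (PowerSeries.C θ) := by
  rw [HasPar, par, PowerSeries.map_C, neg_one_smul, ← map_neg]
  exact congrArg _ (K.σ_odd θ hθ)

theorem D_C_mul {θ : G} (hθ : θ ∈ K.odd) (μ : Fin d) (u : PowerSeries G) :
    K.D μ (PowerSeries.C θ * u) = PowerSeries.C θ * K.D μ u := by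
  ext n
  rw [coeff_C_mul', D, coeff_lift, coeff_lift, coeff_C_mul', K.pd_odd_mul μ θ hθ]

theorem C_mul_C_mul {θ : G} (hθ : θ ∈ K.odd) (u : PowerSeries G) :
    PowerSeries.C θ * (PowerSeries.C θ * u) = 0 := by
  rw [← mul_assoc, ← map_mul, K.odd_sq θ hθ, map_zero, zero_mul]

theorem C_mul_mul_C_mul {θ : G} (hθ : θ ∈ K.odd) (u v : PowerSeries G) :
    PowerSeries.C θ * u * (PowerSeries.C θ * v) = 0 := by
  rw [(hasPar_C hθ).comm_odd, mul_assoc, C_mul_C_mul hθ, mul_zero]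

/-- This makes the coefficient of `θ` in a variation unique. -/
theorem eq_of_C_mul_eq {u v : PowerSeries G}
    (h : ∀ θ ∈ K.odd, PowerSeries.C θ * u = PowerSeries.C θ * v) : u = v := by
  rw [← sub_eq_zero]
  ext n
  rw [map_zero]
  refine K.odd_sep _ fun θ hθ => ?_
  rw [← coeff_C_mul', mul_sub, h θ hθ, sub_self, map_zero]

theorem hasPar_odd_of_C_mul {u : PowerSeries G}
    (h : ∀ θ ∈ K.odd, K.HasPar 1 (PowerSeries.C θ * u)) : K.HasPar (-1) u := by
  rw [HasPar]
  refine eq_of_C_mul_eq (K := K) fun θ hθ => ?_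
  have h1 := h θ hθ
  rw [HasPar, map_mul, hasPar_C hθ, one_smul, neg_one_smul, neg_mul] at h1
  rw [neg_one_smul, mul_neg, ← h1, neg_neg]

/-! ### Green operators -/

variable (K)

/-- `L` inverts `-∂² + κ` with vanishing boundary values. -/
structure IsGreen (κ : ℝ) (L : G →ₗ[ℝ] G) : Prop where
  mem : ∀ x, L x ∈ K.dir
  right : ∀ x, -(∑ μ, K.pd μ (K.pd μ (L x))) + κ • L x = x
  left : ∀ x ∈ K.dir, L (-(∑ μ, K.pd μ (K.pd μ x)) + κ • x) = x
  σ : ∀ x, K.σ (L x) = L (K.σ x)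

variable {K} {κ : ℝ} {L : G →ₗ[ℝ] G}

theorem IsGreen.dir_lift (hL : K.IsGreen κ L) (u : PowerSeries G) : K.Dir (lift L u) :=
  fun n => by rw [coeff_lift]; exact hL.mem _

theorem coeff_helmholtz (n : ℕ) (u : PowerSeries G) :
    coeff n (-(∑ μ, K.D μ (K.D μ u)) + κ • u)
      = -(∑ μ, K.pd μ (K.pd μ (coeff n u))) + κ • coeff n u := by
  rw [map_add, map_neg, map_sum, coeff_real_smul]
  simp only [D, coeff_lift]

theorem IsGreen.helmholtz_lift (hL : K.IsGreen κ L) (u : PowerSeries G) :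
    -(∑ μ, K.D μ (K.D μ (lift L u))) + κ • lift L u = u := by
  ext n
  rw [coeff_helmholtz, coeff_lift, hL.right]

theorem IsGreen.lift_helmholtz (hL : K.IsGreen κ L) {u : PowerSeries G} (hu : K.Dir u) :
    lift L (-(∑ μ, K.D μ (K.D μ u)) + κ • u) = u := by
  ext n
  rw [coeff_lift, coeff_helmholtz, hL.left _ (hu n)]

variable {C : Type}

theorem IsContraction.lift_comp {N : (C → PowerSeries G) → C → PowerSeries G}
    (hN : IsContraction N) (L : G →ₗ[ℝ] G) :
    IsContraction fun u a => GribovZwanziger.lift L (N u a) :=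
  fun m u v h a => (hN m u v h a).lift L

/-- Applying `L` to the equation turns it into a fixed point equation. The boundary condition is
absorbed, because `L` takes values in functions vanishing on the boundary and inverts `-∂² + κ` from
both sides. -/
theorem IsGreen.fixed_iff (hL : K.IsGreen κ L) (N : (C → PowerSeries G) → C → PowerSeries G)
    (u : C → PowerSeries G) :
    ((∀ a, K.Dir (u a)) ∧ ∀ a, -(∑ μ, K.D μ (K.D μ (u a))) + κ • u a = N u a) ↔
      (fun a => GribovZwanziger.lift L (N u a)) = u := by
  constructor
  · rintro ⟨hu, h⟩
    funext a
    rw [← h, hL.lift_helmholtz (hu a)]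
  · intro h
    have h' : ∀ a, u a = GribovZwanziger.lift L (N u a) := fun a => (congrFun h a).symm
    refine ⟨fun a => ?_, fun a => ?_⟩
    · rw [h']; exact hL.dir_lift _
    · nth_rw 1 2 [h' a]
      exact hL.helmholtz_lift _

/-- Perturbative boundary value problems have unique solutions. -/
theorem IsGreen.existsUnique (hL : K.IsGreen κ L)
    {N : (C → PowerSeries G) → C → PowerSeries G} (hN : IsContraction N) :
    ∃! u : C → PowerSeries G,
      (∀ a, K.Dir (u a)) ∧ ∀ a, -(∑ μ, K.D μ (K.D μ (u a))) + κ • u a = N u a := by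
  have hc := IsContraction.lift_comp hN L
  obtain ⟨u, hu⟩ := hc.exists_fixed
  exact ⟨u, (hL.fixed_iff N u).2 hu,
    fun v hv => hc.eq_of_fixed ((hL.fixed_iff N v).1 hv) hu⟩

/-- Fixed points of contractions inherit parity. -/
theorem hasPar_of_fixed {Ψ : (C → PowerSeries G) → C → PowerSeries G} (hΨ : IsContraction Ψ)
    {ε : ℝ} (h : ∀ u, (∀ a, K.HasPar ε (u a)) → ∀ a, K.HasPar ε (Ψ u a)) {u : C → PowerSeries G}
    (hu : Ψ u = u) (a : C) : K.HasPar ε (u a) := by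
  have h2 : ∀ m a, K.HasPar ε (Ψ^[m] 0 a) := by
    intro m
    induction m with
    | zero => exact fun a => hasPar_zero ε
    | succ m ih => rw [Function.iterate_succ_apply']; exact h _ ih
  exact hasPar_of_truncEq fun m => ⟨_, h2 m a, hΨ.truncEq_iterate hu 0 m a⟩

theorem dir_of_fixed {Ψ : (C → PowerSeries G) → C → PowerSeries G} (hΨ : IsContraction Ψ)
    (h : ∀ u, (∀ a, K.Dir (u a)) → ∀ a, K.Dir (Ψ u a)) {u : C → PowerSeries G}
    (hu : Ψ u = u) (a : C) : K.Dir (u a) := by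
  have h2 : ∀ m a, K.Dir (Ψ^[m] 0 a) := by
    intro m
    induction m with
    | zero => exact fun a => dir_zero
    | succ m ih => rw [Function.iterate_succ_apply']; exact h _ ih
  exact dir_of_truncEq fun m => ⟨_, h2 m a, hΨ.truncEq_iterate hu 0 m a⟩

theorem IsGreen.hasPar (hL : K.IsGreen κ L) {N : (C → PowerSeries G) → C → PowerSeries G}
    (hN : IsContraction N) {ε : ℝ}
    (h : ∀ u, (∀ a, K.HasPar ε (u a)) → ∀ a, K.HasPar ε (N u a)) {u : C → PowerSeries G}
    (hu : (∀ a, K.Dir (u a)) ∧ ∀ a, -(∑ μ, K.D μ (K.D μ (u a))) + κ • u a = N u a) (a : C) :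
    K.HasPar ε (u a) :=
  hasPar_of_fixed (IsContraction.lift_comp hN L) (fun u hu a => (h u hu a).lift hL.σ)
    ((hL.fixed_iff N u).1 hu) a

end Calculus

end GribovZwanziger

end

noncomputable section

namespace GribovZwanziger

namespace Calculus

open PowerSeries (coeff X)

variable {d : ℕ} {G E : Type*} [Ring G] [Algebra ℝ G] [Ring E] [Algebra ℝ E] (K : Calculus d G E)
  {C : Type}

/-! ### Gauge transformations -/

/-- The derivative of a multiplet. -/
def Dv (μ : Fin d) (u : C → PowerSeries G) : C → PowerSeries G := fun a => K.D μ (u a)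

theorem Dv_add (μ : Fin d) (u v : C → PowerSeries G) :
    K.Dv μ (u + v) = K.Dv μ u + K.Dv μ v := by funext a; exact map_add _ _ _

theorem Dv_sub (μ : Fin d) (u v : C → PowerSeries G) :
    K.Dv μ (u - v) = K.Dv μ u - K.Dv μ v := by funext a; exact map_sub _ _ _

theorem Dv_smul (μ : Fin d) (r : ℝ) (u : C → PowerSeries G) :
    K.Dv μ (r • u) = r • K.Dv μ u := by funext a; exact (K.D μ).map_smul r (u a)

theorem Dv_X_smul (μ : Fin d) (u : C → PowerSeries G) :
    K.Dv μ ((X : PowerSeries G) • u) = (X : PowerSeries G) • K.Dv μ u := by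
  funext a; exact K.D_X_mul _ _

theorem Dv_comm (μ ν : Fin d) (u : C → PowerSeries G) :
    K.Dv μ (K.Dv ν u) = K.Dv ν (K.Dv μ u) := by funext a; exact K.D_comm _ _ _

theorem Dv_C_smul {θ : G} (hθ : θ ∈ K.odd) (μ : Fin d) (u : C → PowerSeries G) :
    K.Dv μ ((PowerSeries.C θ : PowerSeries G) • u)
      = (PowerSeries.C θ : PowerSeries G) • K.Dv μ u := by
  funext a; exact D_C_mul hθ _ _

variable [Fintype C] (f : C → C → C → ℝ)

/-- The covariant derivative. -/
def covD (A : Fin d → C → PowerSeries G) (μ : Fin d) (u : C → PowerSeries G) :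
    C → PowerSeries G :=
  fun a => K.D μ (u a) - ∑ b, ∑ c, f a b c • (X * (A μ c * u b))

/-- The Faddeev-Popov operator. -/
def fp (A : Fin d → C → PowerSeries G) (u : C → PowerSeries G) : C → PowerSeries G :=
  fun a => -∑ μ, K.D μ (K.covD f A μ u a)

/-- Solutions of `(M(A) + κ) u = J` with vanishing boundary values. -/
def IsFPSolution (κ : ℝ) (A : Fin d → C → PowerSeries G) (J u : C → PowerSeries G) : Prop :=
  (∀ a, K.Dir (u a)) ∧ ∀ a, K.fp f A u a + κ • u a = J a

/-- The finite gauge transformation of a potential. -/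
def gaugeTransform (ξ : C → PowerSeries G) (A : Fin d → C → PowerSeries G) :
    Fin d → C → PowerSeries G :=
  fun μ a => gsum fun k => (1 / (k.factorial : ℝ)) • ((bracket f ξ)^[k] (A μ)) a
    - (1 / ((k + 1).factorial : ℝ)) • ((bracket f ξ)^[k] (fun b => K.D μ (ξ b))) a

/-- `ξ` dresses `A` to a transverse potential. -/
def IsDressing (A : Fin d → C → PowerSeries G) (ξ : C → PowerSeries G) : Prop :=
  (∀ a, K.HasPar 1 (ξ a)) ∧ (∀ a, K.Dir (ξ a)) ∧
    ∀ a, ∑ μ, K.D μ (K.gaugeTransform f ξ A μ a) = 0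

variable {f}

/-- Antisymmetry of `f` in its last two indices turns `-g f^{abc} A^c u^b` into `+g (A × u)^a`, the
form used in all later computations. -/
theorem covD_eq (hf : IsStructureConst f) (A : Fin d → C → PowerSeries G) (μ : Fin d)
    (u : C → PowerSeries G) :
    K.covD f A μ u = K.Dv μ u + (X : PowerSeries G) • bracket f (A μ) u := by
  funext a
  simp only [covD, Dv, bracket, Pi.add_apply, Pi.smul_apply, smul_eq_mul, Finset.mul_sum,
    mul_smul_comm]
  rw [sub_eq_add_neg, Finset.sum_comm, ← Finset.sum_neg_distrib]
  congr 1
  refine Finset.sum_congr rfl fun c _ => ?_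
  rw [← Finset.sum_neg_distrib]
  exact Finset.sum_congr rfl fun b _ => by rw [hf.swap_right, neg_smul, neg_neg]

theorem Dv_bracket (μ : Fin d) (u v : C → PowerSeries G) :
    K.Dv μ (bracket f u v) = bracket f (K.Dv μ u) v + bracket f u (K.Dv μ v) := by
  funext a
  exact bracket_leibniz f (K.D μ) (K.D_mul μ) u v a

theorem bracket_X_right (u v : C → PowerSeries G) :
    bracket f u ((X : PowerSeries G) • v) = (X : PowerSeries G) • bracket f u v :=
  bracket_mul_right f X u v fun b => X_comm (u b)

theorem bracket_X_left (u v : C → PowerSeries G) :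
    bracket f ((X : PowerSeries G) • u) v = (X : PowerSeries G) • bracket f u v :=
  bracket_mul_left f X u v

variable {K}

theorem bracket_C_right {θ : G} {u : C → PowerSeries G} (hu : ∀ a, K.HasPar 1 (u a))
    (v : C → PowerSeries G) :
    bracket f u ((PowerSeries.C θ : PowerSeries G) • v)
      = (PowerSeries.C θ : PowerSeries G) • bracket f u v :=
  bracket_mul_right f _ u v fun b => ((hu b).comm _).symm

theorem HasPar.bracket {ε ε' : ℝ} {u v : C → PowerSeries G} (hu : ∀ a, K.HasPar ε (u a))
    (hv : ∀ a, K.HasPar ε' (v a)) (a : C) : K.HasPar (ε * ε') (bracket f u v a) :=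
  HasPar.sum fun b _ => HasPar.sum fun c _ => ((hu b).mul (hv c)).smul _

theorem HasPar.even_bracket {ε : ℝ} {u v : C → PowerSeries G} (hu : ∀ a, K.HasPar 1 (u a))
    (hv : ∀ a, K.HasPar ε (v a)) (a : C) : K.HasPar ε (GribovZwanziger.bracket f u v a) := by
  simpa using HasPar.bracket hu hv a

theorem Dir.bracket_right (u : C → PowerSeries G) {v : C → PowerSeries G}
    (hv : ∀ a, K.Dir (v a)) (a : C) : K.Dir (bracket f u v a) :=
  Dir.sum fun _ _ => Dir.sum fun c _ => ((hv c).mul_left _).smul _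

theorem Dir.bracket_left {u : C → PowerSeries G} (hu : ∀ a, K.Dir (u a))
    (v : C → PowerSeries G) (a : C) : K.Dir (bracket f u v a) :=
  Dir.sum fun b _ => Dir.sum fun _ _ => ((hu b).mul_right _).smul _

/-! ### Power series in the adjoint action -/

variable (f) in
/-- `∑ₖ pₖ (g ad ξ)^k u`. -/
def adSum (p : ℕ → ℝ) (ξ u : C → PowerSeries G) : C → PowerSeries G :=
  fun a => gsum fun k => p k • ((bracket f ξ)^[k] u) a

theorem iterate_bracket_add (ξ u v : C → PowerSeries G) (k : ℕ) :
    (bracket f ξ)^[k] (u + v) = (bracket f ξ)^[k] u + (bracket f ξ)^[k] v := by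
  induction k with
  | zero => rfl
  | succ k ih => simp only [Function.iterate_succ_apply', ih, bracket_add_right]

theorem iterate_bracket_neg (ξ u : C → PowerSeries G) (k : ℕ) :
    (bracket f ξ)^[k] (-u) = -(bracket f ξ)^[k] u := by
  induction k with
  | zero => rfl
  | succ k ih => simp only [Function.iterate_succ_apply', ih, bracket_neg_right]

theorem iterate_bracket_mul {r : PowerSeries G} {ξ : C → PowerSeries G}
    (hr : ∀ b, r * ξ b = ξ b * r) (u : C → PowerSeries G) (k : ℕ) :
    (bracket f ξ)^[k] (r • u) = r • (bracket f ξ)^[k] u := by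
  induction k with
  | zero => rfl
  | succ k ih => simp only [Function.iterate_succ_apply', ih, bracket_mul_right f r ξ _ hr]

theorem adSum_add (p : ℕ → ℝ) (ξ u v : C → PowerSeries G) :
    adSum f p ξ (u + v) = adSum f p ξ u + adSum f p ξ v := by
  funext a
  simp only [adSum, iterate_bracket_add, Pi.add_apply, smul_add, gsum_add]

theorem adSum_neg (p : ℕ → ℝ) (ξ u : C → PowerSeries G) :
    adSum f p ξ (-u) = -adSum f p ξ u := by
  funext a
  simp only [adSum, iterate_bracket_neg, Pi.neg_apply, smul_neg, gsum_neg]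

theorem adSum_mul (p : ℕ → ℝ) {r : PowerSeries G} {ξ : C → PowerSeries G}
    (hr : ∀ b, r * ξ b = ξ b * r) (u : C → PowerSeries G) :
    adSum f p ξ (r • u) = r • adSum f p ξ u := by
  funext a
  simp only [adSum, iterate_bracket_mul hr, Pi.smul_apply, smul_eq_mul, mul_gsum, mul_smul_comm]

/-- Splitting off the lowest order. -/
theorem adSum_succ (p : ℕ → ℝ) (ξ u : C → PowerSeries G) :
    adSum f p ξ u = p 0 • u
      + (X : PowerSeries G) • adSum f (fun k => p (k + 1)) ξ (bracket f ξ u) := by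
  funext a
  simp only [adSum, Pi.add_apply, Pi.smul_apply, smul_eq_mul]
  rw [gsum_succ]
  rfl

theorem TruncEq.adSum (p : ℕ → ℝ) {m : ℕ} {ξ ξ' u u' : C → PowerSeries G}
    (h : ∀ a, TruncEq m (ξ a) (ξ' a)) (h' : ∀ a, TruncEq m (u a) (u' a)) (a : C) :
    TruncEq m (adSum f p ξ u a) (adSum f p ξ' u' a) :=
  TruncEq.gsum fun k => (TruncEq.iterate_bracket f h h' k a).smul _

theorem HasPar.iterate_bracket {ε : ℝ} {ξ u : C → PowerSeries G} (hξ : ∀ a, K.HasPar 1 (ξ a))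
    (hu : ∀ a, K.HasPar ε (u a)) (k : ℕ) (a : C) :
    K.HasPar ε ((GribovZwanziger.bracket f ξ)^[k] u a) := by
  induction k generalizing a with
  | zero => exact hu a
  | succ k ih =>
    rw [Function.iterate_succ_apply']
    exact HasPar.even_bracket hξ ih a

theorem HasPar.adSum (p : ℕ → ℝ) {ε : ℝ} {ξ u : C → PowerSeries G} (hξ : ∀ a, K.HasPar 1 (ξ a))
    (hu : ∀ a, K.HasPar ε (u a)) (a : C) : K.HasPar ε (adSum f p ξ u a) :=
  HasPar.gsum fun k => (HasPar.iterate_bracket hξ hu k a).smul _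

theorem Dir.adSum (p : ℕ → ℝ) (ξ : C → PowerSeries G) {u : C → PowerSeries G}
    (hu : ∀ a, K.Dir (u a)) (a : C) : K.Dir (adSum f p ξ u a) := by
  refine Dir.gsum fun k => Dir.smul ?_ _
  induction k generalizing a with
  | zero => exact hu a
  | succ k ih =>
    rw [Function.iterate_succ_apply']
    exact Dir.bracket_right ξ ih a

/-- The coefficients of the exponential series. -/
def expCoeff (k : ℕ) : ℝ := 1 / (k.factorial : ℝ)

/-- The coefficients of `(exp x - 1) / x`. -/
def phiCoeff (k : ℕ) : ℝ := 1 / ((k + 1).factorial : ℝ)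

theorem gaugeTransform_eq (ξ : C → PowerSeries G) (A : Fin d → C → PowerSeries G) (μ : Fin d) :
    K.gaugeTransform f ξ A μ = adSum f expCoeff ξ (A μ) - adSum f phiCoeff ξ (K.Dv μ ξ) := by
  funext a
  rw [Pi.sub_apply, adSum, adSum, ← gsum_sub]
  rfl

theorem adSum_exp (ξ u : C → PowerSeries G) :
    adSum f expCoeff ξ u = u + (X : PowerSeries G) • adSum f phiCoeff ξ (bracket f ξ u) := by
  rw [adSum_succ]
  simp only [expCoeff, Nat.factorial_zero, Nat.cast_one, div_one, one_smul]
  rfl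

theorem adSum_phi (ξ u : C → PowerSeries G) :
    adSum f phiCoeff ξ u = u + (X : PowerSeries G) •
      adSum f (fun k => phiCoeff (k + 1)) ξ (bracket f ξ u) := by
  rw [adSum_succ]
  simp [phiCoeff]

/-- `A^h - A = - φ(g ad ξ) D(A) ξ`. -/
theorem gaugeTransform_eq_sub (hf : IsStructureConst f) {ξ : C → PowerSeries G}
    (hξ : ∀ a, K.HasPar 1 (ξ a)) (A : Fin d → C → PowerSeries G) (μ : Fin d) :
    K.gaugeTransform f ξ A μ = A μ - adSum f phiCoeff ξ (K.covD f A μ ξ) := by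
  -- Since `exp x = 1 + x φ(x)` and `ξ × A = -A × ξ`, both terms beyond `A` combine into `φ(g ad ξ)`
  -- applied to `∂ξ + g A × ξ`.
  rw [gaugeTransform_eq, adSum_exp, covD_eq K hf, adSum_add, adSum_mul _ (fun b => X_comm _),
    bracket_anticomm hf (fun b c => (hξ b).comm _), adSum_neg, smul_neg]
  abel

theorem HasPar.gaugeTransform {ξ : C → PowerSeries G} (hξ : ∀ a, K.HasPar 1 (ξ a))
    {A : Fin d → C → PowerSeries G} (hA : ∀ μ a, K.HasPar 1 (A μ a)) (μ : Fin d) (a : C) :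
    K.HasPar 1 (K.gaugeTransform f ξ A μ a) := by
  rw [gaugeTransform_eq]
  exact (HasPar.adSum _ hξ (hA μ) a).sub (HasPar.adSum _ hξ (fun b => (hξ b).D μ) a)

/-! ### Existence of the dressing and of the Faddeev-Popov inverse -/

variable (K f) in
/-- The right-hand side of the boundary value problem for the dressing. -/
def dressingRHS (A : Fin d → C → PowerSeries G) (ξ : C → PowerSeries G) : C → PowerSeries G :=
  fun a => -∑ μ, K.D μ (A μ a + X * (adSum f phiCoeff ξ (bracket f ξ (A μ)) a
    - adSum f (fun k => phiCoeff (k + 1)) ξ (bracket f ξ (K.Dv μ ξ)) a))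

theorem isContraction_dressingRHS (A : Fin d → C → PowerSeries G) :
    IsContraction (K.dressingRHS f A) := by
  intro m u v h a
  refine TruncEq.neg (TruncEq.sum fun μ _ => ((TruncEq.refl _ _).add (TruncEq.X_mul ?_)).lift _)
  exact (TruncEq.adSum _ h (TruncEq.brk f h fun a => TruncEq.refl _ _) a).sub
    (TruncEq.adSum _ h (TruncEq.brk f h fun a => (h a).lift _) a)

/-- To lowest order the transformed potential is `A - ∂ξ`. Splitting this off leaves `-∂²ξ` on one
side and, on the other, terms in which `ξ` occurs only behind a factor `g`. -/
theorem dressing_equation_iff (A : Fin d → C → PowerSeries G) (ξ : C → PowerSeries G) (a : C) :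
    ∑ μ, K.D μ (K.gaugeTransform f ξ A μ a) = 0 ↔
      -(∑ μ, K.D μ (K.D μ (ξ a))) + (0 : ℝ) • ξ a = K.dressingRHS f A ξ a := by
  have e : ∀ μ, K.gaugeTransform f ξ A μ a = (A μ a + X * (adSum f phiCoeff ξ (bracket f ξ (A μ)) a
    - adSum f (fun k => phiCoeff (k + 1)) ξ (bracket f ξ (K.Dv μ ξ)) a)) - K.D μ (ξ a) := by
    intro μ
    rw [gaugeTransform_eq, adSum_exp, adSum_phi ξ (K.Dv μ ξ)]
    simp only [Pi.sub_apply, Pi.add_apply, Pi.smul_apply, smul_eq_mul, mul_sub]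
    rw [show K.Dv μ ξ a = K.D μ (ξ a) from rfl]
    abel
  simp only [e, map_sub, Finset.sum_sub_distrib]
  rw [zero_smul, add_zero, dressingRHS, neg_inj, sub_eq_zero, eq_comm]

theorem hasPar_dressingRHS {A : Fin d → C → PowerSeries G} (hA : ∀ μ a, K.HasPar 1 (A μ a))
    {ξ : C → PowerSeries G} (hξ : ∀ a, K.HasPar 1 (ξ a)) (a : C) :
    K.HasPar 1 (K.dressingRHS f A ξ a) := by
  refine HasPar.neg (HasPar.sum fun μ _ => HasPar.D ((hA μ a).add (HasPar.X_mul ?_)) μ)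
  exact (HasPar.adSum _ hξ (HasPar.even_bracket hξ (hA μ)) a).sub
    (HasPar.adSum _ hξ (HasPar.even_bracket hξ fun b => (hξ b).D μ) a)

variable {L : G →ₗ[ℝ] G} {κ : ℝ}

theorem IsGreen.existsUnique_dressing (hL : K.IsGreen 0 L) {A : Fin d → C → PowerSeries G}
    (hA : ∀ μ a, K.HasPar 1 (A μ a)) : ∃! ξ, K.IsDressing f A ξ := by
  have hc := isContraction_dressingRHS (K := K) (f := f) A
  obtain ⟨ξ, hξ, hu⟩ := hL.existsUnique hc
  -- Uniqueness needs no parity; evenness of the solution comes from the iteration, which preserves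
  -- it.
  refine ⟨ξ, ⟨hL.hasPar hc (fun u hu => hasPar_dressingRHS hA hu) hξ, hξ.1,
    fun a => (dressing_equation_iff A ξ a).2 (hξ.2 a)⟩, fun v hv => hu v ⟨hv.2.1, fun a =>
      (dressing_equation_iff A v a).1 (hv.2.2 a)⟩⟩

variable (K f) in
/-- The right-hand side of the boundary value problem for the Faddeev-Popov inverse. -/
def fpRHS (A : Fin d → C → PowerSeries G) (J u : C → PowerSeries G) : C → PowerSeries G :=
  fun a => J a + X * ∑ μ, K.D μ (bracket f (A μ) u a)

theorem isContraction_fpRHS (A : Fin d → C → PowerSeries G) (J : C → PowerSeries G) :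
    IsContraction (K.fpRHS f A J) := by
  intro m u v h a
  exact (TruncEq.refl _ _).add (TruncEq.X_mul (TruncEq.sum fun μ _ =>
    (TruncEq.brk f (fun b => TruncEq.refl _ _) h a).lift _))

theorem fp_equation_iff (hf : IsStructureConst f) (A : Fin d → C → PowerSeries G)
    (J u : C → PowerSeries G) (a : C) : K.fp f A u a + κ • u a = J a ↔
      -(∑ μ, K.D μ (K.D μ (u a))) + κ • u a = K.fpRHS f A J u a := by
  have e : K.fp f A u a = -(∑ μ, K.D μ (K.D μ (u a))) - X * ∑ μ, K.D μ (bracket f (A μ) u a) := by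
    rw [fp]
    simp only [covD_eq K hf, Pi.add_apply, Pi.smul_apply, smul_eq_mul, map_add, D_X_mul,
      Finset.sum_add_distrib, Finset.mul_sum, neg_add_rev, Dv]
    abel
  rw [e, fpRHS, sub_add_eq_add_sub, sub_eq_iff_eq_add]

theorem IsGreen.existsUnique_fp (hL : K.IsGreen κ L) (hf : IsStructureConst f)
    (A : Fin d → C → PowerSeries G) (J : C → PowerSeries G) :
    ∃! u, K.IsFPSolution f κ A J u := by
  obtain ⟨u, hu, h⟩ := hL.existsUnique (isContraction_fpRHS (K := K) (f := f) A J)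
  exact ⟨u, ⟨hu.1, fun a => (fp_equation_iff hf A J u a).2 (hu.2 a)⟩,
    fun v hv => h v ⟨hv.1, fun a => (fp_equation_iff hf A J v a).1 (hv.2 a)⟩⟩

theorem IsGreen.hasPar_fp (hL : K.IsGreen κ L) (hf : IsStructureConst f)
    {A : Fin d → C → PowerSeries G} (hA : ∀ μ a, K.HasPar 1 (A μ a)) {ε : ℝ}
    {J u : C → PowerSeries G} (hJ : ∀ a, K.HasPar ε (J a)) (hu : K.IsFPSolution f κ A J u)
    (a : C) : K.HasPar ε (u a) := by
  refine hL.hasPar (isContraction_fpRHS (K := K) (f := f) A J) (fun u hu a => ?_)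
    ⟨hu.1, fun a => (fp_equation_iff hf A J u a).1 (hu.2 a)⟩ a
  exact (hJ a).add (HasPar.X_mul (HasPar.sum fun μ _ => (HasPar.even_bracket (hA μ) hu a).D μ))

end Calculus

end GribovZwanziger

end

noncomputable section

namespace GribovZwanziger

namespace Calculus

open PowerSeries (coeff X)

variable {d : ℕ} {G E : Type*} [Ring G] [Algebra ℝ G] [Ring E] [Algebra ℝ E] {K : Calculus d G E}
  {C : Type} [Fintype C] {f : C → C → C → ℝ}

/-! ### Gauge invariance of the dressed potential -/

variable (f) in
/-- The Taylor coefficients of the solution of `u' = ξ × u + s`, `u(0) = u₀`. -/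
def flowSeq (ξ u₀ s : C → PowerSeries G) : ℕ → C → PowerSeries G
  | 0 => u₀
  | k + 1 => ((k : ℝ) + 1)⁻¹ • (bracket f ξ (flowSeq ξ u₀ s k) + if k = 0 then s else 0)

theorem flowSeq_succ (ξ u₀ s : C → PowerSeries G) (k : ℕ) :
    ((k : ℝ) + 1) • flowSeq f ξ u₀ s (k + 1)
      = bracket f ξ (flowSeq f ξ u₀ s k) + if k = 0 then s else 0 := by
  rw [flowSeq, smul_smul, mul_inv_cancel₀ (by positivity), one_smul]

theorem flowSeq_succ_eq (ξ u₀ s : C → PowerSeries G) (k : ℕ) :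
    flowSeq f ξ u₀ s (k + 1) = expCoeff (k + 1) • (bracket f ξ)^[k + 1] u₀
      + phiCoeff k • (bracket f ξ)^[k] s := by
  induction k with
  | zero => simp [flowSeq, expCoeff, phiCoeff]
  | succ k ih =>
    have e : ∀ n : ℕ, (((n + 1 : ℕ) : ℝ) + 1)⁻¹ * (1 / ((n + 1).factorial : ℝ))
        = 1 / ((n + 2).factorial : ℝ) := by
      intro n
      rw [Nat.factorial_succ (n + 1)]
      push_cast
      field_simp
    rw [flowSeq, ih, bracket_add_right, bracket_smul_right, bracket_smul_right, if_neg (by omega),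
      add_zero, smul_add, smul_smul, smul_smul, ← Function.iterate_succ_apply' (bracket f ξ),
      ← Function.iterate_succ_apply' (bracket f ξ)]
    simp only [expCoeff, phiCoeff, e]

/-- `gsum` evaluates the Taylor series of the flow at time `g`. With initial value `g u` the result
is `g` times a combination of `exp` and `φ`, the shape of a finite gauge transformation when `s =
-∂ξ`. -/
theorem gsum_flowSeq (ξ u s : C → PowerSeries G) (a : C) :
    gsum (fun k => flowSeq f ξ ((X : PowerSeries G) • u) s k a)
      = X * (adSum f expCoeff ξ u a + adSum f phiCoeff ξ s a) := by
  have e : (X : PowerSeries G) * adSum f expCoeff ξ u a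
      = gsum fun k => expCoeff k • ((bracket f ξ)^[k] ((X : PowerSeries G) • u)) a := by
    change _ = adSum f expCoeff ξ ((X : PowerSeries G) • u) a
    rw [adSum_mul _ (fun b => X_comm _), Pi.smul_apply, smul_eq_mul]
  rw [mul_add, e, gsum_succ, gsum_succ (fun k => expCoeff k • _), add_assoc]
  congr 1
  · simp [flowSeq, expCoeff]
  · rw [adSum, ← mul_add, ← gsum_add]
    congr 2
    funext k
    rw [flowSeq_succ_eq]
    rfl

theorem IsMul.D {θ : G} (hθ : θ ∈ K.odd) {u : PowerSeries G} (hu : IsMul θ u) (μ : Fin d) :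
    IsMul θ (K.D μ u) := by
  obtain ⟨u, rfl⟩ := hu
  exact ⟨_, D_C_mul hθ μ u⟩

theorem IsMul.bracket {θ : G} {u v : C → PowerSeries G} (hu : ∀ a, K.HasPar 1 (u a))
    (hv : ∀ a, IsMul θ (v a)) (a : C) : IsMul θ (GribovZwanziger.bracket f u v a) := by
  choose w hw using hv
  obtain rfl : v = (PowerSeries.C θ : PowerSeries G) • w := funext hw
  exact ⟨_, congrFun (bracket_C_right hu w) a⟩

theorem bracket_eq_zero_of_isMul {θ : G} (hθ : θ ∈ K.odd) {u v : C → PowerSeries G}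
    (hu : ∀ a, IsMul θ (u a)) (hv : ∀ a, IsMul θ (v a)) : bracket f u v = 0 := by
  funext a
  refine Finset.sum_eq_zero fun b _ => Finset.sum_eq_zero fun c _ => ?_
  obtain ⟨x, hx⟩ := hu b
  obtain ⟨y, hy⟩ := hv c
  rw [hx, hy, C_mul_mul_C_mul hθ, smul_zero]

theorem isMul_flowSeq {θ : G} {ξ u s : C → PowerSeries G} (hξ : ∀ a, K.HasPar 1 (ξ a))
    (hu : ∀ a, IsMul θ (u a)) (hs : ∀ a, IsMul θ (s a)) (k : ℕ) (a : C) :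
    IsMul θ (flowSeq f ξ u s k a) := by
  induction k generalizing a with
  | zero => exact hu a
  | succ k ih =>
    refine IsMul.smul (IsMul.add (IsMul.bracket hξ ih a) ?_) _
    split_ifs
    · exact hs a
    · exact isMul_zero θ

theorem hasPar_flowSeq {ξ u s : C → PowerSeries G} (hξ : ∀ a, K.HasPar 1 (ξ a))
    (hu : ∀ a, K.HasPar 1 (u a)) (hs : ∀ a, K.HasPar 1 (s a)) (k : ℕ) (a : C) :
    K.HasPar 1 (flowSeq f ξ u s k a) := by
  induction k generalizing a with
  | zero => exact hu a
  | succ k ih =>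
    refine HasPar.smul (HasPar.add (HasPar.even_bracket hξ ih a) ?_) _
    split_ifs
    · exact hs a
    · exact hasPar_zero 1

open Finset.HasAntidiagonal in
theorem sum_antidiagonal_ite_left {M : Type*} [AddCommMonoid M] (F : ℕ → M) (k : ℕ) :
    ∑ p ∈ antidiagonal k, (if p.1 = 0 then F p.2 else 0) = F k := by
  rw [Finset.sum_eq_single (0, k)]
  · simp
  · rintro ⟨i, j⟩ hp hne
    rw [Finset.HasAntidiagonal.mem_antidiagonal] at hp
    rw [if_neg]
    rintro rfl
    simp only [zero_add] at hp
    exact hne (by rw [hp])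
  · intro h
    exact absurd (Finset.HasAntidiagonal.mem_antidiagonal.2 (zero_add k)) h

open Finset.HasAntidiagonal in
theorem sum_antidiagonal_ite_right {M : Type*} [AddCommMonoid M] (F : ℕ → M) (k : ℕ) :
    ∑ p ∈ antidiagonal k, (if p.2 = 0 then F p.1 else 0) = F k := by
  rw [← Finset.Nat.sum_antidiagonal_swap]
  exact sum_antidiagonal_ite_left F k

open Finset.HasAntidiagonal in
/-- The variation of the flow of a gauge transformation is an infinitesimal gauge
transformation. -/
theorem flow_variation_step (hf : IsStructureConst f) (μ : Fin d) {ξ A η Z : C → PowerSeries G}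
    (hξ : ∀ a, K.HasPar 1 (ξ a)) (hA : ∀ a, K.HasPar 1 (A a)) (k : ℕ) :
    ((k : ℝ) + 1) • ∑ p ∈ antidiagonal (k + 1), bracket f (flowSeq f ξ A (-K.Dv μ ξ) p.1)
        (flowSeq f ξ η Z p.2)
      = bracket f ξ (∑ p ∈ antidiagonal k, bracket f (flowSeq f ξ A (-K.Dv μ ξ) p.1)
        (flowSeq f ξ η Z p.2)) - bracket f (K.Dv μ ξ) (flowSeq f ξ η Z k)
        - bracket f Z (flowSeq f ξ A (-K.Dv μ ξ) k) := by
  set α := flowSeq f ξ A (-K.Dv μ ξ) with hα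
  set ε := flowSeq f ξ η Z with hε
  have hαe : ∀ k a, K.HasPar 1 (α k a) :=
    fun k a => hasPar_flowSeq hξ hA (fun b => ((hξ b).D μ).neg) k a
  -- Leibniz rule on Taylor coefficients: on the antidiagonal `k + 1 = p.1 + p.2`, and each part
  -- differentiates one factor.
  have e1 : ((k : ℝ) + 1) • ∑ p ∈ antidiagonal (k + 1), bracket f (α p.1) (ε p.2)
      = ∑ p ∈ antidiagonal (k + 1), bracket f ((p.1 : ℝ) • α p.1) (ε p.2)
        + ∑ p ∈ antidiagonal (k + 1), bracket f (α p.1) ((p.2 : ℝ) • ε p.2) := by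
    rw [← Finset.sum_add_distrib, Finset.smul_sum]
    refine Finset.sum_congr rfl fun p hp => ?_
    rw [bracket_smul_left, bracket_smul_right, ← add_smul]
    congr 1
    exact_mod_cast (Finset.HasAntidiagonal.mem_antidiagonal.1 hp).symm
  rw [e1, Finset.Nat.sum_antidiagonal_succ, Finset.Nat.sum_antidiagonal_succ']
  simp only [Nat.cast_zero, zero_smul, bracket_zero_left, bracket_zero_right, zero_add,
    Nat.cast_add, Nat.cast_one]
  have e2 : ∀ p ∈ antidiagonal k, bracket f (((p.1 : ℝ) + 1) • α (p.1 + 1)) (ε p.2)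
      = bracket f (bracket f ξ (α p.1)) (ε p.2)
        + if p.1 = 0 then -bracket f (K.Dv μ ξ) (ε p.2) else 0 := by
    intro p _
    rw [hα, flowSeq_succ, bracket_add_left]
    congr 1
    split_ifs
    · rw [bracket_neg_left]
    · rw [bracket_zero_left]
  have e3 : ∀ p ∈ antidiagonal k, bracket f (α p.1) (((p.2 : ℝ) + 1) • ε (p.2 + 1))
      = bracket f (α p.1) (bracket f ξ (ε p.2))
        + if p.2 = 0 then -bracket f Z (α p.1) else 0 := by
    intro p _
    rw [hε, flowSeq_succ, bracket_add_right]
    congr 1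
    split_ifs
    · rw [bracket_anticomm hf fun b c => (hαe _ b).comm _]
    · rw [bracket_zero_right]
  -- The flow equations have been inserted for both factors. The source terms survive only at index
  -- zero; the terms with `ξ` recombine by the Jacobi identity.
  rw [Finset.sum_congr rfl e2, Finset.sum_congr rfl e3, Finset.sum_add_distrib,
    Finset.sum_add_distrib, sum_antidiagonal_ite_left (fun j => -bracket f (K.Dv μ ξ) (ε j)),
    sum_antidiagonal_ite_right (fun j => -bracket f Z (α j)), bracket_sum_right]
  simp only [bracket_jacobi hf (ε _) (fun b c => (hξ b).comm _), Finset.sum_add_distrib]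
  abel

open Finset.HasAntidiagonal in
-- Let `α` flow under `ξ` from `A` with source `-∂ξ`, and `ε` from `η` with source `Z`. Then `α - ∂ε
-- - α × ε` obeys the flow equation of `ξ + Z` with source `-∂(ξ + Z)`, up to terms quadratic in
-- `θ`, which vanish. Its initial value is that on the left, so the Taylor coefficients agree.
theorem flowSeq_variation (hf : IsStructureConst f) (μ : Fin d) {θ : G} (hθ : θ ∈ K.odd)
    {ξ A η Z : C → PowerSeries G} (hξ : ∀ a, K.HasPar 1 (ξ a)) (hA : ∀ a, K.HasPar 1 (A a))
    (hη' : ∀ a, IsMul θ (η a)) (hZ' : ∀ a, IsMul θ (Z a)) (k : ℕ) :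
    flowSeq f (ξ + Z) (A - K.Dv μ η - bracket f A η) (-K.Dv μ (ξ + Z)) k
      = flowSeq f ξ A (-K.Dv μ ξ) k - K.Dv μ (flowSeq f ξ η Z k)
        - ∑ p ∈ antidiagonal k, bracket f (flowSeq f ξ A (-K.Dv μ ξ) p.1)
          (flowSeq f ξ η Z p.2) := by
  induction k with
  | zero => simp [flowSeq]
  | succ k ih =>
    have hαe : ∀ k a, K.HasPar 1 (flowSeq f ξ A (-K.Dv μ ξ) k a) :=
      fun k a => hasPar_flowSeq hξ hA (fun b => ((hξ b).D μ).neg) k a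
    have hεm : ∀ k a, IsMul θ (flowSeq f ξ η Z k a) := isMul_flowSeq hξ hη' hZ'
    have h0 : ((k : ℝ) + 1) ≠ 0 := by positivity
    refine smul_right_injective _ h0 ?_
    simp only
    rw [smul_sub, smul_sub, flow_variation_step hf μ hξ hA, ← Dv_smul, flowSeq_succ,
      flowSeq_succ, flowSeq_succ, ih]
    -- Both `Z` and the coefficients of `ε` carry a factor `θ`, and `θ² = 0`.
    have hz1 : bracket f Z (K.Dv μ (flowSeq f ξ η Z k)) = 0 :=
      bracket_eq_zero_of_isMul hθ hZ' fun a => IsMul.D hθ (hεm k a) μ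
    have hz2 : bracket f Z (∑ p ∈ antidiagonal k, bracket f (flowSeq f ξ A (-K.Dv μ ξ) p.1)
        (flowSeq f ξ η Z p.2)) = 0 := by
      refine bracket_eq_zero_of_isMul hθ hZ' fun a => ?_
      rw [Finset.sum_apply]
      exact IsMul.sum fun p _ => IsMul.bracket (hαe _) (hεm _) a
    simp only [bracket_add_left, bracket_sub_right, hz1, hz2, Dv_add, Dv_bracket]
    split_ifs
    · abel
    · rw [show K.Dv μ (0 : C → PowerSeries G) = 0 from funext fun a => map_zero _]
      abel

/-- If `exp(g ad ξ) η + φ(g ad ξ) Z = 0`, the gauge transformation by `ξ + Z` of `A - D η` is that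
by `ξ` of `A`. -/
theorem gaugeTransform_variation (hf : IsStructureConst f) {θ : G} (hθ : θ ∈ K.odd)
    {ξ η Z : C → PowerSeries G} {A : Fin d → C → PowerSeries G} (hξ : ∀ a, K.HasPar 1 (ξ a))
    (hA : ∀ μ a, K.HasPar 1 (A μ a)) (hη' : ∀ a, IsMul θ (η a))
    (hZ' : ∀ a, IsMul θ (Z a)) (h : adSum f expCoeff ξ η + adSum f phiCoeff ξ Z = 0) :
    K.gaugeTransform f (ξ + Z) (fun μ => A μ - K.covD f A μ η) = K.gaugeTransform f ξ A := by
  funext μ a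
  -- The flow starts from `g A` and `g η`: after multiplication by `g` the covariant derivative
  -- loses its explicit coupling, as `g D η = ∂(gη) + (gA) × (gη)`.
  apply X_mul_cancel
  have e : ∀ (ξ : C → PowerSeries G) (A : Fin d → C → PowerSeries G),
      X * K.gaugeTransform f ξ A μ a
        = gsum fun k => flowSeq f ξ ((X : PowerSeries G) • A μ) (-K.Dv μ ξ) k a := by
    intro ξ A
    rw [gsum_flowSeq, gaugeTransform_eq, adSum_neg, Pi.sub_apply, Pi.neg_apply, sub_eq_add_neg]
  have e0 : (X : PowerSeries G) • (A μ - K.covD f A μ η)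
      = (X : PowerSeries G) • A μ - K.Dv μ ((X : PowerSeries G) • η)
        - bracket f ((X : PowerSeries G) • A μ) ((X : PowerSeries G) • η) := by
    rw [covD_eq K hf, bracket_X_left, bracket_X_right, Dv_X_smul, smul_sub, smul_add]
    abel
  have hXm : ∀ a, IsMul θ (((X : PowerSeries G) • η) a) := fun b => by
    obtain ⟨w, hw⟩ := hη' b
    exact ⟨X * w, by rw [Pi.smul_apply, hw, smul_eq_mul, ← mul_assoc, X_comm, mul_assoc]⟩
  have hXA : ∀ a, K.HasPar 1 (((X : PowerSeries G) • A μ) a) := fun b => (hA μ b).X_mul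
  rw [e, e, e0]
  simp only [flowSeq_variation hf μ hθ hξ hXA hXm hZ', Pi.sub_apply, Finset.sum_apply]
  rw [gsum_sub, gsum_sub, ← bracket_gsum_gsum]
  -- At time `g` the parameter `ε` equals `g (exp(g ad ξ) η + φ(g ad ξ) Z)`, which is zero by
  -- hypothesis.
  have hz : (fun b => gsum fun k => flowSeq f ξ ((X : PowerSeries G) • η) Z k b) = 0 := by
    funext b
    rw [gsum_flowSeq, ← Pi.add_apply, h, Pi.zero_apply, mul_zero]
  have hz' : gsum (fun k => K.Dv μ (flowSeq f ξ ((X : PowerSeries G) • η) Z k) a) = 0 := by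
    have := congrFun hz a
    rw [show (fun k => K.Dv μ (flowSeq f ξ ((X : PowerSeries G) • η) Z k) a)
      = fun k => lift (K.pd μ) (flowSeq f ξ ((X : PowerSeries G) • η) Z k a) from rfl,
      ← lift_gsum, this, Pi.zero_apply, map_zero]
  rw [hz, bracket_zero_right, hz', Pi.zero_apply, sub_zero, sub_zero]

/-- The dressing parameter of the infinitesimally transformed potential. -/
theorem exists_dressing_variation {ξ c : C → PowerSeries G} (hξ : ∀ a, K.HasPar 1 (ξ a))
    (hc : ∀ a, K.HasPar (-1) (c a)) (hc' : ∀ a, K.Dir (c a)) :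
    ∃ ζ : C → PowerSeries G, (∀ a, K.HasPar (-1) (ζ a)) ∧ (∀ a, K.Dir (ζ a)) ∧
      adSum f expCoeff ξ c + adSum f phiCoeff ξ ζ = 0 := by
  -- The equation solved for `ζ`: `φ` has constant term `1`, and the rest of `φ(g ad ξ) ζ` carries a
  -- factor `g`.
  set Ψ : (C → PowerSeries G) → C → PowerSeries G := fun ζ a => -(adSum f expCoeff ξ c a
    + X * adSum f (fun k => phiCoeff (k + 1)) ξ (bracket f ξ ζ) a) with hΨ
  have hcon : IsContraction Ψ := fun m u v h a => ((TruncEq.refl _ _).add (TruncEq.X_mul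
    (TruncEq.adSum _ (fun _ => TruncEq.refl _ _) (TruncEq.brk f (fun _ => TruncEq.refl _ _) h)
      a))).neg
  obtain ⟨ζ, hζ⟩ := hcon.exists_fixed
  refine ⟨ζ, hasPar_of_fixed hcon (fun u hu a => ?_) hζ, dir_of_fixed hcon (fun u hu a => ?_) hζ,
    ?_⟩
  · exact ((HasPar.adSum _ hξ hc a).add
      (HasPar.adSum _ hξ (HasPar.even_bracket hξ hu) a).X_mul).neg
  · exact ((Dir.adSum _ ξ hc' a).add ((Dir.adSum _ ξ (Dir.bracket_right ξ hu) a).mul_left X)).neg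
  · funext a
    rw [adSum_phi]
    have := congrFun hζ a
    simp only [hΨ] at this
    simp only [Pi.add_apply, Pi.smul_apply, smul_eq_mul, Pi.zero_apply]
    nth_rw 1 [← this]
    abel

variable (K f) in
/-- The field `A^h`. -/
def dressed (A : Fin d → C → PowerSeries G) : Fin d → C → PowerSeries G :=
  K.gaugeTransform f (Classical.epsilon (K.IsDressing f A)) A

variable {L : G →ₗ[ℝ] G}

theorem IsGreen.isDressing_epsilon (hL : K.IsGreen 0 L) {A : Fin d → C → PowerSeries G}
    (hA : ∀ μ a, K.HasPar 1 (A μ a)) :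
    K.IsDressing f A (Classical.epsilon (K.IsDressing f A)) :=
  Classical.epsilon_spec (hL.existsUnique_dressing hA).exists

theorem IsGreen.hasPar_dressed (hL : K.IsGreen 0 L) {A : Fin d → C → PowerSeries G}
    (hA : ∀ μ a, K.HasPar 1 (A μ a)) (μ : Fin d) (a : C) : K.HasPar 1 (K.dressed f A μ a) :=
  HasPar.gaugeTransform (hL.isDressing_epsilon hA).1 hA μ a

theorem IsGreen.dressed_transverse (hL : K.IsGreen 0 L) {A : Fin d → C → PowerSeries G}
    (hA : ∀ μ a, K.HasPar 1 (A μ a)) (a : C) : ∑ μ, K.D μ (K.dressed f A μ a) = 0 :=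
  (hL.isDressing_epsilon hA).2.2 a

/-- `A^h` is invariant under BRST transformations. -/
theorem IsGreen.dressed_invariant (hL : K.IsGreen 0 L) (hf : IsStructureConst f) {θ : G}
    (hθ : θ ∈ K.odd) {A : Fin d → C → PowerSeries G} (hA : ∀ μ a, K.HasPar 1 (A μ a))
    {c : C → PowerSeries G} (hc : ∀ a, K.HasPar (-1) (c a)) (hc' : ∀ a, K.Dir (c a)) :
    K.dressed f (fun μ => A μ + (PowerSeries.C θ : PowerSeries G) • -K.covD f A μ c)
      = K.dressed f A := by
  have hξ := hL.isDressing_epsilon (f := f) hA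
  set ξ := Classical.epsilon (K.IsDressing f A)
  obtain ⟨ζ, hζ, hζ', h⟩ := exists_dressing_variation (f := f) hξ.1 hc hc'
  set η : C → PowerSeries G := (PowerSeries.C θ : PowerSeries G) • c with hη
  set Z : C → PowerSeries G := (PowerSeries.C θ : PowerSeries G) • ζ with hZ
  have hAη : (fun μ => A μ + (PowerSeries.C θ : PowerSeries G) • -K.covD f A μ c)
      = fun μ => A μ - K.covD f A μ η := by
    funext μ
    rw [covD_eq K hf, covD_eq K hf, hη, bracket_C_right (hA μ), Dv_C_smul _ hθ, smul_neg, smul_add,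
      ← sub_eq_add_neg, smul_smul, smul_smul, ← X_comm]
  have hZe : ∀ a, K.HasPar 1 (Z a) := fun a => (hasPar_C hθ).odd_mul_odd (hζ a)
  have hηe : ∀ a, K.HasPar 1 (η a) := fun a => (hasPar_C hθ).odd_mul_odd (hc a)
  have hcomm : ∀ b, (PowerSeries.C θ : PowerSeries G) * ξ b = ξ b * PowerSeries.C θ :=
    fun b => ((hξ.1 b).comm _).symm
  -- The odd constant `θ` commutes with the even `ξ`, so it can be pulled out of the equation for
  -- `c` and `ζ`.
  have key := gaugeTransform_variation hf hθ (η := η) (Z := Z) hξ.1 hA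
    (fun a => ⟨_, rfl⟩) (fun a => ⟨_, rfl⟩) (by
      rw [hη, hZ, adSum_mul _ hcomm, adSum_mul _ hcomm, ← smul_add, h, smul_zero])
  rw [hAη]
  have hA' : ∀ μ a, K.HasPar 1 ((A μ - K.covD f A μ η) a) := fun μ a => by
    rw [covD_eq K hf]
    exact (hA μ a).sub (((hηe a).D μ).add (HasPar.even_bracket (hA μ) hηe a).X_mul)
  have hd : K.IsDressing f (fun μ => A μ - K.covD f A μ η) (ξ + Z) := by
    refine ⟨fun a => (hξ.1 a).add (hZe a), fun a => (hξ.2.1 a).add ((hζ' a).mul_left _), ?_⟩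
    rw [key]
    exact hξ.2.2
  -- The dressing chosen for the varied potential must be `ξ + Z`, by uniqueness.
  rw [dressed, (hL.existsUnique_dressing hA').unique (hL.isDressing_epsilon hA') hd, key]
  rfl

end Calculus

end GribovZwanziger

end

noncomputable section

namespace GribovZwanziger

/-! ### The invariant pairing -/

section Pairing

variable {C : Type} [Fintype C] {S : Type*} [Ring S] [Algebra ℝ S] {f : C → C → C → ℝ}

theorem pair_add_left (u u' v : C → S) : pair (u + u') v = pair u v + pair u' v := by
  simp [pair, add_mul, Finset.sum_add_distrib]

theorem pair_add_right (u v v' : C → S) : pair u (v + v') = pair u v + pair u v' := by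
  simp [pair, mul_add, Finset.sum_add_distrib]

theorem pair_neg_left (u v : C → S) : pair (-u) v = -pair u v := by simp [pair]

theorem pair_neg_right (u v : C → S) : pair u (-v) = -pair u v := by simp [pair]

theorem pair_sub_left (u u' v : C → S) : pair (u - u') v = pair u v - pair u' v := by
  rw [sub_eq_add_neg, pair_add_left, pair_neg_left, sub_eq_add_neg]

theorem pair_sub_right (u v v' : C → S) : pair u (v - v') = pair u v - pair u v' := by
  rw [sub_eq_add_neg, pair_add_right, pair_neg_right, sub_eq_add_neg]

theorem pair_smul_left (r : ℝ) (u v : C → S) : pair (r • u) v = r • pair u v := by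
  simp [pair, Finset.smul_sum]

theorem pair_smul_right (r : ℝ) (u v : C → S) : pair u (r • v) = r • pair u v := by
  simp [pair, Finset.smul_sum]

theorem pair_mul_left (r : S) (u v : C → S) : pair (r • u) v = r * pair u v := by
  simp [pair, Finset.mul_sum, mul_assoc]

theorem pair_mul_right (r : S) (u v : C → S) (h : ∀ a, r * u a = u a * r) :
    pair u (r • v) = r * pair u v := by
  simp only [pair, Finset.mul_sum, Pi.smul_apply, smul_eq_mul]
  exact Finset.sum_congr rfl fun a _ => by rw [← mul_assoc, ← h, mul_assoc]

theorem pair_zero_right (u : C → S) : pair u 0 = 0 := by simp [pair]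

theorem pair_sum_left {ι : Type*} (s : Finset ι) (u : ι → C → S) (v : C → S) :
    pair (∑ i ∈ s, u i) v = ∑ i ∈ s, pair (u i) v :=
  map_sum (AddMonoidHom.mk' (fun u => pair u v) fun a b => pair_add_left a b v) u s

theorem pair_sum_right {ι : Type*} (s : Finset ι) (u : C → S) (v : ι → C → S) :
    pair u (∑ i ∈ s, v i) = ∑ i ∈ s, pair u (v i) :=
  map_sum (AddMonoidHom.mk' (fun v => pair u v) fun a b => pair_add_right u a b) v s

theorem pair_comm {u v : C → S} (h : ∀ a, u a * v a = v a * u a) : pair u v = pair v u :=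
  Finset.sum_congr rfl fun a _ => h a

/-- `(u × v) · w = u · (v × w)`. -/
theorem pair_bracket_assoc (hf : IsStructureConst f) (u v w : C → S) :
    pair (bracket f u v) w = pair u (bracket f v w) := by
  simp only [pair, bracket, Finset.sum_mul, Finset.mul_sum, smul_mul_assoc, mul_smul_comm,
    mul_assoc]
  rw [Finset.sum_comm]
  refine Finset.sum_congr rfl fun b _ => ?_
  rw [Finset.sum_comm]
  exact Finset.sum_congr rfl fun c _ => Finset.sum_congr rfl fun a _ => by rw [hf.rot]

theorem bracket_self (hf : IsStructureConst f) {u : C → S} (h : ∀ b c, u b * u c = u c * u b) :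
    bracket f u u = 0 := by
  have h2 : (2 : ℝ) • bracket f u u = 0 := by
    rw [two_smul]
    nth_rw 1 [bracket_anticomm hf h]
    rw [neg_add_cancel]
  exact (smul_eq_zero.1 h2).resolve_left two_ne_zero

end Pairing

namespace Calculus

open PowerSeries (coeff X)

section

variable {d : ℕ} {G E : Type*} [Ring G] [Algebra ℝ G] [Ring E] [Algebra ℝ E] {K : Calculus d G E}
  {C : Type} [Fintype C] {f : C → C → C → ℝ}

/-! ### Integration by parts -/

theorem integ_pair_Dv (μ : Fin d) {u v : C → PowerSeries G} (h : ∀ a, K.Dir (v a)) :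
    K.integ (pair u (K.Dv μ v)) = -K.integ (pair (K.Dv μ u) v) := by
  simp only [pair, map_sum, ← Finset.sum_neg_distrib]
  exact Finset.sum_congr rfl fun a _ => by
    rw [eq_neg_iff_add_eq_zero, add_comm, ← eq_neg_iff_add_eq_zero]
    exact K.integ_D_mul_right μ _ (h a)

theorem integ_pair_Dv' (μ : Fin d) {u v : C → PowerSeries G} (h : ∀ a, K.Dir (u a)) :
    K.integ (pair u (K.Dv μ v)) = -K.integ (pair (K.Dv μ u) v) := by
  simp only [pair, map_sum, ← Finset.sum_neg_distrib]
  exact Finset.sum_congr rfl fun a _ => by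
    rw [eq_neg_iff_add_eq_zero, add_comm, ← eq_neg_iff_add_eq_zero]
    exact K.integ_D_mul_left μ (h a) _

/-- Integration by parts for the covariant derivative. -/
theorem integ_pair_covD (hf : IsStructureConst f) {A : Fin d → C → PowerSeries G}
    (hA : ∀ μ a, K.HasPar 1 (A μ a)) (μ : Fin d) {u v : C → PowerSeries G}
    (h : ∀ a, K.Dir (v a)) :
    K.integ (pair u (K.covD f A μ v)) = -K.integ (pair (K.covD f A μ u) v) := by
  rw [covD_eq K hf, covD_eq K hf, pair_add_right, pair_add_left, map_add, map_add,
    integ_pair_Dv μ h, pair_mul_right X _ _ (fun a => X_comm _), pair_mul_left,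
    pair_bracket_left hf v (fun b c => (hA μ b).comm _), mul_neg, map_neg]
  abel

variable (K f) in
/-- The transpose of the Faddeev-Popov operator. -/
def fpTr (A : Fin d → C → PowerSeries G) (u : C → PowerSeries G) : C → PowerSeries G :=
  -∑ μ, K.covD f A μ (K.Dv μ u)

theorem fp_eq (A : Fin d → C → PowerSeries G) (u : C → PowerSeries G) :
    K.fp f A u = -∑ μ, K.Dv μ (K.covD f A μ u) := by
  funext a
  rw [Pi.neg_apply, Finset.sum_apply]
  rfl

/-- The transpose of `-∂D` is `-D∂`: one integration by parts uses the boundary values of `u`, the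
other those of `v`. -/
theorem integ_pair_fp (hf : IsStructureConst f) {A : Fin d → C → PowerSeries G}
    (hA : ∀ μ a, K.HasPar 1 (A μ a)) {u v : C → PowerSeries G} (hu : ∀ a, K.Dir (u a))
    (hv : ∀ a, K.Dir (v a)) :
    K.integ (pair u (K.fp f A v)) = K.integ (pair (K.fpTr f A u) v) := by
  rw [fp_eq, fpTr, pair_neg_left, pair_neg_right, pair_sum_left, pair_sum_right, map_neg, map_neg,
    map_sum, map_sum]
  congr 1
  refine Finset.sum_congr rfl fun μ _ => ?_
  rw [integ_pair_Dv' μ hu, integ_pair_covD hf hA μ hv, neg_neg]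

/-- The operators `∂_μ D_μ` and `D_μ ∂_μ` differ by `g (∂A) ×`, which vanishes for transverse `A`.
Applied to `A^h`, this is the symmetry of the kernel of `M(A^h) + κ`. -/
theorem fpTr_eq_fp (hf : IsStructureConst f) {A : Fin d → C → PowerSeries G}
    (hA : ∀ a, ∑ μ, K.D μ (A μ a) = 0) (u : C → PowerSeries G) :
    K.fpTr f A u = K.fp f A u := by
  rw [fp_eq, fpTr]
  congr 1
  have e : ∀ μ, K.Dv μ (K.covD f A μ u) = K.covD f A μ (K.Dv μ u)
      + (X : PowerSeries G) • bracket f (K.Dv μ (A μ)) u := by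
    intro μ
    rw [covD_eq K hf, covD_eq K hf, Dv_add, Dv_X_smul, Dv_bracket, smul_add]
    abel
  have h0 : ∑ μ, K.Dv μ (A μ) = 0 := by
    funext a
    rw [Finset.sum_apply]
    exact hA a
  simp only [e, Finset.sum_add_distrib, ← Finset.smul_sum, ← bracket_sum_left, h0,
    bracket_zero_left, smul_zero, add_zero]

theorem fp_add (hf : IsStructureConst f) (A : Fin d → C → PowerSeries G)
    (u v : C → PowerSeries G) : K.fp f A (u + v) = K.fp f A u + K.fp f A v := by
  simp only [fp_eq, covD_eq K hf, Dv_add, bracket_add_right, smul_add, Finset.sum_add_distrib,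
    neg_add]
  abel

theorem covD_C_smul (hf : IsStructureConst f) {A : Fin d → C → PowerSeries G}
    (hA : ∀ μ a, K.HasPar 1 (A μ a)) {θ : G} (hθ : θ ∈ K.odd) (μ : Fin d)
    (u : C → PowerSeries G) : K.covD f A μ ((PowerSeries.C θ : PowerSeries G) • u)
      = (PowerSeries.C θ : PowerSeries G) • K.covD f A μ u := by
  rw [covD_eq K hf, covD_eq K hf, bracket_C_right (hA μ), Dv_C_smul _ hθ, smul_add, smul_smul,
    smul_smul, X_comm]

theorem fp_C_smul (hf : IsStructureConst f) {A : Fin d → C → PowerSeries G}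
    (hA : ∀ μ a, K.HasPar 1 (A μ a)) {θ : G} (hθ : θ ∈ K.odd) (u : C → PowerSeries G) :
    K.fp f A ((PowerSeries.C θ : PowerSeries G) • u)
      = (PowerSeries.C θ : PowerSeries G) • K.fp f A u := by
  rw [fp_eq, fp_eq, smul_neg, Finset.smul_sum]
  simp only [covD_C_smul hf hA hθ, Dv_C_smul _ hθ]

/-! ### Variations of elementary expressions -/

theorem bracket_C_odd {θ : G} (hθ : θ ∈ K.odd) {u : C → PowerSeries G}
    (hu : ∀ a, K.HasPar (-1) (u a)) (v : C → PowerSeries G) :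
    bracket f u ((PowerSeries.C θ : PowerSeries G) • v)
      = -((PowerSeries.C θ : PowerSeries G) • bracket f u v) := by
  have h : (PowerSeries.C θ : PowerSeries G) • bracket f u v
      = bracket f ((PowerSeries.C θ : PowerSeries G) • u) v := (bracket_mul_left f _ u v).symm
  rw [h, ← bracket_neg_left]
  funext a
  refine Finset.sum_congr rfl fun b _ => Finset.sum_congr rfl fun c _ => ?_
  simp only [Pi.smul_apply, Pi.neg_apply, smul_eq_mul]
  rw [← mul_assoc, (hu b).anticomm (hasPar_C hθ)]

theorem bracket_C_C {θ : G} (hθ : θ ∈ K.odd) (u v : C → PowerSeries G) :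
    bracket f ((PowerSeries.C θ : PowerSeries G) • u) ((PowerSeries.C θ : PowerSeries G) • v)
      = 0 :=
  bracket_eq_zero_of_isMul hθ (fun _ => ⟨_, rfl⟩) fun _ => ⟨_, rfl⟩

theorem pair_C_C {θ : G} (hθ : θ ∈ K.odd) (u v : C → PowerSeries G) :
    pair ((PowerSeries.C θ : PowerSeries G) • u) ((PowerSeries.C θ : PowerSeries G) • v) = 0 :=
  Finset.sum_eq_zero fun _ _ => C_mul_mul_C_mul hθ _ _

variable {θ : G} (hθ : θ ∈ K.odd) (hf : IsStructureConst f) {A : Fin d → C → PowerSeries G}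
  (hA : ∀ μ a, K.HasPar 1 (A μ a)) {c : C → PowerSeries G} (hc : ∀ a, K.HasPar (-1) (c a))
include hθ hf hc

/-- `c × c` is BRST invariant. -/
theorem bracket_ghost_variation :
    bracket f (c + (PowerSeries.C θ : PowerSeries G) •
        ((1 / 2 : ℝ) • (X : PowerSeries G) • bracket f c c))
      (c + (PowerSeries.C θ : PowerSeries G) •
        ((1 / 2 : ℝ) • (X : PowerSeries G) • bracket f c c)) = bracket f c c := by
  have hcc := fun a b => (hc a).anticomm (hc b)
  have h0 := bracket_odd_self hf hcc
  have h1 : bracket f (bracket f c c) c = 0 := by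
    rw [bracket_anticomm hf, h0, neg_zero]
    intro a b
    refine HasPar.comm (K := K) ?_ _
    simpa using HasPar.bracket hc hc a
  rw [bracket_add_left, bracket_add_right, bracket_add_right, bracket_C_odd hθ hc,
    bracket_C_C hθ, bracket_mul_left, bracket_smul_left, bracket_smul_right, bracket_X_left,
    bracket_X_right, h0, h1]
  simp

include hA

/-- `D c` is BRST invariant. -/
theorem covD_ghost_variation (μ : Fin d) :
    K.covD f (fun μ => A μ + (PowerSeries.C θ : PowerSeries G) • -K.covD f A μ c) μ
      (c + (PowerSeries.C θ : PowerSeries G) •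
        ((1 / 2 : ℝ) • (X : PowerSeries G) • bracket f c c)) = K.covD f A μ c := by
  have hcc := fun a b => (hc a).anticomm (hc b)
  -- For odd entries the bracket is symmetric, so both Leibniz terms agree. The factor `2`
  -- compensates the `1/2` in the variation of the ghost.
  have h2 : K.Dv μ (bracket f c c) = (2 : ℝ) • bracket f (K.Dv μ c) c := by
    rw [Dv_bracket, two_smul]
    congr 1
    exact bracket_symm hf fun a b => (hc a).anticomm ((hc b).D μ)
  simp only [covD_eq K hf]
  rw [bracket_add_left, bracket_add_right, bracket_add_right, bracket_C_C hθ, add_zero,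
    bracket_C_right (hA μ), bracket_mul_left f (PowerSeries.C θ), bracket_neg_left,
    bracket_add_left, bracket_X_left, bracket_smul_right, bracket_X_right,
    bracket_odd_right hf (A μ) hcc, Dv_add, Dv_C_smul _ hθ, Dv_smul, Dv_X_smul, h2,
    smul_comm (1 / 2 : ℝ) X, smul_comm (1 / 2 : ℝ) X, smul_smul (1 / 2 : ℝ),
    smul_smul (1 / 2 : ℝ)]
  norm_num
  rw [smul_smul (X : PowerSeries G) (PowerSeries.C θ),
    smul_smul (PowerSeries.C θ) (X : PowerSeries G), X_comm]
  abel

end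

end Calculus

end GribovZwanziger

end

noncomputable section

namespace GribovZwanziger

/-- The sign `±1` of a field component. -/
def Comp.sign {d N : ℕ} : Comp d N → ℝ
  | .A _ _ | .b _ | .phi _ _ _ | .phibar _ _ _ => 1
  | .c _ | .cbar _ | .om _ _ _ | .ombar _ _ _ => -1

namespace Calculus

open PowerSeries (coeff X)

variable {d N : ℕ} {G E : Type*} [Ring G] [Algebra ℝ G] [Ring E] [Algebra ℝ E]
  (K : Calculus d G E) (f : Colour N → Colour N → Colour N → ℝ)

/-! ### Fields, transformations and actions over a calculus -/

/-- Families of field components over an algebra. -/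
abbrev FieldsOver (d N : ℕ) (G : Type*) := Comp d N → PowerSeries G

/-- Potentials over an algebra. -/
abbrev PotOver (d N : ℕ) (G : Type*) := Fin d → Colour N → PowerSeries G

/-- Field configurations over a calculus. -/
def IsConfig (Φ : FieldsOver d N G) : Prop :=
  ∀ i, K.HasPar i.sign (Φ i) ∧ (i.vanishes → K.Dir (Φ i))

/-- The potential of a configuration. -/
def pot (Φ : FieldsOver d N G) : PotOver d N G := fun μ a => Φ (.A μ a)

/-- The ghost of a configuration. -/
def ghost (Φ : FieldsOver d N G) : Colour N → PowerSeries G := fun a => Φ (.c a)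

/-- The transformation generated by an odd vector field. -/
def flow (Q : FieldsOver d N G → FieldsOver d N G) (θ : G) (Φ : FieldsOver d N G) :
    FieldsOver d N G :=
  Φ + (PowerSeries.C θ : PowerSeries G) • Q Φ

/-- The Faddeev-Popov inverse. -/
def fpInv (κ : ℝ) (A : PotOver d N G) (J : Colour N → PowerSeries G) : Colour N → PowerSeries G :=
  Classical.epsilon (K.IsFPSolution f κ A J)

/-- The field strength. -/
def fieldStrength (A : PotOver d N G) (μ ν : Fin d) : Colour N → PowerSeries G :=
  fun a => K.D μ (A ν a) - K.D ν (A μ a) + X * bracket f (A μ) (A ν) a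

/-- The source of the horizon function. -/
def source (A : PotOver d N G) (μ : Fin d) (c : Colour N) : Colour N → PowerSeries G :=
  fun a => ∑ e, f a e c • A μ e

/-- The horizon function. -/
def horizon (A : PotOver d N G) : PowerSeries E :=
  K.integ (∑ μ, ∑ c, ∑ a, X ^ 2 * (source f A μ c a * K.fpInv f 0 A (source f A μ c) a))

/-- The BRST vector field. -/
def brst (Φ : FieldsOver d N G) : FieldsOver d N G
  | .A μ a => -K.covD f (pot Φ) μ (ghost Φ) a
  | .c a => (1 / 2 : ℝ) • (X * bracket f (ghost Φ) (ghost Φ) a)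
  | .cbar a => Φ (.b a)
  | .b _ => 0
  | .phi μ a b => Φ (.om μ a b)
  | .phibar _ _ _ => 0
  | .om _ _ _ => 0
  | .ombar μ a b => Φ (.phibar μ a b)

/-- The shift of `ω̄`. -/
def omShift (g2 κ : ℝ) (A : PotOver d N G) (μ : Fin d) (a b : Colour N) : PowerSeries G :=
  -(g2 • (X * K.fpInv f κ (K.dressed f A) (fun e => ∑ c, f c e b • K.dressed f A μ c) a))

/-- The non-perturbative BRST vector field. -/
def sGamma (g2 κ : ℝ) (Φ : FieldsOver d N G) : FieldsOver d N G
  | .A μ a => -K.covD f (pot Φ) μ (ghost Φ) a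
  | .c a => (1 / 2 : ℝ) • (X * bracket f (ghost Φ) (ghost Φ) a)
  | .cbar a => Φ (.b a)
  | .b _ => 0
  | .phi μ a b => Φ (.om μ a b)
  | .phibar _ _ _ => 0
  | .om _ _ _ => 0
  | .ombar μ a b => Φ (.phibar μ a b) + K.omShift f g2 κ (pot Φ) μ a b

/-- The change of variables from `b` to `b^h`. -/
def toBh (g2 : ℝ) (R : PotOver d N G → Colour N → PowerSeries G) (Φ : FieldsOver d N G) :
    FieldsOver d N G
  | .b a => Φ (.b a) - g2 ^ 2 • R (pot Φ) a
  | i => Φ i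

/-- The BRST vector field in the variables with `b^h`. -/
def sBh (g2 : ℝ) (R : PotOver d N G → Colour N → PowerSeries G)
    (sR : FieldsOver d N G → Colour N → PowerSeries G) (Φ : FieldsOver d N G) : FieldsOver d N G
  | .A μ a => -K.covD f (pot Φ) μ (ghost Φ) a
  | .c a => (1 / 2 : ℝ) • (X * bracket f (ghost Φ) (ghost Φ) a)
  | .cbar a => Φ (.b a) + g2 ^ 2 • R (pot Φ) a
  | .b a => -(g2 ^ 2 • sR Φ a)
  | .phi μ a b => Φ (.om μ a b)
  | .phibar _ _ _ => 0
  | .om _ _ _ => 0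
  | .ombar μ a b => Φ (.phibar μ a b)

/-- The deformation of the BRST vector field. -/
def deltaGamma (g2 κ : ℝ) (R : PotOver d N G → Colour N → PowerSeries G)
    (sR : FieldsOver d N G → Colour N → PowerSeries G) (Φ : FieldsOver d N G) : FieldsOver d N G
  | .A _ _ => 0
  | .c _ => 0
  | .cbar a => -(g2 ^ 2 • R (pot Φ) a)
  | .b a => g2 ^ 2 • sR Φ a
  | .phi _ _ _ => 0
  | .phibar _ _ _ => 0
  | .om _ _ _ => 0
  | .ombar μ a b => K.omShift f g2 κ (pot Φ) μ a b

/-- The Yang-Mills action. -/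
def actionYM (Φ : FieldsOver d N G) : PowerSeries E :=
  K.integ ((1 / 4 : ℝ) • ∑ μ, ∑ ν, ∑ a,
    K.fieldStrength f (pot Φ) μ ν a * K.fieldStrength f (pot Φ) μ ν a)

/-- The gauge fixing action. -/
def actionLandau (Φ : FieldsOver d N G) : PowerSeries E :=
  K.integ (∑ a, (Φ (.b a) * ∑ μ, K.D μ (Φ (.A μ a))
    + Φ (.cbar a) * ∑ μ, K.D μ (K.covD f (pot Φ) μ (ghost Φ) a)))

/-- The gauge parameter term. -/
def actionAlpha (α : ℝ) (Φ : FieldsOver d N G) : PowerSeries E :=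
  K.integ (-((α / 2) • ∑ a, Φ (.b a) * Φ (.b a)))

/-- The ghost interaction. -/
def actionGhostInt (α : ℝ) (Φ : FieldsOver d N G) : PowerSeries E :=
  K.integ ((α / 2) • (X * ∑ a, ∑ b, ∑ c, f a b c • (Φ (.b a) * Φ (.cbar b) * Φ (.c c)))
    + (α / 8) • (X ^ 2 * ∑ a, ∑ b, ∑ c, ∑ e, ∑ e', (f a b c * f c e e') •
      (Φ (.cbar a) * Φ (.cbar b) * Φ (.c e) * Φ (.c e'))))

/-- The localizing action. -/
def actionLoc (g2 : ℝ) (Φ : FieldsOver d N G) : PowerSeries E :=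
  K.integ (-(∑ μ, ∑ c, ∑ a,
      (Φ (.phibar μ a c) * K.fp f (K.dressed f (pot Φ)) (fun b => Φ (.phi μ b c)) a
        - Φ (.ombar μ a c) * K.fp f (K.dressed f (pot Φ)) (fun b => Φ (.om μ b c)) a))
    + g2 • (X * ∑ μ, ∑ a, ∑ b, ∑ c, f a b c •
        (K.dressed f (pot Φ) μ a * (Φ (.phi μ b c) + Φ (.phibar μ b c)))))

/-- The refinement. -/
def actionRef (m2 κ : ℝ) (Φ : FieldsOver d N G) : PowerSeries E :=
  K.integ ((m2 / 2) • (∑ μ, ∑ a, K.dressed f (pot Φ) μ a * K.dressed f (pot Φ) μ a)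
    - κ • ∑ μ, ∑ a, ∑ b, (Φ (.phibar μ a b) * Φ (.phi μ a b)
        - Φ (.ombar μ a b) * Φ (.om μ a b)))

end Calculus

end GribovZwanziger

end

noncomputable section

namespace GribovZwanziger

namespace Calculus

open PowerSeries (coeff X)

section

variable {d N : ℕ} {G E : Type*} [Ring G] [Algebra ℝ G] [Ring E] [Algebra ℝ E]
  {K : Calculus d G E} {f : Colour N → Colour N → Colour N → ℝ}

/-! ### Invariance of the actions -/

theorem pair_eq_zero_of_isMul {θ : G} (hθ : θ ∈ K.odd) {u v : Colour N → PowerSeries G}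
    (hu : ∀ a, IsMul θ (u a)) (hv : ∀ a, IsMul θ (v a)) : pair u v = 0 := by
  refine Finset.sum_eq_zero fun a _ => ?_
  obtain ⟨x, hx⟩ := hu a
  obtain ⟨y, hy⟩ := hv a
  rw [hx, hy, C_mul_mul_C_mul hθ]

theorem fieldStrength_eq (A : PotOver d N G) (μ ν : Fin d) :
    K.fieldStrength f A μ ν = K.Dv μ (A ν) - K.Dv ν (A μ)
      + (X : PowerSeries G) • bracket f (A μ) (A ν) := rfl

/-- The field strength transforms covariantly. -/
theorem fieldStrength_variation (hf : IsStructureConst f) {θ : G} (hθ : θ ∈ K.odd)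
    {A : PotOver d N G} (hA : ∀ μ a, K.HasPar 1 (A μ a)) {η : Colour N → PowerSeries G}
    (hη' : ∀ a, IsMul θ (η a)) (μ ν : Fin d) :
    K.fieldStrength f (fun μ => A μ - K.covD f A μ η) μ ν
      = K.fieldStrength f A μ ν - (X : PowerSeries G) • bracket f (K.fieldStrength f A μ ν) η := by
  have hD : ∀ μ a, IsMul θ (K.covD f A μ η a) := by
    intro μ a
    rw [covD_eq K hf]
    obtain ⟨y, hy⟩ := IsMul.bracket (hA μ) hη' a
    refine (IsMul.D hθ (hη' a) μ).add ⟨X * y, ?_⟩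
    rw [Pi.smul_apply, hy, smul_eq_mul, ← mul_assoc, X_comm, mul_assoc]
  have h0 := bracket_eq_zero_of_isMul (f := f) hθ (hD μ) (hD ν)
  have hj := bracket_jacobi hf η (fun b c => (hA μ b).comm (A ν c))
  have e1 : bracket f (K.Dv μ η) (A ν) = -bracket f (A ν) (K.Dv μ η) :=
    bracket_anticomm hf fun b c => ((hA ν c).comm _).symm
  have e2 : bracket f (bracket f (A μ) η) (A ν) = -bracket f (A ν) (bracket f (A μ) η) :=
    bracket_anticomm hf fun b c => ((hA ν c).comm _).symm
  simp only [fieldStrength_eq]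
  rw [bracket_sub_left, bracket_sub_right, bracket_sub_right, h0, sub_zero]
  simp only [covD_eq K hf, Dv_sub, Dv_add, Dv_X_smul, Dv_bracket, bracket_add_left,
    bracket_add_right, bracket_sub_left, bracket_X_left, bracket_X_right, e1, e2, hj,
    K.Dv_comm ν μ, smul_add, smul_sub, smul_neg]
  abel

/-- The linear term is `F · (F × η) = (F × F) · η = 0`, as `F` is even; the quadratic term contains
`θ` twice. -/
theorem pair_fieldStrength_variation (hf : IsStructureConst f) {θ : G} (hθ : θ ∈ K.odd)
    {F η : Colour N → PowerSeries G} (hF : ∀ a, K.HasPar 1 (F a))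
    (hη' : ∀ a, IsMul θ (η a)) :
    pair (F - (X : PowerSeries G) • bracket f F η) (F - (X : PowerSeries G) • bracket f F η)
      = pair F F := by
  have h0 := pair_eq_zero_of_isMul hθ (IsMul.bracket (f := f) hF hη')
    (IsMul.bracket (f := f) hF hη')
  have h1 : pair F (bracket f F η) = 0 := by
    rw [← pair_bracket_assoc hf, bracket_self hf fun b c => (hF b).comm _]
    simp [pair]
  have h2 : pair (bracket f F η) F = 0 := by
    rw [pair_comm fun a => ((hF a).comm _).symm, h1]
  have hX : ∀ (u : Colour N → PowerSeries G) a, X * u a = u a * X := fun u a => X_comm _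
  rw [pair_sub_left, pair_sub_right, pair_sub_right, pair_mul_right _ _ _ (hX _), pair_mul_left,
    pair_mul_left, pair_mul_right _ _ _ (hX _), h0, h1, h2]
  simp

theorem hasPar_fieldStrength {A : PotOver d N G} (hA : ∀ μ a, K.HasPar 1 (A μ a)) (μ ν : Fin d)
    (a : Colour N) : K.HasPar 1 (K.fieldStrength f A μ ν a) :=
  (((hA ν a).D μ).sub ((hA μ a).D ν)).add (HasPar.X_mul (HasPar.even_bracket (hA μ) (hA ν) a))

theorem IsConfig.pot {Φ : FieldsOver d N G} (h : K.IsConfig Φ) (μ : Fin d) (a : Colour N) :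
    K.HasPar 1 (Calculus.pot Φ μ a) := (h (.A μ a)).1

theorem IsConfig.ghost {Φ : FieldsOver d N G} (h : K.IsConfig Φ) (a : Colour N) :
    K.HasPar (-1) (Calculus.ghost Φ a) := (h (.c a)).1

theorem IsConfig.ghost_dir {Φ : FieldsOver d N G} (h : K.IsConfig Φ) (a : Colour N) :
    K.Dir (Calculus.ghost Φ a) := (h (.c a)).2 trivial

variable {Φ : FieldsOver d N G} (hΦ : K.IsConfig Φ) {θ : G} (hθ : θ ∈ K.odd)
  (hf : IsStructureConst f)

/-- The transformation law of potential and ghost. -/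
structure IsGaugeBRST (K : Calculus d G E) (f : Colour N → Colour N → Colour N → ℝ)
    (Q : FieldsOver d N G → FieldsOver d N G) : Prop where
  A : ∀ Φ μ a, Q Φ (.A μ a) = -K.covD f (Calculus.pot Φ) μ (Calculus.ghost Φ) a
  c : ∀ Φ a, Q Φ (.c a)
    = (1 / 2 : ℝ) • (X * bracket f (Calculus.ghost Φ) (Calculus.ghost Φ) a)

theorem isGaugeBRST_sGamma (g2 κ : ℝ) : IsGaugeBRST K f (K.sGamma f g2 κ) :=
  ⟨fun _ _ _ => rfl, fun _ _ => rfl⟩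

theorem isGaugeBRST_brst : IsGaugeBRST K f (K.brst f) :=
  ⟨fun _ _ _ => rfl, fun _ _ => rfl⟩

variable {Q : FieldsOver d N G → FieldsOver d N G} (hQ : IsGaugeBRST K f Q)

include hQ in
theorem pot_flow (Φ : FieldsOver d N G) (θ : G) : pot (flow Q θ Φ)
    = fun μ => pot Φ μ + (PowerSeries.C θ : PowerSeries G) • -K.covD f (pot Φ) μ (ghost Φ) := by
  funext μ a
  exact congrArg (fun x => Φ (.A μ a) + PowerSeries.C θ * x) (hQ.A Φ μ a)

include hQ in
theorem ghost_flow (Φ : FieldsOver d N G) (θ : G) : ghost (flow Q θ Φ)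
    = ghost Φ + (PowerSeries.C θ : PowerSeries G) • ((1 / 2 : ℝ) • (X : PowerSeries G) •
      bracket f (ghost Φ) (ghost Φ)) := by
  funext a
  exact congrArg (fun x => Φ (.c a) + PowerSeries.C θ * x) (hQ.c Φ a)

include hΦ hθ hf hQ

theorem pot_flow' : pot (flow Q θ Φ) = fun μ => pot Φ μ
    - K.covD f (pot Φ) μ ((PowerSeries.C θ : PowerSeries G) • ghost Φ) := by
  rw [pot_flow hQ]
  funext μ
  rw [covD_C_smul hf hΦ.pot hθ, smul_neg, sub_eq_add_neg]

theorem actionYM_invariant : K.actionYM f (flow Q θ Φ) = K.actionYM f Φ := by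
  have e : ∀ Ψ : FieldsOver d N G, K.actionYM f Ψ = K.integ ((1 / 4 : ℝ) • ∑ μ, ∑ ν,
    pair (K.fieldStrength f (pot Ψ) μ ν) (K.fieldStrength f (pot Ψ) μ ν)) := fun _ => rfl
  rw [e, e, pot_flow' hΦ hθ hf hQ]
  congr 2
  refine Finset.sum_congr rfl fun μ _ => Finset.sum_congr rfl fun ν _ => ?_
  have hη : ∀ a, IsMul θ (((PowerSeries.C θ : PowerSeries G) • ghost Φ) a) := fun a => ⟨_, rfl⟩
  rw [fieldStrength_variation hf hθ hΦ.pot hη,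
    pair_fieldStrength_variation hf hθ (hasPar_fieldStrength hΦ.pot μ ν) hη]

/-- `D c` and `b` are invariant. What remains is `-θ b ∂Dc` from the variation of `A` and `+θ b ∂Dc`
from that of `c̄`. -/
theorem actionLandau_invariant (hc : ∀ a, Q Φ (.cbar a) = Φ (.b a)) (hb : ∀ a, Q Φ (.b a) = 0) :
    K.actionLandau f (flow Q θ Φ) = K.actionLandau f Φ := by
  unfold actionLandau
  congr 1
  refine Finset.sum_congr rfl fun a _ => ?_
  have h1 : ∀ μ, K.covD f (pot (flow Q θ Φ)) μ (ghost (flow Q θ Φ))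
      = K.covD f (pot Φ) μ (ghost Φ) := by
    intro μ
    rw [pot_flow hQ, ghost_flow hQ]
    exact covD_ghost_variation hθ hf hΦ.pot hΦ.ghost μ
  have h2 : ∀ μ, flow Q θ Φ (.A μ a) = Φ (.A μ a)
      - PowerSeries.C θ * K.covD f (pot Φ) μ (ghost Φ) a := by
    intro μ
    rw [sub_eq_add_neg, ← mul_neg]
    exact congrFun (congrFun (pot_flow hQ Φ θ) μ) a
  have h3 : flow Q θ Φ (.b a) = Φ (.b a) := by
    change Φ (.b a) + PowerSeries.C θ * Q Φ (.b a) = _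
    rw [hb, mul_zero, add_zero]
  have h4 : flow Q θ Φ (.cbar a) = Φ (.cbar a) + PowerSeries.C θ * Φ (.b a) := by
    change Φ (.cbar a) + PowerSeries.C θ * Q Φ (.cbar a) = _
    rw [hc]
  have h5 : K.HasPar 1 (Φ (.b a)) := (hΦ (.b a)).1
  simp only [h1, h2, h3, h4, map_sub, D_C_mul hθ, Finset.sum_sub_distrib, ← Finset.mul_sum,
    mul_sub, add_mul]
  rw [← mul_assoc (Φ (.b a)), h5.comm (PowerSeries.C θ)]
  abel

omit hΦ hf hθ hQ in
theorem actionAlpha_invariant (α : ℝ) (hb : ∀ a, Q Φ (.b a) = 0) :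
    K.actionAlpha α (flow Q θ Φ) = K.actionAlpha α Φ := by
  have h3 : ∀ a, flow Q θ Φ (.b a) = Φ (.b a) := by
    intro a
    change Φ (.b a) + PowerSeries.C θ * Q Φ (.b a) = _
    rw [hb, mul_zero, add_zero]
  simp only [actionAlpha, h3]

/-! ### The ghost interaction -/

omit hΦ hθ hf hQ in
theorem sum_eq_pair_bracket (u v w : Colour N → PowerSeries G) :
    ∑ a, ∑ b, ∑ c, f a b c • (u a * v b * w c) = pair u (bracket f v w) := by
  simp only [pair, bracket, Finset.mul_sum, mul_smul_comm, mul_assoc]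

omit hΦ hθ hf hQ in
theorem sum_eq_pair_bracket_bracket (u v w z : Colour N → PowerSeries G) :
    ∑ a, ∑ b, ∑ c, ∑ e, ∑ e', (f a b c * f c e e') • (u a * v b * w e * z e')
      = pair u (bracket f v (bracket f w z)) := by
  simp only [pair, bracket, Finset.mul_sum, mul_smul_comm, mul_assoc, Finset.smul_sum, smul_smul]

omit hΦ hθ hf hQ in
theorem pair_C_right {θ : G} {u : Colour N → PowerSeries G} (hu : ∀ a, K.HasPar 1 (u a))
    (v : Colour N → PowerSeries G) :
    pair u ((PowerSeries.C θ : PowerSeries G) • v) = PowerSeries.C θ * pair u v :=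
  pair_mul_right _ u v fun a => ((hu a).comm _).symm

omit hΦ hf hQ in
theorem pair_C_right_odd {u : Colour N → PowerSeries G} (hu : ∀ a, K.HasPar (-1) (u a))
    (v : Colour N → PowerSeries G) :
    pair u ((PowerSeries.C θ : PowerSeries G) • v) = -(PowerSeries.C θ * pair u v) := by
  simp only [pair, Finset.mul_sum, Pi.smul_apply, smul_eq_mul, ← Finset.sum_neg_distrib]
  refine Finset.sum_congr rfl fun a _ => ?_
  rw [← mul_assoc, (hu a).anticomm (hasPar_C hθ), neg_mul, mul_assoc]

omit hΦ hθ hf hQ in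
theorem actionGhostInt_eq (α : ℝ) (Ψ : FieldsOver d N G) :
    K.actionGhostInt f α Ψ = K.integ ((α / 2) • (X *
      pair (fun a => Ψ (.b a)) (bracket f (fun a => Ψ (.cbar a)) (ghost Ψ)))
      + (α / 8) • (X ^ 2 * pair (fun a => Ψ (.cbar a)) (bracket f (fun a => Ψ (.cbar a))
        (bracket f (ghost Ψ) (ghost Ψ))))) := by
  rw [← sum_eq_pair_bracket, ← sum_eq_pair_bracket_bracket]
  rfl

section

variable {b cb c : Colour N → PowerSeries G} (hpb : ∀ a, K.HasPar 1 (b a))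
  (hpcb : ∀ a, K.HasPar (-1) (cb a))
include hpb hpcb

omit hΦ hQ in
-- The variation of `c̄` contributes `b · (b × c) = 0`, so only the variation of the ghost is left;
-- its sign comes from moving `θ` past the odd `c̄`.
theorem pair_bracket_variation : pair b (bracket f (cb + (PowerSeries.C θ : PowerSeries G) • b)
      (c + (PowerSeries.C θ : PowerSeries G) • ((1 / 2 : ℝ) • (X : PowerSeries G) •
        bracket f c c))) = pair b (bracket f cb c)
      - (1 / 2 : ℝ) • (X * (PowerSeries.C θ * pair b (bracket f cb (bracket f c c)))) := by
  have hbc : pair b (bracket f b c) = 0 := by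
    rw [← pair_bracket_assoc hf, bracket_self hf fun i j => (hpb i).comm _]
    simp [pair]
  rw [bracket_add_left, bracket_add_right, bracket_add_right, bracket_C_C hθ,
    bracket_C_odd hθ hpcb, bracket_mul_left, bracket_smul_right, bracket_X_right, pair_add_right,
    pair_add_right, pair_add_right, pair_zero_right, pair_neg_right, pair_C_right hpb,
    pair_C_right hpb, hbc, pair_smul_right, pair_mul_right _ _ _ fun a => X_comm (b a),
    mul_smul_comm, ← mul_assoc, ← mul_assoc, X_comm, mul_zero, add_zero, add_zero,
    ← sub_eq_add_neg]

omit hΦ hQ in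
-- The two factors `c̄` contribute equally: `c̄ · (b × w) = -b · (c̄ × w)`, and the sign is
-- compensated by moving `θ` past `c̄`. In the application `w = c × c`, which is invariant.
theorem pair_bracket_bracket_variation (w : Colour N → PowerSeries G) :
    pair (cb + (PowerSeries.C θ : PowerSeries G) • b)
      (bracket f (cb + (PowerSeries.C θ : PowerSeries G) • b) w)
      = pair cb (bracket f cb w) + (2 : ℝ) • (PowerSeries.C θ * pair b (bracket f cb w)) := by
  have hcbb : pair cb (bracket f b w) = -pair b (bracket f cb w) := by
    rw [← pair_bracket_assoc hf, bracket_anticomm hf fun i j => ((hpb j).comm _).symm,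
      pair_neg_left, pair_bracket_assoc hf]
  rw [bracket_add_left, bracket_mul_left, pair_add_left, pair_add_right, pair_add_right,
    pair_C_C hθ, pair_C_right_odd hθ hpcb, hcbb, pair_mul_left, two_smul, mul_neg, neg_neg,
    add_zero, add_assoc]

end

theorem actionGhostInt_invariant (α : ℝ) (hc : ∀ a, Q Φ (.cbar a) = Φ (.b a))
    (hb : ∀ a, Q Φ (.b a) = 0) :
    K.actionGhostInt f α (flow Q θ Φ) = K.actionGhostInt f α Φ := by
  have h3 : (fun a => flow Q θ Φ (.b a)) = fun a => Φ (.b a) := by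
    funext a
    change Φ (.b a) + PowerSeries.C θ * Q Φ (.b a) = _
    rw [hb, mul_zero, add_zero]
  have h4 : (fun a => flow Q θ Φ (.cbar a))
      = (fun a => Φ (.cbar a)) + (PowerSeries.C θ : PowerSeries G) • fun a => Φ (.b a) := by
    funext a
    change Φ (.cbar a) + PowerSeries.C θ * Q Φ (.cbar a) = _
    rw [hc]
    rfl
  rw [actionGhostInt_eq, actionGhostInt_eq, h3, h4, ghost_flow hQ,
    bracket_ghost_variation hθ hf hΦ.ghost,
    pair_bracket_variation hθ hf (fun a => (hΦ (.b a)).1) (fun a => (hΦ (.cbar a)).1),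
    pair_bracket_bracket_variation hθ hf (fun a => (hΦ (.b a)).1) (fun a => (hΦ (.cbar a)).1)]
  congr 1
  generalize pair (fun a => Φ (.b a)) (bracket f (fun a => Φ (.cbar a)) (ghost Φ)) = p1
  generalize pair (fun a => Φ (.cbar a)) _ = p2
  generalize pair (fun a => Φ (.b a)) _ = q
  -- The quartic term varies into `2 · α/8` and the cubic one into `-(1/2) · α/2` of the same
  -- expression `g² θ b · (c̄ × (c × c))`; this balance fixes the coefficient `α/8`.
  rw [mul_sub, mul_add, mul_smul_comm, mul_smul_comm, smul_sub, smul_add, smul_smul,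
    smul_smul, ← mul_assoc X X, ← pow_two, show α / 2 * (1 / 2) = α / 8 * 2 by ring]
  abel

/-! ### The localizing action -/

omit hΦ hθ hf hQ in
-- The mass terms are absorbed into the operator `M(A^h) + κ`, and the action splits into
-- independent pieces labelled by `μ` and the second colour index. The unrefined and refined cases
-- become one computation.
theorem actionLoc_add_actionRef_eq (g2 m2 κ : ℝ) (Ψ : FieldsOver d N G) :
    K.actionLoc f g2 Ψ + K.actionRef f m2 κ Ψ = K.integ ((m2 / 2) •
        ∑ μ, pair (K.dressed f (pot Ψ) μ) (K.dressed f (pot Ψ) μ))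
      + K.integ (∑ μ, ∑ c, (
        -(pair (fun a => Ψ (.phibar μ a c)) (K.fp f (K.dressed f (pot Ψ)) (fun a => Ψ (.phi μ a c))
          + κ • fun a => Ψ (.phi μ a c)))
        + pair (fun a => Ψ (.ombar μ a c)) (K.fp f (K.dressed f (pot Ψ)) (fun a => Ψ (.om μ a c))
          + κ • fun a => Ψ (.om μ a c))
        + g2 • (X * pair (fun e => ∑ a, f a e c • K.dressed f (pot Ψ) μ a)
            (fun a => Ψ (.phi μ a c) + Ψ (.phibar μ a c))))) := by
  have e1 : ∑ μ, ∑ a, ∑ b, ∑ c, f a b c • (K.dressed f (pot Ψ) μ a *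
        (Ψ (.phi μ b c) + Ψ (.phibar μ b c)))
      = ∑ μ, ∑ c, pair (fun e => ∑ a, f a e c • K.dressed f (pot Ψ) μ a)
            (fun a => Ψ (.phi μ a c) + Ψ (.phibar μ a c)) := by
    refine Finset.sum_congr rfl fun μ _ => ?_
    simp only [pair, Finset.sum_mul, smul_mul_assoc]
    rw [Finset.sum_comm' (s' := fun _ => Finset.univ) (t' := Finset.univ) (by simp)]
    conv_rhs => rw [Finset.sum_comm]
    refine Finset.sum_congr rfl fun b _ => ?_
    rw [Finset.sum_comm]
  have e2 : ∑ μ, ∑ a, ∑ b, (Ψ (.phibar μ a b) * Ψ (.phi μ a b) - Ψ (.ombar μ a b) * Ψ (.om μ a b))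
      = ∑ μ, ∑ c, (pair (fun a => Ψ (.phibar μ a c)) (fun a => Ψ (.phi μ a c))
        - pair (fun a => Ψ (.ombar μ a c)) (fun a => Ψ (.om μ a c))) := by
    refine Finset.sum_congr rfl fun μ _ => ?_
    rw [Finset.sum_comm]
    simp only [pair, Finset.sum_sub_distrib]
  rw [actionLoc, actionRef, e1, e2, ← map_add, ← map_add]
  congr 1
  simp only [pair_add_right, pair_smul_right, Finset.sum_add_distrib, Finset.sum_sub_distrib,
    Finset.sum_neg_distrib, ← Finset.smul_sum, ← Finset.mul_sum, smul_sub]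
  simp only [pair]
  abel

end

end Calculus

end GribovZwanziger

end

/-! ### The shift of `ω̄` and the invariance of the localizing action -/

noncomputable section

namespace GribovZwanziger

namespace Calculus

open PowerSeries (coeff X)

section

variable {d N : ℕ} {G E : Type*} [Ring G] [Algebra ℝ G] [Ring E] [Algebra ℝ E]
  {K : Calculus d G E} {f : Colour N → Colour N → Colour N → ℝ} {L₀ L : G →ₗ[ℝ] G} {κ : ℝ}

theorem IsGreen.isFPSolution_fpInv (hL : K.IsGreen κ L) (hf : IsStructureConst f)
    (A : PotOver d N G) (J : Colour N → PowerSeries G) :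
    K.IsFPSolution f κ A J (K.fpInv f κ A J) :=
  Classical.epsilon_spec (hL.existsUnique_fp hf A J).exists

theorem IsGreen.hasPar_fpInv (hL : K.IsGreen κ L) (hf : IsStructureConst f)
    {A : PotOver d N G} (hA : ∀ μ a, K.HasPar 1 (A μ a)) {ε : ℝ} {J : Colour N → PowerSeries G}
    (hJ : ∀ a, K.HasPar ε (J a)) (a : Colour N) : K.HasPar ε (K.fpInv f κ A J a) :=
  hL.hasPar_fp hf hA hJ (hL.isFPSolution_fpInv hf A J) a

/-- The colour source in the shift of `ω̄`. -/
theorem hasPar_shiftSource {A : PotOver d N G} (hA : ∀ μ a, K.HasPar 1 (A μ a)) (μ : Fin d)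
    (b e : Colour N) : K.HasPar 1 (∑ c, f c e b • A μ c) :=
  HasPar.sum fun c _ => (hA μ c).smul _

theorem hasPar_omShift (h0 : K.IsGreen 0 L₀) (hL : K.IsGreen κ L) (hf : IsStructureConst f)
    (g2 : ℝ) {A : PotOver d N G} (hA : ∀ μ a, K.HasPar 1 (A μ a)) (μ : Fin d) (a b : Colour N) :
    K.HasPar 1 (K.omShift f g2 κ A μ a b) :=
  (((hL.hasPar_fpInv hf (h0.hasPar_dressed hA) (hasPar_shiftSource (h0.hasPar_dressed hA) μ b)
    a).X_mul).smul g2).neg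

theorem dir_omShift (hL : K.IsGreen κ L) (hf : IsStructureConst f)
    (g2 : ℝ) (A : PotOver d N G) (μ : Fin d) (a b : Colour N) :
    K.Dir (K.omShift f g2 κ A μ a b) :=
  ((((hL.isFPSolution_fpInv hf _ _).1 a).mul_left X).smul g2).neg

theorem integ_X_mul (u : PowerSeries G) : K.integ (X * u) = X * K.integ u :=
  lift_X_mul _ _

/-- The defining property of the shift of `ω̄`. -/
theorem integ_pair_omShift (h0 : K.IsGreen 0 L₀) (hL : K.IsGreen κ L) (hf : IsStructureConst f)
    (g2 : ℝ) {A : PotOver d N G} (hA : ∀ μ a, K.HasPar 1 (A μ a)) (μ : Fin d) (b : Colour N)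
    {η : Colour N → PowerSeries G} (hη : ∀ a, K.Dir (η a)) :
    K.integ (pair (fun a => K.omShift f g2 κ A μ a b)
        (K.fp f (K.dressed f A) η + κ • η))
      = -K.integ (g2 • (X * pair (fun e => ∑ c, f c e b • K.dressed f A μ c) η)) := by
  set v := K.fpInv f κ (K.dressed f A) fun e => ∑ c, f c e b • K.dressed f A μ c with hv
  have hs := hL.isFPSolution_fpInv hf (K.dressed f A) fun e => ∑ c, f c e b • K.dressed f A μ c
  rw [← hv] at hs
  have e : (fun a => K.omShift f g2 κ A μ a b) = -(g2 • (X : PowerSeries G) • v) := rfl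
  have hs' : K.fp f (K.dressed f A) v + κ • v = fun e => ∑ c, f c e b • K.dressed f A μ c :=
    funext hs.2
  -- The source is rewritten as `(M(A^h) + κ) v`, so that both sides pair `v` with `η` through the
  -- operator. Moving it across is legitimate because `A^h` is transverse and both `v` and `η`
  -- vanish on the boundary.
  rw [e, ← hs', pair_neg_left, map_neg, pair_smul_left, pair_mul_left, pair_add_right,
    pair_smul_right, pair_add_left, pair_smul_left, map_smul, map_smul, integ_X_mul, integ_X_mul,
    map_add, map_add, integ_pair_fp hf (h0.hasPar_dressed hA) hs.1 hη,
    fpTr_eq_fp hf (h0.dressed_transverse hA)]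

/-- The localizing action and the refinement are invariant together. -/
theorem actionLoc_add_actionRef_invariant (h0 : K.IsGreen 0 L₀) (hL : K.IsGreen κ L)
    (hf : IsStructureConst f) (g2 m2 : ℝ) {Φ : FieldsOver d N G} (hΦ : K.IsConfig Φ) {θ : G}
    (hθ : θ ∈ K.odd) :
    K.actionLoc f g2 (flow (K.sGamma f g2 κ) θ Φ) + K.actionRef f m2 κ (flow (K.sGamma f g2 κ) θ Φ)
      = K.actionLoc f g2 Φ + K.actionRef f m2 κ Φ := by
  have hA : K.dressed f (pot (flow (K.sGamma f g2 κ) θ Φ)) = K.dressed f (pot Φ) := by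
    rw [pot_flow (isGaugeBRST_sGamma g2 κ)]
    exact h0.dressed_invariant hf hθ hΦ.pot hΦ.ghost hΦ.ghost_dir
  rw [actionLoc_add_actionRef_eq, actionLoc_add_actionRef_eq, hA]
  congr 1
  simp only [map_sum]
  refine Finset.sum_congr rfl fun μ _ => Finset.sum_congr rfl fun c _ => ?_
  set B := K.dressed f (pot Φ) with hB
  have hpB : ∀ μ a, K.HasPar 1 (B μ a) := h0.hasPar_dressed hΦ.pot
  set J : Colour N → PowerSeries G := fun e => ∑ a, f a e c • B μ a with hJ
  set w : Colour N → PowerSeries G := fun a => Φ (.om μ a c) with hw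
  set φ : Colour N → PowerSeries G := fun a => Φ (.phi μ a c) with hφ
  set φb : Colour N → PowerSeries G := fun a => Φ (.phibar μ a c) with hφb
  set wb : Colour N → PowerSeries G := fun a => Φ (.ombar μ a c) with hwb
  set sh : Colour N → PowerSeries G := fun a => K.omShift f g2 κ (pot Φ) μ a c with hsh
  set η : Colour N → PowerSeries G := (PowerSeries.C θ : PowerSeries G) • w with hη
  have e1 : (fun a => flow (K.sGamma f g2 κ) θ Φ (.phi μ a c)) = φ + η := rfl
  have e2 : (fun a => flow (K.sGamma f g2 κ) θ Φ (.phibar μ a c)) = φb := by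
    funext a
    change Φ (.phibar μ a c) + PowerSeries.C θ * 0 = _
    rw [mul_zero, add_zero]
  have e3 : (fun a => flow (K.sGamma f g2 κ) θ Φ (.om μ a c)) = w := by
    funext a
    change Φ (.om μ a c) + PowerSeries.C θ * 0 = _
    rw [mul_zero, add_zero]
  have e4 : (fun a => flow (K.sGamma f g2 κ) θ Φ (.ombar μ a c))
      = wb + (PowerSeries.C θ : PowerSeries G) • (φb + sh) := rfl
  have e5 : (fun a => flow (K.sGamma f g2 κ) θ Φ (.phi μ a c)
      + flow (K.sGamma f g2 κ) θ Φ (.phibar μ a c)) = (φ + φb) + η := by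
    rw [add_right_comm, ← e1, ← e2]
    rfl
  have e6 : (fun a => Φ (.phi μ a c) + Φ (.phibar μ a c)) = φ + φb := rfl
  have hηd : ∀ a, K.Dir (η a) := fun a => ((hΦ (.om μ a c)).2 trivial).mul_left _
  have key := integ_pair_omShift h0 hL hf g2 hΦ.pot μ c hηd
  rw [← hB, ← hJ, ← hsh] at key
  have hP : K.fp f B η + κ • η = (PowerSeries.C θ : PowerSeries G) • (K.fp f B w + κ • w) := by
    rw [hη, fp_C_smul hf hpB hθ, smul_add, smul_comm κ]
  have hφp : ∀ a, K.HasPar 1 (φb a) := fun a => (hΦ (.phibar μ a c)).1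
  have hshp : ∀ a, K.HasPar 1 (sh a) := fun a => hasPar_omShift h0 hL hf g2 hΦ.pot μ a c
  -- The shift and the variation of the horizon source cancel, but only after integration.
  have key' : K.integ (pair sh (K.fp f B η + κ • η) + g2 • (X * pair J η)) = 0 := by
    rw [map_add, key, neg_add_cancel]
  -- Among the terms linear in `θ`, the pairing of `φ̄` with the variation of `φ` cancels against
  -- the `φ̄` in the variation of `ω̄`; the remaining two are those of `key'`.
  rw [e1, e2, e3, e4, e5, e6, fp_add hf, smul_add, add_add_add_comm, pair_add_right φb,
    pair_add_left wb, pair_mul_left, pair_add_left φb, mul_add, pair_add_right J, mul_add, smul_add]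
  rw [hP, pair_C_right hφp]
  rw [hP, pair_C_right hshp] at key'
  rw [← sub_eq_zero, ← map_sub, ← key']
  congr 1
  abel

/-! ### The Gribov-Zwanziger actions -/

variable (g2 α m2 : ℝ) {Φ : FieldsOver d N G} (hΦ : K.IsConfig Φ) {θ : G} (hθ : θ ∈ K.odd)

theorem actionRef_zero (Φ : FieldsOver d N G) : K.actionRef f 0 0 Φ = 0 := by
  rw [actionRef, zero_div, zero_smul, zero_smul, sub_zero, map_zero]

theorem actionLoc_invariant (h0 : K.IsGreen 0 L₀) (hf : IsStructureConst f)
    (hΦ : K.IsConfig Φ) (hθ : θ ∈ K.odd) :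
    K.actionLoc f g2 (flow (K.sGamma f g2 0) θ Φ) = K.actionLoc f g2 Φ := by
  have := actionLoc_add_actionRef_invariant h0 h0 hf g2 0 hΦ hθ
  rwa [actionRef_zero, actionRef_zero, add_zero, add_zero] at this

theorem gaugeFixed_invariant (hf : IsStructureConst f) (hΦ : K.IsConfig Φ) (hθ : θ ∈ K.odd) :
    K.actionYM f (flow (K.sGamma f g2 κ) θ Φ) = K.actionYM f Φ ∧
    K.actionLandau f (flow (K.sGamma f g2 κ) θ Φ) = K.actionLandau f Φ ∧
    K.actionAlpha α (flow (K.sGamma f g2 κ) θ Φ) = K.actionAlpha α Φ ∧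
    K.actionGhostInt f α (flow (K.sGamma f g2 κ) θ Φ) = K.actionGhostInt f α Φ :=
  ⟨actionYM_invariant hΦ hθ hf (isGaugeBRST_sGamma g2 κ),
    actionLandau_invariant hΦ hθ hf (isGaugeBRST_sGamma g2 κ) (fun _ => rfl) fun _ => rfl,
    actionAlpha_invariant α fun _ => rfl,
    actionGhostInt_invariant hΦ hθ hf (isGaugeBRST_sGamma g2 κ) α (fun _ => rfl) fun _ => rfl⟩

end

end Calculus

end GribovZwanziger

end

noncomputable section

namespace GribovZwanziger

namespace Calculus

open PowerSeries (coeff X)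

section

variable {d N : ℕ} {G E : Type*} [Ring G] [Algebra ℝ G] [Ring E] [Algebra ℝ E]
  {K : Calculus d G E} {f : Colour N → Colour N → Colour N → ℝ} {L₀ L : G →ₗ[ℝ] G} {κ : ℝ}

/-! ### Odd vector fields and nilpotency -/

variable (K) in
/-- Odd vector fields over a calculus. -/
def IsOddField (Q : FieldsOver d N G → FieldsOver d N G) : Prop :=
  ∀ Φ, K.IsConfig Φ → ∀ i, K.HasPar (-i.sign) (Q Φ i) ∧ (i.vanishes → K.Dir (Q Φ i))

theorem IsOddField.isConfig_flow {Q : FieldsOver d N G → FieldsOver d N G} (hQ : K.IsOddField Q)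
    {Φ : FieldsOver d N G} (hΦ : K.IsConfig Φ) {θ : G} (hθ : θ ∈ K.odd) :
    K.IsConfig (flow Q θ Φ) := by
  intro i
  refine ⟨(hΦ i).1.add ?_, fun hi => ((hΦ i).2 hi).add (((hQ Φ hΦ i).2 hi).mul_left _)⟩
  have h := (hasPar_C hθ).mul (hQ Φ hΦ i).1
  rwa [neg_mul_neg, one_mul] at h

theorem HasPar.covD {ε : ℝ} {A : PotOver d N G} (hA : ∀ μ a, K.HasPar 1 (A μ a))
    {u : Colour N → PowerSeries G} (hu : ∀ a, K.HasPar ε (u a)) (μ : Fin d) (a : Colour N) :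
    K.HasPar ε (K.covD f A μ u a) :=
  ((hu a).D μ).sub (HasPar.sum fun b _ => HasPar.sum fun c _ =>
    ((((hA μ c).even_mul (hu b)).X_mul).smul _))

theorem IsConfig.covD_ghost {Φ : FieldsOver d N G} (hΦ : K.IsConfig Φ) (μ : Fin d)
    (a : Colour N) : K.HasPar (-1) (-K.covD f (Calculus.pot Φ) μ (Calculus.ghost Φ) a) :=
  (HasPar.covD hΦ.pot hΦ.ghost μ a).neg

theorem IsConfig.ghost_ghost {Φ : FieldsOver d N G} (hΦ : K.IsConfig Φ) (a : Colour N) :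
    K.HasPar (- -1) ((1 / 2 : ℝ) • (X * bracket f (Calculus.ghost Φ) (Calculus.ghost Φ) a)) ∧
      K.Dir ((1 / 2 : ℝ) • (X * bracket f (Calculus.ghost Φ) (Calculus.ghost Φ) a)) := by
  refine ⟨(HasPar.X_mul ?_).smul _,
    ((Dir.bracket_left hΦ.ghost_dir _ a).mul_left _).smul _⟩
  rw [show (- -1 : ℝ) = -1 * -1 by norm_num]
  exact HasPar.bracket hΦ.ghost hΦ.ghost a

theorem isOddField_sGamma (h0 : K.IsGreen 0 L₀) (hL : K.IsGreen κ L) (hf : IsStructureConst f)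
    (g2 : ℝ) : K.IsOddField (K.sGamma f g2 κ) := by
  intro Φ hΦ i
  cases i with
  | A μ a => exact ⟨hΦ.covD_ghost μ a, False.elim⟩
  | c a => exact ⟨hΦ.ghost_ghost a |>.1, fun _ => hΦ.ghost_ghost a |>.2⟩
  | cbar a =>
    refine ⟨?_, False.elim⟩
    simp only [Comp.sign, neg_neg]
    exact (hΦ (.b a)).1
  | b a => exact ⟨hasPar_zero _, False.elim⟩
  | phi μ a b => exact ⟨(hΦ (.om μ a b)).1, fun _ => (hΦ (.om μ a b)).2 trivial⟩
  | phibar μ a b => exact ⟨hasPar_zero _, fun _ => dir_zero⟩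
  | om μ a b => exact ⟨hasPar_zero _, fun _ => dir_zero⟩
  | ombar μ a b =>
    refine ⟨?_, fun _ => ((hΦ (.phibar μ a b)).2 trivial).add (dir_omShift hL hf g2 _ μ a b)⟩
    simp only [Comp.sign, neg_neg]
    exact (hΦ (.phibar μ a b)).1.add (hasPar_omShift h0 hL hf g2 hΦ.pot μ a b)

theorem isOddField_brst : K.IsOddField (K.brst f) := by
  intro Φ hΦ i
  cases i with
  | A μ a => exact ⟨hΦ.covD_ghost μ a, False.elim⟩
  | c a => exact ⟨hΦ.ghost_ghost a |>.1, fun _ => hΦ.ghost_ghost a |>.2⟩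
  | cbar a =>
    refine ⟨?_, False.elim⟩
    simp only [Comp.sign, neg_neg]
    exact (hΦ (.b a)).1
  | b a => exact ⟨hasPar_zero _, False.elim⟩
  | phi μ a b => exact ⟨(hΦ (.om μ a b)).1, fun _ => (hΦ (.om μ a b)).2 trivial⟩
  | phibar μ a b => exact ⟨hasPar_zero _, fun _ => dir_zero⟩
  | om μ a b => exact ⟨hasPar_zero _, fun _ => dir_zero⟩
  | ombar μ a b =>
    refine ⟨?_, fun _ => (hΦ (.phibar μ a b)).2 trivial⟩
    simp only [Comp.sign, neg_neg]
    exact (hΦ (.phibar μ a b)).1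

section

variable {Φ : FieldsOver d N G} (hΦ : K.IsConfig Φ) {θ : G} (hθ : θ ∈ K.odd)
  (hf : IsStructureConst f) {Q : FieldsOver d N G → FieldsOver d N G} (hQ : IsGaugeBRST K f Q)
include hΦ hθ hf hQ

theorem covD_ghost_flow (μ : Fin d) : K.covD f (pot (flow Q θ Φ)) μ (ghost (flow Q θ Φ))
    = K.covD f (pot Φ) μ (ghost Φ) := by
  rw [pot_flow hQ, ghost_flow hQ]
  exact covD_ghost_variation hθ hf hΦ.pot hΦ.ghost μ

theorem bracket_ghost_flow : bracket f (ghost (flow Q θ Φ)) (ghost (flow Q θ Φ))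
    = bracket f (ghost Φ) (ghost Φ) := by
  rw [ghost_flow hQ]
  exact bracket_ghost_variation hθ hf hΦ.ghost

theorem dressed_flow (h0 : K.IsGreen 0 L₀) :
    K.dressed f (pot (flow Q θ Φ)) = K.dressed f (pot Φ) := by
  rw [pot_flow hQ]
  exact h0.dressed_invariant hf hθ hΦ.pot hΦ.ghost hΦ.ghost_dir

theorem omShift_flow (h0 : K.IsGreen 0 L₀) (g2 : ℝ) :
    K.omShift f g2 κ (pot (flow Q θ Φ)) = K.omShift f g2 κ (pot Φ) := by
  funext μ a b
  rw [omShift, dressed_flow hΦ hθ hf hQ h0]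
  rfl

end

theorem flow_apply (Q : FieldsOver d N G → FieldsOver d N G) (θ : G) (Φ : FieldsOver d N G)
    (i : Comp d N) : flow Q θ Φ i = Φ i + PowerSeries.C θ * Q Φ i := rfl

/-- Nilpotency means that the vector field is constant along its own flow. `D c` and `c × c` are
invariant, `b`, `ω` and `φ̄` have zero variation, and the shift is a functional of the invariant
`A^h`. -/
theorem sGamma_flow (h0 : K.IsGreen 0 L₀) (hf : IsStructureConst f) (g2 : ℝ)
    {Φ : FieldsOver d N G} (hΦ : K.IsConfig Φ) {θ : G} (hθ : θ ∈ K.odd) :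
    K.sGamma f g2 κ (flow (K.sGamma f g2 κ) θ Φ) = K.sGamma f g2 κ Φ := by
  have hQ := isGaugeBRST_sGamma (K := K) (f := f) g2 κ
  funext i
  cases i with
  | A μ a => exact congrArg (fun x => -x) (congrFun (covD_ghost_flow hΦ hθ hf hQ μ) a)
  | c a =>
    exact congrArg (fun x => (1 / 2 : ℝ) • (X * x)) (congrFun (bracket_ghost_flow hΦ hθ hf hQ) a)
  | cbar a =>
    change Φ (.b a) + PowerSeries.C θ * 0 = Φ (.b a)
    rw [mul_zero, add_zero]
  | b a => rfl
  | phi μ a b =>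
    change Φ (.om μ a b) + PowerSeries.C θ * 0 = Φ (.om μ a b)
    rw [mul_zero, add_zero]
  | phibar μ a b => rfl
  | om μ a b => rfl
  | ombar μ a b =>
    change Φ (.phibar μ a b) + PowerSeries.C θ * 0 + K.omShift f g2 κ _ μ a b
      = Φ (.phibar μ a b) + K.omShift f g2 κ _ μ a b
    rw [mul_zero, add_zero, omShift_flow hΦ hθ hf hQ h0]

theorem brst_flow (hf : IsStructureConst f)
    {Φ : FieldsOver d N G} (hΦ : K.IsConfig Φ) {θ : G} (hθ : θ ∈ K.odd) :
    K.brst f (flow (K.brst f) θ Φ) = K.brst f Φ := by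
  have hQ := isGaugeBRST_brst (K := K) (f := f)
  funext i
  cases i with
  | A μ a => exact congrArg (fun x => -x) (congrFun (covD_ghost_flow hΦ hθ hf hQ μ) a)
  | c a =>
    exact congrArg (fun x => (1 / 2 : ℝ) • (X * x)) (congrFun (bracket_ghost_flow hΦ hθ hf hQ) a)
  | cbar a =>
    change Φ (.b a) + PowerSeries.C θ * 0 = Φ (.b a)
    rw [mul_zero, add_zero]
  | b a => rfl
  | phi μ a b =>
    change Φ (.om μ a b) + PowerSeries.C θ * 0 = Φ (.om μ a b)
    rw [mul_zero, add_zero]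
  | phibar μ a b => rfl
  | om μ a b => rfl
  | ombar μ a b =>
    change Φ (.phibar μ a b) + PowerSeries.C θ * 0 = Φ (.phibar μ a b)
    rw [mul_zero, add_zero]

/-! ### The limit of vanishing Gribov parameter -/

theorem omShift_eq_smul (g2 : ℝ) (A : PotOver d N G) (μ : Fin d) (a b : Colour N) :
    K.omShift f g2 κ A μ a b = g2 • K.omShift f 1 κ A μ a b := by
  rw [omShift, omShift, one_smul, smul_neg]

theorem tendsto_coeff_add_smul (n : ℕ) (ℓ : G →ₗ[ℝ] ℝ) (x y : PowerSeries G) (k : ℕ)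
    (hk : k ≠ 0) :
    Tendsto (fun γ : ℝ => ℓ (coeff n (x + γ ^ k • y))) (𝓝 0) (𝓝 (ℓ (coeff n x))) := by
  have e : (fun γ : ℝ => ℓ (coeff n (x + γ ^ k • y)))
      = fun γ => ℓ (coeff n x) + γ ^ k * ℓ (coeff n y) := by
    funext γ
    rw [map_add, coeff_real_smul, map_add, map_smul, smul_eq_mul]
  rw [e]
  have h : Continuous fun γ : ℝ => ℓ (coeff n x) + γ ^ k * ℓ (coeff n y) := by fun_prop
  have h' := h.tendsto 0
  rwa [zero_pow hk, zero_mul, add_zero] at h'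

theorem sGamma_zero (Φ : FieldsOver d N G) : K.sGamma f 0 κ Φ = K.brst f Φ := by
  funext i
  cases i with
  | ombar μ a b =>
    change Φ (.phibar μ a b) + K.omShift f 0 κ _ μ a b = Φ (.phibar μ a b)
    rw [omShift_eq_smul, zero_smul, add_zero]
  | _ => rfl

theorem tendsto_sGamma (Φ : FieldsOver d N G) (i : Comp d N) (n : ℕ) (ℓ : G →ₗ[ℝ] ℝ) :
    Tendsto (fun γ : ℝ => ℓ (coeff n (K.sGamma f (γ ^ 2) κ Φ i))) (𝓝 0)
      (𝓝 (ℓ (coeff n (K.brst f Φ i)))) := by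
  cases i with
  | ombar μ a b =>
    change Tendsto (fun γ : ℝ => ℓ (coeff n (Φ (.phibar μ a b) + K.omShift f (γ ^ 2) κ _ μ a b)))
      _ (𝓝 (ℓ (coeff n (Φ (.phibar μ a b)))))
    simp only [omShift_eq_smul (_ ^ 2)]
    exact tendsto_coeff_add_smul n ℓ _ _ 2 two_ne_zero
  | _ => exact tendsto_const_nhds

/-! ### The decomposition of the non-perturbative BRST operator -/

variable (K f) in
/-- `R` is a functional of the potential with BRST variation `sR`. -/
structure IsVariation (R : PotOver d N G → Colour N → PowerSeries G)
    (sR : FieldsOver d N G → Colour N → PowerSeries G) : Prop where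
  even : ∀ A : PotOver d N G, (∀ μ a, K.HasPar 1 (A μ a)) → ∀ a, K.HasPar 1 (R A a)
  acts : ∀ Φ, K.IsConfig Φ → ∀ θ ∈ K.odd, ∀ a,
    R (pot (flow (K.brst f) θ Φ)) a = R (pot Φ) a + PowerSeries.C θ * sR Φ a

namespace IsVariation

variable {R : PotOver d N G → Colour N → PowerSeries G}
  {sR : FieldsOver d N G → Colour N → PowerSeries G} (hR : K.IsVariation f R sR)
include hR

/-- `θ sR` is a difference of two values of the even functional `R`. -/
theorem odd {Φ : FieldsOver d N G} (hΦ : K.IsConfig Φ) (a : Colour N) :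
    K.HasPar (-1) (sR Φ a) := by
  refine hasPar_odd_of_C_mul fun θ hθ => ?_
  have h := hR.acts Φ hΦ θ hθ a
  rw [← sub_eq_iff_eq_add'] at h
  rw [← h]
  exact (hR.even _ (isOddField_brst.isConfig_flow hΦ hθ).pot a).sub (hR.even _ hΦ.pot a)

/-- A priori `sR` is any function of all the fields. The flow of `A` involves only `A` and `c`, and
odd constants separate, so on configurations `sR` depends on `A` and `c` alone. -/
theorem congr {Φ Ψ : FieldsOver d N G} (hΦ : K.IsConfig Φ) (hΨ : K.IsConfig Ψ)
    (hp : pot Φ = pot Ψ) (hg : ghost Φ = ghost Ψ) : sR Φ = sR Ψ := by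
  funext a
  refine eq_of_C_mul_eq (K := K) fun θ hθ => ?_
  have h1 := hR.acts Φ hΦ θ hθ a
  have h2 := hR.acts Ψ hΨ θ hθ a
  rw [pot_flow isGaugeBRST_brst, hp, hg, ← pot_flow isGaugeBRST_brst, h2] at h1
  exact (add_left_cancel h1).symm

/-- This is `s(sR) = 0`. As the BRST field is constant along its flow, the flow by `θ` followed by
that by `θ'` is the flow by `θ + θ'`, again an odd parameter. Expanding `R` both ways and cancelling
leaves an equality of coefficients of `θ'`. -/
theorem brst_flow (hf : IsStructureConst f) {Φ : FieldsOver d N G} (hΦ : K.IsConfig Φ) {θ : G}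
    (hθ : θ ∈ K.odd) : sR (flow (K.brst f) θ Φ) = sR Φ := by
  funext a
  refine eq_of_C_mul_eq (K := K) fun θ' hθ' => ?_
  have h1 := hR.acts _ ((isOddField_brst (f := f)).isConfig_flow hΦ hθ) θ' hθ' a
  have h2 := hR.acts Φ hΦ (θ + θ') (K.odd_add θ hθ θ' hθ') a
  have e : flow (K.brst f) θ' (flow (K.brst f) θ Φ) = flow (K.brst f) (θ + θ') Φ := by
    funext i
    rw [flow_apply, Calculus.brst_flow hf hΦ hθ, flow_apply, flow_apply, map_add, add_mul,
      add_assoc]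
  rw [e, h2, hR.acts Φ hΦ θ hθ a, map_add, add_mul, add_assoc] at h1
  exact (add_left_cancel (add_left_cancel h1)).symm

variable (g2 : ℝ)

omit hR in
theorem isGaugeBRST_sBh : IsGaugeBRST K f (K.sBh f g2 R sR) :=
  ⟨fun _ _ _ => rfl, fun _ _ => rfl⟩

theorem isOddField_sBh : K.IsOddField (K.sBh f g2 R sR) := by
  intro Φ hΦ i
  cases i with
  | A μ a => exact ⟨hΦ.covD_ghost μ a, False.elim⟩
  | c a => exact ⟨hΦ.ghost_ghost a |>.1, fun _ => hΦ.ghost_ghost a |>.2⟩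
  | cbar a =>
    refine ⟨?_, False.elim⟩
    simp only [Comp.sign, neg_neg]
    exact (hΦ (.b a)).1.add ((hR.even _ hΦ.pot a).smul _)
  | b a => exact ⟨((hR.odd hΦ a).smul _).neg, False.elim⟩
  | phi μ a b => exact ⟨(hΦ (.om μ a b)).1, fun _ => (hΦ (.om μ a b)).2 trivial⟩
  | phibar μ a b => exact ⟨hasPar_zero _, fun _ => dir_zero⟩
  | om μ a b => exact ⟨hasPar_zero _, fun _ => dir_zero⟩
  | ombar μ a b =>
    refine ⟨?_, fun _ => (hΦ (.phibar μ a b)).2 trivial⟩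
    simp only [Comp.sign, neg_neg]
    exact (hΦ (.phibar μ a b)).1

theorem isOddField_deltaGamma (h0 : K.IsGreen 0 L₀) (hL : K.IsGreen κ L)
    (hf : IsStructureConst f) : K.IsOddField (K.deltaGamma f g2 κ R sR) := by
  intro Φ hΦ i
  cases i with
  | A μ a => exact ⟨hasPar_zero _, False.elim⟩
  | c a => exact ⟨hasPar_zero _, fun _ => dir_zero⟩
  | cbar a =>
    refine ⟨?_, False.elim⟩
    simp only [Comp.sign, neg_neg]
    exact ((hR.even _ hΦ.pot a).smul _).neg
  | b a => exact ⟨(hR.odd hΦ a).smul _, False.elim⟩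
  | phi μ a b => exact ⟨hasPar_zero _, fun _ => dir_zero⟩
  | phibar μ a b => exact ⟨hasPar_zero _, fun _ => dir_zero⟩
  | om μ a b => exact ⟨hasPar_zero _, fun _ => dir_zero⟩
  | ombar μ a b =>
    refine ⟨?_, fun _ => dir_omShift hL hf g2 _ μ a b⟩
    simp only [Comp.sign, neg_neg]
    exact hasPar_omShift h0 hL hf g2 hΦ.pot μ a b

section

variable {Φ : FieldsOver d N G} (hΦ : K.IsConfig Φ)
include hΦ

theorem isConfig_toBh : K.IsConfig (toBh g2 R Φ) := by
  intro i
  cases i with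
  | b a => exact ⟨(hΦ (.b a)).1.sub ((hR.even _ hΦ.pot a).smul _), False.elim⟩
  | _ => exact hΦ _

omit hR hΦ in
theorem sGamma_eq_add : K.sGamma f g2 κ Φ = K.sBh f g2 R sR Φ + K.deltaGamma f g2 κ R sR Φ := by
  funext i
  cases i with
  | cbar a =>
    change Φ (.b a) = Φ (.b a) + g2 ^ 2 • R (pot Φ) a + -(g2 ^ 2 • R (pot Φ) a)
    rw [add_neg_cancel_right]
  | b a => exact (neg_add_cancel _).symm
  | ombar μ a b => rfl
  | _ => exact (add_zero _).symm

variable {θ : G} (hθ : θ ∈ K.odd) (hf : IsStructureConst f)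
include hθ

theorem toBh_flow : toBh g2 R (flow (K.brst f) θ Φ)
    = flow (K.sBh f g2 R sR) θ (toBh g2 R Φ) := by
  have hs : sR (toBh g2 R Φ) = sR Φ := hR.congr (hR.isConfig_toBh g2 hΦ) hΦ rfl rfl
  funext i
  cases i with
  | cbar a =>
    change Φ (.cbar a) + PowerSeries.C θ * Φ (.b a) = Φ (.cbar a)
      + PowerSeries.C θ * (Φ (.b a) - g2 ^ 2 • R (pot Φ) a + g2 ^ 2 • R (pot Φ) a)
    rw [sub_add_cancel]
  | b a =>
    change Φ (.b a) + PowerSeries.C θ * 0 - g2 ^ 2 • R (pot (flow (K.brst f) θ Φ)) a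
      = Φ (.b a) - g2 ^ 2 • R (pot Φ) a + PowerSeries.C θ * -(g2 ^ 2 • sR (toBh g2 R Φ) a)
    rw [hR.acts Φ hΦ θ hθ, hs, smul_add, mul_neg, mul_smul_comm, mul_zero, add_zero, sub_add_eq_sub_sub,
      ← sub_eq_add_neg]
  | _ => rfl

theorem pot_flow_sBh : R (pot (flow (K.sBh f g2 R sR) θ Φ)) = fun a => R (pot Φ) a
    + PowerSeries.C θ * sR Φ a := by
  funext a
  rw [pot_flow (isGaugeBRST_sBh g2), ← pot_flow isGaugeBRST_brst, hR.acts Φ hΦ θ hθ]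

include hf

/-- The flows of `s` in the variables `b` and `b^h` move `A` and `c` in the same way, and `sR` sees
nothing else. -/
theorem sR_flow_sBh : sR (flow (K.sBh f g2 R sR) θ Φ) = sR Φ := by
  rw [← hR.brst_flow hf hΦ hθ]
  refine hR.congr ((hR.isOddField_sBh g2).isConfig_flow hΦ hθ)
    (isOddField_brst.isConfig_flow hΦ hθ) ?_ ?_
  · rw [pot_flow (isGaugeBRST_sBh g2), pot_flow isGaugeBRST_brst]
  · rw [ghost_flow (isGaugeBRST_sBh g2), ghost_flow isGaugeBRST_brst]

theorem sBh_flow : K.sBh f g2 R sR (flow (K.sBh f g2 R sR) θ Φ) = K.sBh f g2 R sR Φ := by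
  have hQ := isGaugeBRST_sBh (K := K) (f := f) (R := R) (sR := sR) g2
  funext i
  cases i with
  | A μ a => exact congrArg (fun x => -x) (congrFun (covD_ghost_flow hΦ hθ hf hQ μ) a)
  | c a =>
    exact congrArg (fun x => (1 / 2 : ℝ) • (X * x)) (congrFun (bracket_ghost_flow hΦ hθ hf hQ) a)
  | cbar a =>
    change Φ (.b a) + PowerSeries.C θ * -(g2 ^ 2 • sR Φ a)
      + g2 ^ 2 • R (pot (flow (K.sBh f g2 R sR) θ Φ)) a = Φ (.b a) + g2 ^ 2 • R (pot Φ) a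
    -- The variation of `b^h` cancels that of `γ⁴ R`.
    rw [hR.pot_flow_sBh g2 hΦ hθ, smul_add, mul_neg, mul_smul_comm]
    abel
  | b a => exact congrArg (fun x => -(g2 ^ 2 • x)) (congrFun (hR.sR_flow_sBh g2 hΦ hθ hf) a)
  | phi μ a b =>
    change Φ (.om μ a b) + PowerSeries.C θ * 0 = Φ (.om μ a b)
    rw [mul_zero, add_zero]
  | phibar μ a b => rfl
  | om μ a b => rfl
  | ombar μ a b =>
    change Φ (.phibar μ a b) + PowerSeries.C θ * 0 = Φ (.phibar μ a b)
    rw [mul_zero, add_zero]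

omit hR hΦ hθ hf in
theorem pot_flow_deltaGamma : pot (flow (K.deltaGamma f g2 κ R sR) θ Φ) = pot Φ := by
  funext μ a
  change Φ (.A μ a) + PowerSeries.C θ * 0 = Φ (.A μ a)
  rw [mul_zero, add_zero]

omit hR hΦ hθ hf in
theorem ghost_flow_deltaGamma : ghost (flow (K.deltaGamma f g2 κ R sR) θ Φ) = ghost Φ := by
  funext a
  change Φ (.c a) + PowerSeries.C θ * 0 = Φ (.c a)
  rw [mul_zero, add_zero]

theorem sR_flow_deltaGamma (h0 : K.IsGreen 0 L₀) (hL : K.IsGreen κ L) :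
    sR (flow (K.deltaGamma f g2 κ R sR) θ Φ) = sR Φ :=
  hR.congr ((hR.isOddField_deltaGamma g2 h0 hL hf).isConfig_flow hΦ hθ) hΦ
    (pot_flow_deltaGamma g2) (ghost_flow_deltaGamma g2)

/-- The values of `δ` depend on `A` and `c` only, and `δ` moves neither. -/
theorem deltaGamma_flow (h0 : K.IsGreen 0 L₀) (hL : K.IsGreen κ L) :
    K.deltaGamma f g2 κ R sR (flow (K.deltaGamma f g2 κ R sR) θ Φ)
      = K.deltaGamma f g2 κ R sR Φ := by
  funext i
  cases i with
  | cbar a => exact congrArg (fun A => -(g2 ^ 2 • R A a)) (pot_flow_deltaGamma g2)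
  | b a => exact congrArg (fun x => g2 ^ 2 • x a) (hR.sR_flow_deltaGamma g2 hΦ hθ hf h0 hL)
  | ombar μ a b => exact congrArg (fun A => K.omShift f g2 κ A μ a b) (pot_flow_deltaGamma g2)
  | _ => rfl

/-- The anticommutator of `s` and `δ` acting on the fields, one order at a time. -/
theorem deltaGamma_flow_sBh (h0 : K.IsGreen 0 L₀) :
    K.deltaGamma f g2 κ R sR (flow (K.sBh f g2 R sR) θ Φ)
      = K.deltaGamma f g2 κ R sR Φ + (PowerSeries.C θ : PowerSeries G) •
        fun i => match i with
          | .cbar a => -(g2 ^ 2 • sR Φ a)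
          | _ => 0 := by
  have hQ := isGaugeBRST_sBh (K := K) (f := f) (R := R) (sR := sR) g2
  have hz : ∀ x : PowerSeries G, x = x + PowerSeries.C θ * 0 := fun x => by
    rw [mul_zero, add_zero]
  funext i
  cases i with
  | cbar a =>
    change -(g2 ^ 2 • R (pot (flow (K.sBh f g2 R sR) θ Φ)) a)
      = -(g2 ^ 2 • R (pot Φ) a) + PowerSeries.C θ * -(g2 ^ 2 • sR Φ a)
    rw [hR.pot_flow_sBh g2 hΦ hθ, smul_add, mul_neg, mul_smul_comm, neg_add]
  | b a =>
    exact (congrArg (fun x => g2 ^ 2 • x a) (hR.sR_flow_sBh g2 hΦ hθ hf)).trans (hz _)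
  | ombar μ a b =>
    exact (congrArg (fun x => x μ a b) (omShift_flow hΦ hθ hf hQ h0 g2)).trans (hz _)
  | _ => exact hz _

/-- Only `c̄` contributes: `s c̄ = b^h + γ⁴ R`, where `δ` moves `b^h` by `γ⁴ sR` and leaves `R`
fixed. This is opposite to the action of `s` on `δ c̄ = -γ⁴ R`. -/
theorem sBh_flow_deltaGamma (h0 : K.IsGreen 0 L₀) (hL : K.IsGreen κ L) :
    K.sBh f g2 R sR (flow (K.deltaGamma f g2 κ R sR) θ Φ)
      = K.sBh f g2 R sR Φ + (PowerSeries.C θ : PowerSeries G) •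
        -fun i => match i with
          | .cbar a => -(g2 ^ 2 • sR Φ a)
          | _ => 0 := by
  have hp := pot_flow_deltaGamma (K := K) (f := f) (κ := κ) (R := R) (sR := sR) (Φ := Φ) (θ := θ) g2
  have hg := ghost_flow_deltaGamma (K := K) (f := f) (κ := κ) (R := R) (sR := sR) (Φ := Φ)
    (θ := θ) g2
  have hz : ∀ x : PowerSeries G, x = x + PowerSeries.C θ * -0 := fun x => by
    rw [neg_zero, mul_zero, add_zero]
  funext i
  cases i with
  | A μ a => exact (congrArg₂ (fun A c => -K.covD f A μ c a) hp hg).trans (hz _)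
  | c a =>
    exact (congrArg (fun c => (1 / 2 : ℝ) • (X * bracket f c c a)) hg).trans (hz _)
  | cbar a =>
    change Φ (.b a) + PowerSeries.C θ * (g2 ^ 2 • sR Φ a)
      + g2 ^ 2 • R (pot (flow (K.deltaGamma f g2 κ R sR) θ Φ)) a
      = Φ (.b a) + g2 ^ 2 • R (pot Φ) a + PowerSeries.C θ * - -(g2 ^ 2 • sR Φ a)
    rw [hp, neg_neg]
    abel
  | b a =>
    exact (congrArg (fun x => -(g2 ^ 2 • x a)) (hR.sR_flow_deltaGamma g2 hΦ hθ hf h0 hL)).trans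
      (hz _)
  | phi μ a b =>
    change Φ (.om μ a b) + PowerSeries.C θ * 0 = Φ (.om μ a b) + PowerSeries.C θ * -0
    rw [neg_zero]
  | ombar μ a b =>
    change Φ (.phibar μ a b) + PowerSeries.C θ * 0 = Φ (.phibar μ a b) + PowerSeries.C θ * -0
    rw [neg_zero]
  | _ => exact hz _

end

omit hR in
theorem sBh_zero (Φ : FieldsOver d N G) : K.sBh f 0 R sR Φ = K.brst f Φ := by
  funext i
  cases i with
  | cbar a =>
    change Φ (.b a) + (0 : ℝ) ^ 2 • R (pot Φ) a = Φ (.b a)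
    rw [zero_pow two_ne_zero, zero_smul, add_zero]
  | b a =>
    change -((0 : ℝ) ^ 2 • sR Φ a) = 0
    rw [zero_pow two_ne_zero, zero_smul, neg_zero]
  | _ => rfl

omit hR in
theorem deltaGamma_zero (Φ : FieldsOver d N G) : K.deltaGamma f 0 κ R sR Φ = 0 := by
  funext i
  cases i with
  | cbar a =>
    change -((0 : ℝ) ^ 2 • R (pot Φ) a) = 0
    rw [zero_pow two_ne_zero, zero_smul, neg_zero]
  | b a =>
    change (0 : ℝ) ^ 2 • sR Φ a = 0
    rw [zero_pow two_ne_zero, zero_smul]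
  | ombar μ a b =>
    change K.omShift f 0 κ _ μ a b = 0
    rw [omShift_eq_smul, zero_smul]
  | _ => rfl

omit hR in
theorem tendsto_deltaGamma (Φ : FieldsOver d N G) (i : Comp d N) (n : ℕ) (ℓ : G →ₗ[ℝ] ℝ) :
    Tendsto (fun γ : ℝ => ℓ (coeff n (K.deltaGamma f (γ ^ 2) κ R sR Φ i))) (𝓝 0) (𝓝 0) := by
  have key : ∀ (y : PowerSeries G) (k : ℕ), k ≠ 0 →
      Tendsto (fun γ : ℝ => ℓ (coeff n (γ ^ k • y))) (𝓝 0) (𝓝 0) := by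
    intro y k hk
    simpa only [zero_add, map_zero] using tendsto_coeff_add_smul n ℓ 0 y k hk
  have hz : Tendsto (fun _ : ℝ => ℓ (coeff n (0 : PowerSeries G))) (𝓝 0) (𝓝 0) := by
    simp only [map_zero]
    exact tendsto_const_nhds
  cases i with
  | cbar a =>
    refine (key (-R (pot Φ) a) 4 (by norm_num)).congr fun γ => ?_
    rw [smul_neg, show γ ^ 4 = (γ ^ 2) ^ 2 by ring]
    rfl
  | b a =>
    refine (key (sR Φ a) 4 (by norm_num)).congr fun γ => ?_
    rw [show γ ^ 4 = (γ ^ 2) ^ 2 by ring]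
    rfl
  | ombar μ a b =>
    refine (key (K.omShift f 1 κ (pot Φ) μ a b) 2 two_ne_zero).congr fun γ => ?_
    rw [← omShift_eq_smul]
    rfl
  | _ => exact hz

end IsVariation

end

end Calculus

end GribovZwanziger

end

noncomputable section

namespace GribovZwanziger

namespace Calculus

open PowerSeries (coeff X)

section

variable {d N : ℕ} {G E : Type*} [Ring G] [Algebra ℝ G] [Ring E] [Algebra ℝ E]
  {K : Calculus d G E} {f : Colour N → Colour N → Colour N → ℝ} {L : G →ₗ[ℝ] G}

/-! ### Functionals of the potential -/

variable (K) in
/-- Even potentials. -/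
def EvenPot (A : PotOver d N G) : Prop := ∀ μ a, K.HasPar 1 (A μ a)

variable (K L) in
/-- A class of functionals of the potential closed under algebraic operations, derivatives, the
operator `L` and limits. -/
structure FunctionalClass (NL : (PotOver d N G → PowerSeries G) → Prop) : Prop where
  zero : NL fun _ => 0
  comp : ∀ μ a, NL fun A => A μ a
  add : ∀ {P Q}, NL P → NL Q → NL fun A => P A + Q A
  mul : ∀ {P Q}, NL P → NL Q → NL fun A => P A * Q A
  X_mul : ∀ {P}, NL P → NL fun A => X * P A
  smul : ∀ (r : ℝ) {P}, NL P → NL fun A => r • P A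
  D : ∀ μ {P}, NL P → NL fun A => K.D μ (P A)
  lift : ∀ {P}, NL P → NL fun A => lift L (P A)
  limit : ∀ {P}, (∀ m, ∃ P', NL P' ∧ ∀ A, K.EvenPot A → TruncEq m (P A) (P' A)) → NL P

namespace FunctionalClass

variable {NL : (PotOver d N G → PowerSeries G) → Prop} (h : K.FunctionalClass L NL)
include h

theorem neg {P : PotOver d N G → PowerSeries G} (hP : NL P) : NL fun A => -P A := by
  simpa only [neg_one_smul] using h.smul (-1) hP

theorem sub {P Q : PotOver d N G → PowerSeries G} (hP : NL P) (hQ : NL Q) :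
    NL fun A => P A - Q A := by
  simpa only [sub_eq_add_neg] using h.add hP (h.neg hQ)

theorem sum {ι : Type*} (s : Finset ι) {P : ι → PotOver d N G → PowerSeries G}
    (hP : ∀ i, NL (P i)) : NL fun A => ∑ i ∈ s, P i A := by
  classical
  induction s using Finset.induction_on with
  | empty => simpa only [Finset.sum_empty] using h.zero
  | insert i s hi ih => simpa only [Finset.sum_insert hi] using h.add (hP i) ih

theorem X_pow_mul (k : ℕ) {P : PotOver d N G → PowerSeries G} (hP : NL P) :
    NL fun A => X ^ k * P A := by
  induction k with
  | zero => simpa only [pow_zero, one_mul] using hP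
  | succ k ih => simpa only [pow_succ', mul_assoc] using h.X_mul ih

theorem gsum {t : ℕ → PotOver d N G → PowerSeries G} (ht : ∀ k, NL (t k)) :
    NL fun A => GribovZwanziger.gsum fun k => t k A :=
  h.limit fun m => ⟨_, h.sum (Finset.range m) fun k => h.X_pow_mul k (ht k),
    fun A _ => gsum_truncEq (fun k => t k A) m⟩

theorem bracket {u v : PotOver d N G → Colour N → PowerSeries G} (hu : ∀ a, NL fun A => u A a)
    (hv : ∀ a, NL fun A => v A a) (a : Colour N) :
    NL fun A => GribovZwanziger.bracket f (u A) (v A) a :=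
  h.sum _ fun b => h.sum _ fun c => h.smul _ (h.mul (hu b) (hv c))

theorem adSum (p : ℕ → ℝ) {ξ u : PotOver d N G → Colour N → PowerSeries G}
    (hξ : ∀ a, NL fun A => ξ A a) (hu : ∀ a, NL fun A => u A a) (a : Colour N) :
    NL fun A => Calculus.adSum f p (ξ A) (u A) a := by
  refine h.gsum fun k => h.smul _ ?_
  induction k generalizing a with
  | zero => exact hu a
  | succ k ih =>
    simp only [Function.iterate_succ_apply']
    exact h.bracket hξ ih a

/-- Fixed points of contractions in the class. -/
theorem of_fixed {Ψ : PotOver d N G → (Colour N → PowerSeries G) → Colour N → PowerSeries G}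
    (hΨ : ∀ A, IsContraction (Ψ A))
    (hNL : ∀ u : PotOver d N G → Colour N → PowerSeries G, (∀ a, NL fun A => u A a) →
      ∀ a, NL fun A => Ψ A (u A) a)
    {u : PotOver d N G → Colour N → PowerSeries G} (hu : ∀ A, K.EvenPot A → Ψ A (u A) = u A)
    (a : Colour N) : NL fun A => u A a := by
  have h2 : ∀ m a, NL fun A => (Ψ A)^[m] 0 a := by
    intro m
    induction m with
    | zero => exact fun a => h.zero
    | succ m ih =>
      simp only [Function.iterate_succ_apply']
      exact hNL _ ih
  exact h.limit fun m => ⟨_, h2 m a, fun A hA => (hΨ A).truncEq_iterate (hu A hA) 0 m a⟩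

/-- Solutions of perturbative boundary value problems in the class. -/
theorem of_boundaryValue (hL : K.IsGreen 0 L)
    {F : PotOver d N G → (Colour N → PowerSeries G) → Colour N → PowerSeries G}
    (hF : ∀ A, IsContraction (F A))
    (hNL : ∀ u : PotOver d N G → Colour N → PowerSeries G, (∀ a, NL fun A => u A a) →
      ∀ a, NL fun A => F A (u A) a)
    {u : PotOver d N G → Colour N → PowerSeries G}
    (hu : ∀ A, K.EvenPot A → (∀ a, K.Dir (u A a)) ∧
      ∀ a, -(∑ μ, K.D μ (K.D μ (u A a))) + (0 : ℝ) • u A a = F A (u A) a)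
    (a : Colour N) : NL fun A => u A a :=
  h.of_fixed (fun A => IsContraction.lift_comp (hF A) L)
    (fun u hu a => h.lift (hNL u hu a)) (fun A hA => (hL.fixed_iff (F A) (u A)).1 (hu A hA)) a

/-- The dressing parameter is in the class. -/
theorem dressing (hL : K.IsGreen 0 L) (a : Colour N) :
    NL fun A => Classical.epsilon (K.IsDressing f A) a := by
  refine h.of_boundaryValue hL (F := fun A => K.dressingRHS f A)
    (fun A => isContraction_dressingRHS A) (fun u hu a => ?_) (fun A hA => ?_) a
  · refine h.neg (h.sum _ fun μ => h.D μ (h.add (h.comp μ a) (h.X_mul (h.sub ?_ ?_))))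
    · exact h.adSum _ hu (h.bracket hu fun b => h.comp μ b) a
    · exact h.adSum _ hu (h.bracket hu fun b => h.D μ (hu b)) a
  · have hξ := hL.isDressing_epsilon (f := f) hA
    exact ⟨hξ.2.1, fun a => (dressing_equation_iff A _ a).1 (hξ.2.2 a)⟩

theorem dressed (hL : K.IsGreen 0 L) (μ : Fin d) (a : Colour N) :
    NL fun A => K.dressed f A μ a := by
  have hξ := h.dressing (f := f) hL
  simp only [Calculus.dressed, gaugeTransform_eq]
  exact h.sub (h.adSum _ hξ (fun b => h.comp μ b) a) (h.adSum _ hξ (fun b => h.D μ (hξ b)) a)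

theorem fpInv (hL : K.IsGreen 0 L) (hf : IsStructureConst f) {B : PotOver d N G → PotOver d N G}
    (hB : ∀ μ a, NL fun A => B A μ a) {J : PotOver d N G → Colour N → PowerSeries G}
    (hJ : ∀ a, NL fun A => J A a) (a : Colour N) : NL fun A => K.fpInv f 0 (B A) (J A) a := by
  refine h.of_boundaryValue hL (F := fun A => K.fpRHS f (B A) (J A))
    (fun A => isContraction_fpRHS _ _) (fun u hu a => ?_) (fun A hA => ?_) a
  · exact h.add (hJ a) (h.X_mul (h.sum _ fun μ => h.D μ (h.bracket (hB μ) hu a)))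
  · have hs := hL.isFPSolution_fpInv hf (B A) (J A)
    exact ⟨hs.1, fun a => (fp_equation_iff hf _ _ _ a).1 (hs.2 a)⟩

theorem source {B : PotOver d N G → PotOver d N G} (hB : ∀ μ a, NL fun A => B A μ a)
    (μ : Fin d) (c a : Colour N) : NL fun A => Calculus.source f (B A) μ c a :=
  h.sum _ fun e => h.smul _ (hB μ e)

end FunctionalClass

/-! ### The inverse of the transposed Faddeev-Popov operator -/

variable (K f) in
/-- Solutions of the transposed Faddeev-Popov equation with vanishing boundary values. -/
def IsFPTrSolution (A : PotOver d N G) (J u : Colour N → PowerSeries G) : Prop :=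
  (∀ a, K.Dir (u a)) ∧ K.fpTr f A u = J

variable (K f) in
/-- The inverse of the transposed Faddeev-Popov operator. -/
def fpTrInv (A : PotOver d N G) (J : Colour N → PowerSeries G) : Colour N → PowerSeries G :=
  Classical.epsilon (K.IsFPTrSolution f A J)

variable (K f) in
/-- The right-hand side of the transposed Faddeev-Popov equation. -/
def fpTrRHS (A : PotOver d N G) (J u : Colour N → PowerSeries G) : Colour N → PowerSeries G :=
  fun a => J a + X * ∑ μ, bracket f (A μ) (K.Dv μ u) a

theorem isContraction_fpTrRHS (A : PotOver d N G) (J : Colour N → PowerSeries G) :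
    IsContraction (K.fpTrRHS f A J) := by
  intro m u v h a
  exact (TruncEq.refl _ _).add (TruncEq.X_mul (TruncEq.sum fun μ _ =>
    TruncEq.brk f (fun b => TruncEq.refl _ _) (fun b => (h b).lift _) a))

theorem fpTr_equation_iff (hf : IsStructureConst f) (A : PotOver d N G)
    (J u : Colour N → PowerSeries G) : K.fpTr f A u = J ↔
      ∀ a, -(∑ μ, K.D μ (K.D μ (u a))) + (0 : ℝ) • u a = K.fpTrRHS f A J u a := by
  have e : ∀ a, K.fpTr f A u a
      = -(∑ μ, K.D μ (K.D μ (u a))) - X * ∑ μ, bracket f (A μ) (K.Dv μ u) a := by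
    intro a
    simp only [fpTr, covD_eq K hf, Pi.neg_apply, Finset.sum_apply, Pi.add_apply, Pi.smul_apply,
      smul_eq_mul, Finset.sum_add_distrib, Finset.mul_sum, neg_add]
    rw [sub_eq_add_neg]
    rfl
  rw [funext_iff]
  refine forall_congr' fun a => ?_
  rw [e, fpTrRHS, zero_smul, add_zero, sub_eq_iff_eq_add]

/-- A general `A` is not transverse, so `-D∂` differs from `M(A)` and needs its own inverse. It
enters the formula for differences of the horizon function. -/
theorem IsGreen.isFPTrSolution (hL : K.IsGreen 0 L) (hf : IsStructureConst f)
    (A : PotOver d N G) (J : Colour N → PowerSeries G) :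
    K.IsFPTrSolution f A J (K.fpTrInv f A J) := by
  obtain ⟨u, hu, -⟩ := hL.existsUnique (isContraction_fpTrRHS (K := K) (f := f) A J)
  exact Classical.epsilon_spec (p := K.IsFPTrSolution f A J)
    ⟨u, hu.1, (fpTr_equation_iff hf A J u).2 hu.2⟩

theorem FunctionalClass.fpTrInv {NL : (PotOver d N G → PowerSeries G) → Prop}
    (h : K.FunctionalClass L NL) (hL : K.IsGreen 0 L) (hf : IsStructureConst f)
    {J : PotOver d N G → Colour N → PowerSeries G}
    (hJ : ∀ a, NL fun A => J A a) (a : Colour N) : NL fun A => K.fpTrInv f A (J A) a := by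
  refine h.of_boundaryValue hL (F := fun A => K.fpTrRHS f A (J A))
    (fun A => isContraction_fpTrRHS _ _) (fun u hu a => ?_) (fun A hA => ?_) a
  · exact h.add (hJ a) (h.X_mul (h.sum _ fun μ => h.bracket (fun b => h.comp μ b)
      (fun b => h.D μ (hu b)) a))
  · have hs := hL.isFPTrSolution hf A (J A)
    exact ⟨hs.1, (fpTr_equation_iff hf _ _ _).1 hs.2⟩

end

end Calculus

end GribovZwanziger

end

noncomputable section

namespace GribovZwanziger

namespace Calculus

open PowerSeries (coeff X)

section

variable {d N : ℕ} {G E : Type*} [Ring G] [Algebra ℝ G] [Ring E] [Algebra ℝ E]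
  {K : Calculus d G E} {f : Colour N → Colour N → Colour N → ℝ} {L : G →ₗ[ℝ] G}

/-! ### The variation of the horizon function -/

theorem fp_sub_fp (hf : IsStructureConst f) (A B : PotOver d N G) (v : Colour N → PowerSeries G) :
    K.fp f A v = K.fp f B v
      + (X : PowerSeries G) • ∑ ν, K.Dv ν (bracket f (B ν - A ν) v) := by
  simp only [fp_eq, covD_eq K hf, Dv_add, Dv_X_smul, bracket_sub_left, Dv_sub,
    Finset.sum_add_distrib, Finset.sum_sub_distrib, ← Finset.smul_sum, smul_sub]
  abel

/-- The difference of `J M⁻¹ J` for two potentials. -/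
theorem integ_pair_sub (hf : IsStructureConst f) {A B : PotOver d N G} (hA : K.EvenPot A)
    (hB : K.EvenPot B) {J J' v v' w : Colour N → PowerSeries G} (hJ : ∀ a, K.HasPar 1 (J a))
    (hJ' : ∀ a, K.HasPar 1 (J' a)) (hv : K.IsFPSolution f 0 A J v)
    (hv' : K.IsFPSolution f 0 B J' v') (hve : ∀ a, K.HasPar 1 (v' a))
    (hw : K.IsFPTrSolution f A J w) :
    K.integ (pair J' v') - K.integ (pair J v) = K.integ (pair (J' - J) (v' + w)
      - X * ∑ ν, pair (B ν - A ν) (bracket f v' (K.Dv ν w))) := by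
  have e1 : K.fp f A v = J := by
    funext a
    rw [← hv.2 a, zero_smul, add_zero]
  have e2 : K.fp f B v' = J' := by
    funext a
    rw [← hv'.2 a, zero_smul, add_zero]
  have h1 : K.integ (pair J v) = K.integ (pair w J) := by
    have h := integ_pair_fp hf hA hw.1 hv.1
    rw [e1, hw.2] at h
    exact h.symm
  -- The equation for `v'` at `B` is tested with the transposed solution `w` at `A`; the difference
  -- of the two operators produces the term with `B - A`.
  have h2 : K.integ (pair J v') = K.integ (pair w J')
      - K.integ (X * ∑ ν, pair (B ν - A ν) (bracket f v' (K.Dv ν w))) := by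
    have h := integ_pair_fp hf hA hw.1 hv'.1
    rw [hw.2] at h
    rw [← h, fp_sub_fp hf A B, e2, pair_add_right, map_add, pair_mul_right _ _ _ (fun a => X_comm _),
      integ_X_mul, integ_X_mul, pair_sum_right, map_sum, map_sum, sub_eq_add_neg, ← mul_neg,
      ← Finset.sum_neg_distrib]
    congr 2
    refine Finset.sum_congr rfl fun ν _ => ?_
    have hΔ : ∀ a, K.HasPar 1 ((B ν - A ν) a) := fun a => (hB ν a).sub (hA ν a)
    rw [integ_pair_Dv' ν hw.1, pair_comm fun a =>
      ((HasPar.even_bracket hΔ hve a).comm _).symm, pair_bracket_assoc hf]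
  have h3 : pair J' v' = pair (J' - J) v' + pair J v' := by
    rw [← pair_add_left, sub_add_cancel]
  have h4 : pair (J' - J) w = pair w J' - pair w J := by
    rw [pair_sub_left, pair_comm fun a => (hJ' a).comm _, pair_comm fun a => (hJ a).comm _]
  rw [h3, map_add, h1, h2, pair_add_right, h4, map_sub, map_add, map_sub]
  abel

variable (f) in
/-- The transposed colour matrix of the source. -/
def colourOp (c : Colour N) (x : Colour N → PowerSeries G) : Colour N → PowerSeries G :=
  fun e => ∑ a, f a e c • x a

theorem pair_source (A : PotOver d N G) (μ : Fin d) (c : Colour N) (x : Colour N → PowerSeries G) :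
    pair (source f A μ c) x = pair (A μ) (colourOp f c x) := by
  simp only [pair, source, colourOp, Finset.sum_mul, Finset.mul_sum, smul_mul_assoc, mul_smul_comm]
  exact Finset.sum_comm

theorem source_sub (A B : PotOver d N G) (μ : Fin d) (c : Colour N) :
    source f (B - A) μ c = source f B μ c - source f A μ c := by
  funext a
  simp only [source, Pi.sub_apply, smul_sub, Finset.sum_sub_distrib]

theorem hasPar_source {A : PotOver d N G} (hA : K.EvenPot A) (μ : Fin d) (c a : Colour N) :
    K.HasPar 1 (source f A μ c a) :=
  HasPar.sum fun e _ => (hA μ e).smul _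

variable (K f) in
/-- The functional derivative of the horizon function along `B - A`. -/
def horizonKernel (A B : PotOver d N G) (ν : Fin d) : Colour N → PowerSeries G :=
  (X ^ 2 : PowerSeries G) • (∑ c, colourOp f c (K.fpInv f 0 B (source f B ν c)
      + K.fpTrInv f A (source f A ν c))
    - (X : PowerSeries G) • ∑ μ, ∑ c, bracket f (K.fpInv f 0 B (source f B μ c))
      (K.Dv ν (K.fpTrInv f A (source f A μ c))))

theorem integ_X_pow_mul (k : ℕ) (u : PowerSeries G) :
    K.integ (X ^ k * u) = X ^ k * K.integ u := by
  induction k with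
  | zero => rw [pow_zero, pow_zero, one_mul, one_mul]
  | succ k ih => rw [pow_succ', mul_assoc, integ_X_mul, ih, pow_succ', mul_assoc]

theorem horizon_eq (A : PotOver d N G) : K.horizon f A
    = X ^ 2 * ∑ μ, ∑ c, K.integ (pair (source f A μ c) (K.fpInv f 0 A (source f A μ c))) := by
  rw [horizon]
  simp only [← Finset.mul_sum]
  rw [integ_X_pow_mul, map_sum]
  congr 1
  refine Finset.sum_congr rfl fun μ _ => ?_
  rw [map_sum]
  rfl

theorem X_pow_comm (k : ℕ) (u : PowerSeries G) : X ^ k * u = u * X ^ k := by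
  induction k with
  | zero => rw [pow_zero, one_mul, mul_one]
  | succ k ih => rw [pow_succ, mul_assoc, X_comm, ← mul_assoc, ih, mul_assoc]

/-- An exact difference formula in the manner of the resolvent identity, not a linearization: the
kernel depends on both potentials, and no smallness of `B - A` is needed. -/
theorem horizon_sub (hL : K.IsGreen 0 L) (hf : IsStructureConst f) {A B : PotOver d N G}
    (hA : K.EvenPot A) (hB : K.EvenPot B) :
    K.horizon f B - K.horizon f A
      = K.integ (∑ ν, pair (B ν - A ν) (K.horizonKernel f A B ν)) := by
  have e : ∀ μ c, K.integ (pair (source f B μ c) (K.fpInv f 0 B (source f B μ c)))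
      - K.integ (pair (source f A μ c) (K.fpInv f 0 A (source f A μ c)))
      = K.integ (pair (B μ - A μ) (colourOp f c (K.fpInv f 0 B (source f B μ c)
          + K.fpTrInv f A (source f A μ c)))
        - X * ∑ ν, pair (B ν - A ν) (bracket f (K.fpInv f 0 B (source f B μ c))
          (K.Dv ν (K.fpTrInv f A (source f A μ c))))) := by
    intro μ c
    rw [integ_pair_sub hf hA hB (hasPar_source hA μ c) (hasPar_source hB μ c)
      (hL.isFPSolution_fpInv hf _ _) (hL.isFPSolution_fpInv hf _ _)
      (hL.hasPar_fpInv hf hB (hasPar_source hB μ c)) (hL.isFPTrSolution hf _ _), ← source_sub,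
      pair_source]
    rfl
  have hX : ∀ (k : ℕ) (u v : Colour N → PowerSeries G),
      pair u ((X ^ k : PowerSeries G) • v) = X ^ k * pair u v :=
    fun k u v => pair_mul_right _ _ _ fun a => X_pow_comm k _
  have hX1 : ∀ (u v : Colour N → PowerSeries G),
      pair u ((X : PowerSeries G) • v) = X * pair u v :=
    fun u v => pair_mul_right _ _ _ fun a => X_comm _
  rw [horizon_eq, horizon_eq, ← mul_sub, ← Finset.sum_sub_distrib]
  simp only [← Finset.sum_sub_distrib, e, horizonKernel, hX, hX1, pair_sub_right, pair_sum_right]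
  rw [← Finset.mul_sum, integ_X_pow_mul]
  congr 1
  simp only [← map_sum, Finset.sum_sub_distrib, ← Finset.mul_sum]
  congr 3
  refine Eq.trans ?_ Finset.sum_comm
  exact Finset.sum_congr rfl fun μ _ => Finset.sum_comm

/-! ### The remainder of the horizon function -/

/-- Invariance of the pairing under power series in the adjoint action. -/
theorem pair_iterate_bracket (hf : IsStructureConst f) {ξ : Colour N → PowerSeries G}
    (hξ : ∀ a, K.HasPar 1 (ξ a)) (u w : Colour N → PowerSeries G) (k : ℕ) :
    pair ((bracket f ξ)^[k] u) w = pair u ((bracket f (-ξ))^[k] w) := by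
  induction k generalizing w with
  | zero => rfl
  | succ k ih =>
    rw [Function.iterate_succ_apply', pair_bracket_left hf w (fun b c => (hξ b).comm _),
      ← pair_neg_right, ← bracket_neg_left, ih, Function.iterate_succ_apply]

/-- `ad ξ` is antisymmetric for the invariant pairing, so a power series in it is transposed by `ξ ↦
-ξ`. Every coefficient involves finitely many terms, and truncations suffice. -/
theorem pair_adSum (hf : IsStructureConst f) {ξ : Colour N → PowerSeries G}
    (hξ : ∀ a, K.HasPar 1 (ξ a)) (p : ℕ → ℝ) (u w : Colour N → PowerSeries G) :
    pair (adSum f p ξ u) w = pair u (adSum f p (-ξ) w) := by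
  refine eq_of_truncEq fun m => ?_
  have h1 : ∀ (ξ u : Colour N → PowerSeries G) a, TruncEq m (adSum f p ξ u a)
      (∑ k ∈ Finset.range m, X ^ k * (p k • (bracket f ξ)^[k] u a)) :=
    fun ξ u a => gsum_truncEq _ m
  have e : (fun a => ∑ k ∈ Finset.range m, X ^ k * (p k • (bracket f ξ)^[k] u a))
      = ∑ k ∈ Finset.range m, (X ^ k : PowerSeries G) • p k • (bracket f ξ)^[k] u := by
    funext a
    rw [Finset.sum_apply]
    rfl
  have e' : (fun a => ∑ k ∈ Finset.range m, X ^ k * (p k • (bracket f (-ξ))^[k] w a))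
      = ∑ k ∈ Finset.range m, (X ^ k : PowerSeries G) • p k • (bracket f (-ξ))^[k] w := by
    funext a
    rw [Finset.sum_apply]
    rfl
  have h2 : pair (fun a => ∑ k ∈ Finset.range m, X ^ k * (p k • (bracket f ξ)^[k] u a)) w
      = pair u fun a => ∑ k ∈ Finset.range m, X ^ k * (p k • (bracket f (-ξ))^[k] w a) := by
    rw [e, e', pair_sum_left, pair_sum_right]
    refine Finset.sum_congr rfl fun k _ => ?_
    rw [pair_mul_left, pair_mul_right _ _ _ fun a => X_pow_comm k _, pair_smul_left,
      pair_smul_right, pair_iterate_bracket hf hξ]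
  refine TruncEq.trans (TruncEq.sum fun a _ => (h1 ξ u a).mul (TruncEq.refl _ _)) ?_
  refine TruncEq.trans ?_ (TruncEq.sum fun a _ => (TruncEq.refl _ _).mul (h1 (-ξ) w a)).symm
  intro k _
  exact congrArg (coeff k) h2

variable (K f) in
/-- The right-hand side of the boundary value problem for the remainder. -/
def remainderRHS (A : PotOver d N G) (ξ : Colour N → PowerSeries G) (κ : PotOver d N G)
    (r : Colour N → PowerSeries G) : Colour N → PowerSeries G :=
  fun a => -∑ ν, (K.D ν (κ ν a) - X * (K.D ν (adSum f (fun k => phiCoeff (k + 1)) (-ξ)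
      (bracket f (-ξ) (K.Dv ν r - κ ν)) a)
    + bracket f (A ν) (adSum f phiCoeff (-ξ) (K.Dv ν r - κ ν)) a))

theorem isContraction_remainderRHS (A : PotOver d N G) (ξ : Colour N → PowerSeries G)
    (κ : PotOver d N G) : IsContraction (K.remainderRHS f A ξ κ) := by
  intro m u v h a
  have hY : ∀ ν a, TruncEq m ((K.Dv ν u - κ ν) a) ((K.Dv ν v - κ ν) a) :=
    fun ν a => ((h a).lift _).sub (TruncEq.refl _ _)
  refine TruncEq.neg (TruncEq.sum fun ν _ => (TruncEq.refl _ _).sub (TruncEq.X_mul ?_))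
  exact (TruncEq.lift (TruncEq.adSum _ (fun _ => TruncEq.refl _ _)
    (TruncEq.brk f (fun _ => TruncEq.refl _ _) (hY ν)) a) _).add
    (TruncEq.brk f (fun _ => TruncEq.refl _ _)
      (TruncEq.adSum _ (fun _ => TruncEq.refl _ _) (hY ν)) a)

/-- Since `φ(-g ad ξ)` starts with the identity, the covariant divergence is `∂²r - ∂_ν κ_ν` plus
terms with a factor `g`. Its vanishing is thus a perturbative boundary value problem for `r`. -/
theorem remainder_equation (hf : IsStructureConst f) {A : PotOver d N G}
    {ξ : Colour N → PowerSeries G} {κ : PotOver d N G} {r : Colour N → PowerSeries G}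
    (h : ∀ a, -(∑ μ, K.D μ (K.D μ (r a))) + (0 : ℝ) • r a = K.remainderRHS f A ξ κ r a) :
    ∑ ν, K.covD f A ν (adSum f phiCoeff (-ξ) (K.Dv ν r - κ ν)) = 0 := by
  funext a
  have e : ∀ ν, K.covD f A ν (adSum f phiCoeff (-ξ) (K.Dv ν r - κ ν)) a
      = K.D ν (K.D ν (r a)) - (K.D ν (κ ν a) - X * (K.D ν (adSum f (fun k => phiCoeff (k + 1)) (-ξ)
      (bracket f (-ξ) (K.Dv ν r - κ ν)) a)
    + bracket f (A ν) (adSum f phiCoeff (-ξ) (K.Dv ν r - κ ν)) a)) := by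
    intro ν
    rw [covD_eq K hf]
    nth_rw 1 [adSum_phi]
    rw [Dv_add, Dv_sub, Dv_X_smul, mul_add]
    simp only [Pi.add_apply, Pi.sub_apply, Pi.smul_apply, smul_eq_mul, Dv]
    abel
  rw [Finset.sum_apply]
  simp only [e]
  rw [Finset.sum_sub_distrib]
  have h' := h a
  rw [remainderRHS, zero_smul, add_zero, neg_inj] at h'
  rw [h', sub_self, Pi.zero_apply]

/-- Transposing `φ(g ad ξ)` and integrating `D` by parts leaves `ξ` paired with a covariant
divergence that is zero. Only the boundary values of `ξ` are needed. -/
theorem integ_pair_remainder (hf : IsStructureConst f) {A : PotOver d N G} (hA : K.EvenPot A)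
    {ξ : Colour N → PowerSeries G} (hξ : ∀ a, K.HasPar 1 (ξ a)) (hξ' : ∀ a, K.Dir (ξ a))
    (Y : PotOver d N G) (h : ∑ ν, K.covD f A ν (adSum f phiCoeff (-ξ) (Y ν)) = 0) :
    K.integ (∑ ν, pair (adSum f phiCoeff ξ (K.covD f A ν ξ)) (Y ν)) = 0 := by
  have e : ∀ ν, K.integ (pair (adSum f phiCoeff ξ (K.covD f A ν ξ)) (Y ν))
      = -K.integ (pair (K.covD f A ν (adSum f phiCoeff (-ξ) (Y ν))) ξ) := by
    intro ν
    rw [pair_adSum hf hξ, pair_comm fun a => (HasPar.covD hA hξ ν a).comm _,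
      integ_pair_covD hf hA ν hξ']
  rw [map_sum]
  simp only [e]
  rw [Finset.sum_neg_distrib, ← map_sum, ← pair_sum_left, h]
  simp [pair]

variable (K f) in
/-- The remainder of the horizon function. -/
def remainder (A : PotOver d N G) : Colour N → PowerSeries G :=
  Classical.epsilon fun r => (∀ a, K.Dir (r a)) ∧
    ∀ a, -(∑ μ, K.D μ (K.D μ (r a))) + (0 : ℝ) • r a = K.remainderRHS f A
      (Classical.epsilon (K.IsDressing f A)) (K.horizonKernel f A (K.dressed f A)) r a

theorem IsGreen.remainder_spec (hL : K.IsGreen 0 L) (A : PotOver d N G) :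
    (∀ a, K.Dir (K.remainder f A a)) ∧
    ∀ a, -(∑ μ, K.D μ (K.D μ (K.remainder f A a))) + (0 : ℝ) • K.remainder f A a
      = K.remainderRHS f A (Classical.epsilon (K.IsDressing f A))
        (K.horizonKernel f A (K.dressed f A)) (K.remainder f A) a :=
  Classical.epsilon_spec (p := fun r => (∀ a, K.Dir (r a)) ∧
    ∀ a, -(∑ μ, K.D μ (K.D μ (r a))) + (0 : ℝ) • r a = K.remainderRHS f A
      (Classical.epsilon (K.IsDressing f A)) (K.horizonKernel f A (K.dressed f A)) r a)
    (hL.existsUnique (isContraction_remainderRHS A _ _)).exists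

/-- `H(A) = H(A^h) - ∫ R ∂A`. -/
theorem IsGreen.horizon_remainder (hL : K.IsGreen 0 L) (hf : IsStructureConst f)
    {A : PotOver d N G} (hA : K.EvenPot A) :
    K.horizon f A = K.horizon f (K.dressed f A)
      - K.integ (∑ a, K.remainder f A a * ∑ μ, K.D μ (A μ a)) := by
  have hξ := hL.isDressing_epsilon (f := f) hA
  have hB : K.EvenPot (K.dressed f A) := hL.hasPar_dressed hA
  have hR := hL.remainder_spec (f := f) A
  have hH := horizon_sub hL hf hA hB
  set B := K.dressed f A with hBdef
  set ξ := Classical.epsilon (K.IsDressing f A) with hξdef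
  set r := K.remainder f A
  set κ := K.horizonKernel f A B
  have hΔ : ∀ ν, B ν - A ν = -adSum f phiCoeff ξ (K.covD f A ν ξ) := by
    intro ν
    rw [hBdef, dressed, gaugeTransform_eq_sub hf hξ.1]
    abel
  -- Paired with `B - A`, the kernel may be replaced by the gradient of `r`; this is what `r` was
  -- chosen for.
  have h1 : K.integ (∑ ν, pair (B ν - A ν) (K.Dv ν r - κ ν)) = 0 := by
    have := integ_pair_remainder hf hA hξ.1 hξ.2.1 (fun ν => K.Dv ν r - κ ν)
      (remainder_equation hf hR.2)
    simp only [hΔ, pair_neg_left, Finset.sum_neg_distrib, map_neg]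
    rw [this, neg_zero]
  have h2 : K.integ (∑ a, r a * ∑ μ, K.D μ (A μ a))
      = K.integ (∑ ν, pair (B ν - A ν) (K.Dv ν r)) := by
    have e1 : ∑ a, r a * ∑ μ, K.D μ (A μ a) = ∑ ν, -pair r (K.Dv ν (B ν - A ν)) := by
      -- The dressed potential is transverse, so only `∂A` survives in the divergence of `B - A`.
      have hT : ∑ ν, K.Dv ν (B ν) = 0 := by
        funext a
        rw [Finset.sum_apply]
        exact hL.dressed_transverse hA a
      simp only [Dv_sub, pair_sub_right, neg_sub, Finset.sum_sub_distrib]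
      rw [← pair_sum_right, ← pair_sum_right, hT, pair_zero_right, sub_zero]
      refine Finset.sum_congr rfl fun a _ => ?_
      rw [Finset.sum_apply]
      rfl
    rw [e1, map_sum, map_sum]
    refine Finset.sum_congr rfl fun ν _ => ?_
    rw [map_neg, integ_pair_Dv' ν hR.1, neg_neg, pair_comm (u := K.Dv ν r) (v := B ν - A ν) fun a =>
      (((hB ν a).sub (hA ν a)).comm _).symm]
  simp only [pair_sub_right, Finset.sum_sub_distrib, map_sub] at h1
  rw [h2, sub_eq_zero.1 h1, ← hH]
  abel

/-- The kernel and the dressing belong to the class, and so does each iterate of the fixed point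
equation; `r` is their limit. -/
theorem FunctionalClass.remainder {NL : (PotOver d N G → PowerSeries G) → Prop}
    (h : K.FunctionalClass L NL) (hL : K.IsGreen 0 L) (hf : IsStructureConst f) (a : Colour N) :
    NL fun A => K.remainder f A a := by
  have hB : ∀ μ a, NL fun A => K.dressed f A μ a := h.dressed hL
  have hξ : ∀ a, NL fun A => Classical.epsilon (K.IsDressing f A) a := h.dressing hL
  have hξ' : ∀ a, NL fun A => (-Classical.epsilon (K.IsDressing f A)) a := fun a => h.neg (hξ a)
  have hv : ∀ μ c a, NL fun A =>
      K.fpInv f 0 (K.dressed f A) (Calculus.source f (K.dressed f A) μ c) a :=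
    fun μ c => h.fpInv hL hf hB (h.source hB μ c)
  have hw : ∀ μ c a, NL fun A => K.fpTrInv f A (Calculus.source f A μ c) a :=
    fun μ c => h.fpTrInv hL hf (h.source (fun μ a => h.comp μ a) μ c)
  have hκ : ∀ ν a, NL fun A => K.horizonKernel f A (K.dressed f A) ν a := by
    intro ν a
    simp only [horizonKernel, Pi.smul_apply, Pi.sub_apply, Finset.sum_apply, smul_eq_mul]
    refine h.X_pow_mul 2 (h.sub (h.sum _ fun c => h.sum _ fun b => h.smul _
      (h.add (hv ν c b) (hw ν c b))) (h.X_mul (h.sum _ fun μ => h.sum _ fun c => ?_)))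
    exact h.bracket (hv μ c) (fun b => h.D ν (hw μ c b)) a
  refine h.of_boundaryValue hL (F := fun A => K.remainderRHS f A
    (Classical.epsilon (K.IsDressing f A)) (K.horizonKernel f A (K.dressed f A)))
    (fun A => isContraction_remainderRHS _ _ _) (fun u hu a => ?_)
    (fun A _ => hL.remainder_spec A) a
  have hY : ∀ ν a, NL fun A => (K.Dv ν (u A) - K.horizonKernel f A (K.dressed f A) ν) a :=
    fun ν a => h.sub (h.D ν (hu a)) (hκ ν a)
  refine h.neg (h.sum _ fun ν => h.sub (h.D ν (hκ ν a)) (h.X_mul (h.add (h.D ν ?_) ?_)))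
  · exact h.adSum _ hξ' (h.bracket hξ' (hY ν)) a
  · exact h.bracket (fun b => h.comp ν b) (h.adSum _ hξ' (hY ν)) a

end

end Calculus

end GribovZwanziger

end

noncomputable section

namespace GribovZwanziger

namespace Calculus

open PowerSeries (coeff X)

section

variable {d N : ℕ} {G E : Type*} [Ring G] [Algebra ℝ G] [Ring E] [Algebra ℝ E]
  {K : Calculus d G E} {f : Colour N → Colour N → Colour N → ℝ}

/-! ### Variations of functionals of the potential -/

variable (K) in
/-- Even functionals of the potential which vary linearly under odd transformations. -/
def HasVariations (P : PotOver d N G → PowerSeries G) : Prop :=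
  ∀ A, K.EvenPot A → K.HasPar 1 (P A) ∧ ∀ B : PotOver d N G, (∀ μ a, K.HasPar (-1) (B μ a)) →
    ∃ Y, ∀ θ ∈ K.odd, P (fun μ => A μ + (PowerSeries.C θ : PowerSeries G) • B μ)
      = P A + PowerSeries.C θ * Y

theorem EvenPot.add_odd {A B : PotOver d N G} (hA : K.EvenPot A)
    (hB : ∀ μ a, K.HasPar (-1) (B μ a)) {θ : G} (hθ : θ ∈ K.odd) :
    K.EvenPot fun μ => A μ + (PowerSeries.C θ : PowerSeries G) • B μ :=
  fun μ a => (hA μ a).add ((hasPar_C hθ).odd_mul_odd (hB μ a))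

namespace HasVariations

theorem const {u : PowerSeries G} (hu : K.HasPar 1 u) :
    K.HasVariations fun _ : PotOver d N G => u :=
  fun _ _ => ⟨hu, fun _ _ => ⟨0, fun _ _ => by rw [mul_zero, add_zero]⟩⟩

theorem comp (μ : Fin d) (a : Colour N) : K.HasVariations fun A : PotOver d N G => A μ a :=
  fun _ hA => ⟨hA μ a, fun B _ => ⟨B μ a, fun _ _ => rfl⟩⟩

theorem add {P Q : PotOver d N G → PowerSeries G} (hP : K.HasVariations P)
    (hQ : K.HasVariations Q) : K.HasVariations fun A => P A + Q A := by
  refine fun A hA => ⟨(hP A hA).1.add (hQ A hA).1, fun B hB => ?_⟩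
  obtain ⟨Y, hY⟩ := (hP A hA).2 B hB
  obtain ⟨Z, hZ⟩ := (hQ A hA).2 B hB
  refine ⟨Y + Z, fun θ hθ => ?_⟩
  beta_reduce
  rw [hY θ hθ, hZ θ hθ, mul_add]
  abel

theorem mul {P Q : PotOver d N G → PowerSeries G} (hP : K.HasVariations P)
    (hQ : K.HasVariations Q) : K.HasVariations fun A => P A * Q A := by
  refine fun A hA => ⟨(hP A hA).1.even_mul (hQ A hA).1, fun B hB => ?_⟩
  obtain ⟨Y, hY⟩ := (hP A hA).2 B hB
  obtain ⟨Z, hZ⟩ := (hQ A hA).2 B hB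
  refine ⟨Y * Q A + P A * Z, fun θ hθ => ?_⟩
  beta_reduce
  -- The product of the two variations contains `θ` twice and drops out; `P A` is even and commutes
  -- with `θ`.
  rw [hY θ hθ, hZ θ hθ, add_mul, mul_add, mul_add, C_mul_mul_C_mul hθ, ← mul_assoc (P A),
    (hP A hA).1.comm (PowerSeries.C θ), mul_add, mul_assoc, mul_assoc]
  abel

theorem lift {L : G →ₗ[ℝ] G} (hσ : ∀ x, K.σ (L x) = L (K.σ x))
    (hL : ∀ θ ∈ K.odd, ∀ x, L (θ * x) = θ * L x) {P : PotOver d N G → PowerSeries G}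
    (hP : K.HasVariations P) : K.HasVariations fun A => GribovZwanziger.lift L (P A) := by
  refine fun A hA => ⟨(hP A hA).1.lift hσ, fun B hB => ?_⟩
  obtain ⟨Y, hY⟩ := (hP A hA).2 B hB
  refine ⟨GribovZwanziger.lift L Y, fun θ hθ => ?_⟩
  beta_reduce
  rw [hY θ hθ, map_add]
  congr 1
  ext n
  rw [coeff_lift, coeff_C_mul', coeff_C_mul', coeff_lift, hL θ hθ]

/-- The `n`-th coefficient of the variation is taken from the `n`-th approximant. The approximation
also applies at the varied potential, which is again even. -/
theorem limit {P : PotOver d N G → PowerSeries G}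
    (h : ∀ n, ∃ P' : PotOver d N G → PowerSeries G, K.HasVariations P' ∧
      ∀ A, K.EvenPot A → ∀ k ≤ n, coeff k (P A) = coeff k (P' A)) : K.HasVariations P := by
  choose P' hP' h using h
  refine fun A hA => ⟨hasPar_of_truncEq fun m => ⟨P' m A, (hP' m A hA).1,
    fun k hk => h m A hA k hk.le⟩, fun B hB => ?_⟩
  choose Y hY using fun n => (hP' n A hA).2 B hB
  refine ⟨PowerSeries.mk fun n => coeff n (Y n), fun θ hθ => ?_⟩
  ext n
  rw [h n _ (hA.add_odd hB hθ) n le_rfl, hY n θ hθ, map_add, map_add, coeff_C_mul', coeff_C_mul',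
    PowerSeries.coeff_mk, h n A hA n le_rfl]

end HasVariations

open Classical in
/-- Functionals with variations have a BRST variation. -/
theorem exists_isVariation {R : PotOver d N G → Colour N → PowerSeries G}
    (hR : ∀ a, K.HasVariations fun A => R A a) : ∃ sR, K.IsVariation f R sR := by
  have h : ∀ Φ : FieldsOver d N G, K.IsConfig Φ → ∀ a, ∃ Y, ∀ θ ∈ K.odd,
      R (pot (flow (K.brst f) θ Φ)) a = R (pot Φ) a + PowerSeries.C θ * Y := by
    intro Φ hΦ a
    obtain ⟨Y, hY⟩ := (hR a (pot Φ) hΦ.pot).2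
      (fun μ => -K.covD f (pot Φ) μ (ghost Φ)) hΦ.covD_ghost
    refine ⟨Y, fun θ hθ => ?_⟩
    rw [pot_flow isGaugeBRST_brst]
    exact hY θ hθ
  choose Y hY using h
  -- Away from configurations the value of `sR` is never tested and is set to zero.
  exact ⟨fun Φ => if hΦ : K.IsConfig Φ then Y Φ hΦ else 0, fun A hA a => (hR a A hA).1,
    fun Φ hΦ θ hθ a => by rw [dif_pos hΦ]; exact hY Φ hΦ a θ hθ⟩

end

end Calculus

end GribovZwanziger

end

/-! ### Grassmann-valued functions as a calculus -/

noncomputable section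

namespace GribovZwanziger

section

variable {F E : Type*} [CommRing F] [Algebra ℝ F] [Ring E] [Algebra ℝ E]

/-- The integral of `E`-valued functions. -/
def tensorInt (I : F →ₗ[ℝ] ℝ) : F ⊗[ℝ] E →ₗ[ℝ] E :=
  (TensorProduct.lid ℝ E).toLinearMap ∘ₗ I.rTensor E

theorem tensorInt_eq_zero {D : Submodule ℝ F} {I : F →ₗ[ℝ] ℝ} {L : F →ₗ[ℝ] F}
    (h : ∀ f ∈ D, I (L f) = 0) {u : F ⊗[ℝ] E}
    (hu : u ∈ LinearMap.range (D.subtype.rTensor E)) :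
    tensorInt I (L.rTensor E u) = 0 := by
  rw [tensorInt, LinearMap.comp_apply, ← LinearMap.comp_apply (I.rTensor E),
    ← LinearMap.rTensor_comp, rTensor_eq_of_mem_range (L' := 0) (fun f hf => h f hf) hu]
  simp

theorem rTensor_green_right {ι : Type*} [Fintype ι] {κ : ℝ} {L : F →ₗ[ℝ] F} {D : ι → F →ₗ[ℝ] F}
    (h : ∀ f, -(∑ μ, D μ (D μ (L f))) + κ • L f = f) (u : F ⊗[ℝ] E) :
    -(∑ μ, (D μ).rTensor E ((D μ).rTensor E (L.rTensor E u))) + κ • L.rTensor E u = u := by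
  induction u using TensorProduct.induction_on with
  | zero => simp
  | tmul f x =>
    have e := congrArg (fun u => u ⊗ₜ[ℝ] x) (h f)
    simp only [LinearMap.rTensor_tmul]
    rw [← TensorProduct.sum_tmul, ← TensorProduct.neg_tmul, TensorProduct.smul_tmul',
      ← TensorProduct.add_tmul]
    exact e
  | add a b ha hb =>
    refine Eq.trans ?_ (congrArg₂ (· + ·) ha hb)
    simp only [map_add, Finset.sum_add_distrib, smul_add]
    abel

theorem rTensor_green_left {ι : Type*} [Fintype ι] {κ : ℝ} {V : Submodule ℝ F} {L : F →ₗ[ℝ] F}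
    {D : ι → F →ₗ[ℝ] F} (h : ∀ f ∈ V, L (-(∑ μ, D μ (D μ f)) + κ • f) = f) {u : F ⊗[ℝ] E}
    (hu : u ∈ LinearMap.range (V.subtype.rTensor E)) :
    L.rTensor E (-(∑ μ, (D μ).rTensor E ((D μ).rTensor E u)) + κ • u) = u := by
  obtain ⟨w, rfl⟩ := hu
  induction w using TensorProduct.induction_on with
  | zero => simp
  | tmul f x =>
    have e := congrArg (fun u => u ⊗ₜ[ℝ] x) (h f f.2)
    simp only [LinearMap.rTensor_tmul, Submodule.coe_subtype] at e ⊢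
    rw [← TensorProduct.sum_tmul, ← TensorProduct.neg_tmul, TensorProduct.smul_tmul',
      ← TensorProduct.add_tmul, LinearMap.rTensor_tmul]
    exact e
  | add a b ha hb =>
    refine Eq.trans ?_ ((congrArg₂ (· + ·) ha hb).trans (map_add _ _ _).symm)
    simp only [map_add, Finset.sum_add_distrib, smul_add, neg_add]
    abel

end

variable {d N : ℕ} (Ω : Region d)

/-! ### The calculus of Grassmann-valued functions -/

theorem mem_grade_zero_iff {u : GFun Ω} :
    u ∈ (grade 0).baseChange (smoothFun Ω) ↔ tensorPar (smoothFun Ω) gpar u = (1 : ℝ) • u :=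
  mem_baseChange_iff 1 one_ne_zero exists_grade_add
    (fun x hx => by rw [one_smul]; exact gpar_of_mem_zero hx)
    (fun x hx => by rw [neg_one_smul]; exact gpar_of_mem_one hx)

theorem mem_grade_one_iff {u : GFun Ω} :
    u ∈ (grade 1).baseChange (smoothFun Ω) ↔ tensorPar (smoothFun Ω) gpar u = (-1 : ℝ) • u :=
  mem_baseChange_iff (-1) (by norm_num)
    (fun x => by
      obtain ⟨y, hy, z, hz, h⟩ := exists_grade_add x
      exact ⟨z, hz, y, hy, h.trans (add_comm _ _)⟩)
    (fun x hx => by rw [neg_one_smul]; exact gpar_of_mem_one hx)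
    (fun x hx => by rw [neg_neg, one_smul]; exact gpar_of_mem_zero hx)

theorem dirichlet_rTensor_mul {u : GFun Ω}
    (hu : u ∈ LinearMap.range ((dirichlet Ω).subtype.rTensor Grassmann)) (v : GFun Ω) :
    v * u ∈ LinearMap.range ((dirichlet Ω).subtype.rTensor Grassmann) ∧
      u * v ∈ LinearMap.range ((dirichlet Ω).subtype.rTensor Grassmann) := by
  have h := fun (f : smoothFun Ω) (hf : f ∈ dirichlet Ω) (k : smoothFun Ω) =>
    mul_mem_dirichlet hf k
  exact rTensor_mul_mem (F := smoothFun Ω) (E := Grassmann) (D := dirichlet Ω) h v hu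

/-- The calculus of Grassmann-valued smooth functions on a region. -/
def calculus : Calculus d (GFun Ω) Grassmann where
  pd μ := (pdFun Ω μ).rTensor Grassmann
  leibniz μ := rTensor_leibniz (pdFun_mul μ)
  pd_comm μ ν x := by
    rw [← LinearMap.comp_apply, ← LinearMap.rTensor_comp, ← LinearMap.comp_apply,
      ← LinearMap.rTensor_comp]
    congr 2
    ext1 u
    exact pdFun_comm μ ν u
  σ := tensorPar (smoothFun Ω) gpar
  σ_pd μ := tensorPar_rTensor gpar _
  even_comm x y h := by
    have h1 : x ∈ (grade 0).baseChange (smoothFun Ω) := by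
      rw [mem_grade_zero_iff]
      exact h.trans (one_smul ℝ x).symm
    -- For even elements the sign rule holds with the identity in place of the parity automorphism.
    refine (tensor_mul_comm (τ := AlgHom.id ℝ _) (fun x hx y =>
      mul_comm_of_gpar_eq (gpar_of_mem_zero hx) y) h1 y).trans ?_
    congr 1
    induction y using TensorProduct.induction_on with
    | zero => simp
    | tmul f x => rfl
    | add a b ha hb => rw [map_add, ha, hb]
  odd_comm x y h := by
    have h1 : x ∈ (grade 1).baseChange (smoothFun Ω) := by
      rw [mem_grade_one_iff]
      exact h.trans (neg_one_smul ℝ x).symm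
    exact tensor_mul_comm (fun x hx y => mul_comm_of_gpar_eq_neg (gpar_of_mem_one hx) y) h1 y
  odd := {x | ∃ θ ∈ grade 1, x = (1 : smoothFun Ω) ⊗ₜ[ℝ] θ}
  odd_add := by
    rintro _ ⟨θ, hθ, rfl⟩ _ ⟨θ', hθ', rfl⟩
    exact ⟨θ + θ', Submodule.add_mem _ hθ hθ', (TensorProduct.tmul_add _ _ _).symm⟩
  σ_odd := by
    rintro _ ⟨θ, hθ, rfl⟩
    rw [tensorPar_tmul, gpar_of_mem_one hθ, TensorProduct.tmul_neg]
  odd_sq := by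
    rintro _ ⟨θ, hθ, rfl⟩
    rw [Algebra.TensorProduct.tmul_mul_tmul, mul_self_of_mem_one hθ, TensorProduct.tmul_zero]
  pd_odd_mul := by
    rintro μ _ ⟨θ, hθ, rfl⟩ x
    exact rTensor_one_tmul_mul _ _ _
  odd_sep x h := eq_zero_of_one_tmul_mul (grade 1 : Set Grassmann)
    (fun m => ExteriorAlgebra.ι ℝ (Finsupp.single m 1)) (fun m => ι_mem_grade_one _) contr
    exists_contr_eq_zero (fun m x => by rw [contr_ι_mul]; simp)
    fun θ hθ => h _ ⟨θ, hθ, rfl⟩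
  dir := LinearMap.range ((dirichlet Ω).subtype.rTensor Grassmann)
  mul_dir x hx y := (dirichlet_rTensor_mul Ω hx y).1
  dir_mul x hx y := (dirichlet_rTensor_mul Ω hx y).2
  int := tensorInt (intFun Ω)
  int_pd μ x hx := by
    have h := fun (f : smoothFun Ω) (hf : f ∈ dirichlet Ω) => intFun_pdFun μ hf
    exact tensorInt_eq_zero (F := smoothFun Ω) (E := Grassmann) (D := dirichlet Ω)
      (I := intFun Ω) (L := pdFun Ω μ) h hx

/-- The Green operator of Grassmann-valued functions. -/
theorem isGreen {Ω : Region d} {κ : ℝ} (h : Ω.DirichletSolvable κ) :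
    (calculus Ω).IsGreen κ ((greenFun h).rTensor Grassmann) where
  mem x := rTensor_mem_range (greenFun_mem h) x
  right x := rTensor_green_right (greenFun_spec h) x
  left x hx := rTensor_green_left (fun f hf => greenFun_left h hf) hx
  σ x := tensorPar_rTensor gpar _ x

end GribovZwanziger

end

/-! ### Dictionary between the concrete definitions and the calculus -/

noncomputable section

namespace GribovZwanziger

variable {d N : ℕ} (T : SUGenerators N) {Ω : Region d}

theorem hasParity_zero_iff (u : Ser Ω) : HasParity 0 u ↔ (calculus Ω).HasPar 1 u := by
  rw [Calculus.HasPar, PowerSeries.ext_iff]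
  exact forall_congr' fun n => mem_grade_zero_iff Ω

theorem hasParity_one_iff (u : Ser Ω) : HasParity 1 u ↔ (calculus Ω).HasPar (-1) u := by
  rw [Calculus.HasPar, PowerSeries.ext_iff]
  exact forall_congr' fun n => mem_grade_one_iff Ω

theorem isDressing_iff (A : Potential Ω N) (ξ : Colour N → Ser Ω) :
    IsDressing T A ξ ↔ (calculus Ω).IsDressing T.f A ξ :=
  and_congr (forall_congr' fun a => hasParity_zero_iff (ξ a)) Iff.rfl

/-- Both sides apply a choice operator to a predicate, so the equivalence of the predicates has to
be upgraded to an equality before the choices coincide. -/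
theorem Ah_eq (A : Potential Ω N) : Ah T A = (calculus Ω).dressed T.f A := by
  rw [Ah, funext fun ξ => propext (isDressing_iff T A ξ)]
  rfl

theorem horizon_eq (A : Potential Ω N) : horizon T A = (calculus Ω).horizon T.f A := rfl

theorem isConfig_iff (Φ : Fields Ω N) : IsConfig Φ ↔ (calculus Ω).IsConfig Φ := by
  refine forall_congr' fun i => and_congr ?_ Iff.rfl
  cases i with
  | A μ a => exact hasParity_zero_iff _
  | c a => exact hasParity_one_iff _
  | cbar a => exact hasParity_one_iff _
  | b a => exact hasParity_zero_iff _
  | phi μ a b => exact hasParity_zero_iff _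
  | phibar μ a b => exact hasParity_zero_iff _
  | om μ a b => exact hasParity_one_iff _
  | ombar μ a b => exact hasParity_one_iff _

theorem brst_eq : brst (Ω := Ω) T = (calculus Ω).brst T.f := by
  funext Φ i
  cases i <;> rfl

theorem omShift_eq (G κ : ℝ) (A : Potential Ω N) :
    omShift T G κ A = (calculus Ω).omShift T.f G κ A := by
  funext μ a b
  rw [omShift, Calculus.omShift, Ah_eq]
  rfl

theorem sGamma_eq (G κ : ℝ) : sGamma (Ω := Ω) T G κ = (calculus Ω).sGamma T.f G κ := by
  funext Φ i
  cases i
  case ombar μ a b => exact congrArg (Φ (.phibar μ a b) + ·) (congrFun₃ (omShift_eq T G κ _) μ a b)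
  all_goals rfl

theorem sBh_eq (G : ℝ) (R : Potential Ω N → Colour N → Ser Ω)
    (sR : Fields Ω N → Colour N → Ser Ω) : sBh T G R sR = (calculus Ω).sBh T.f G R sR := by
  funext Φ i
  cases i <;> rfl

theorem toBh_eq (G : ℝ) (R : Potential Ω N → Colour N → Ser Ω) :
    toBh G R = Calculus.toBh G R := by
  funext Φ i
  cases i <;> rfl

theorem deltaGamma_eq (G κ : ℝ) (R : Potential Ω N → Colour N → Ser Ω)
    (sR : Fields Ω N → Colour N → Ser Ω) :
    deltaGamma T G κ R sR = (calculus Ω).deltaGamma T.f G κ R sR := by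
  funext Φ i
  cases i
  case ombar μ a b => exact congrFun₃ (omShift_eq T G κ _) μ a b
  all_goals rfl

theorem actionYM_eq : actionYM (Ω := Ω) T = (calculus Ω).actionYM T.f := rfl

theorem actionLandau_eq : actionLandau (Ω := Ω) T = (calculus Ω).actionLandau T.f := rfl

theorem actionAlpha_eq (α : ℝ) :
    actionAlpha (Ω := Ω) (N := N) α = (calculus Ω).actionAlpha α := rfl

theorem actionGhostInt_eq (α : ℝ) :
    actionGhostInt (Ω := Ω) T α = (calculus Ω).actionGhostInt T.f α := rfl

theorem actionLoc_eq (G : ℝ) : actionLoc (Ω := Ω) T G = (calculus Ω).actionLoc T.f G := by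
  funext Φ
  rw [actionLoc, Calculus.actionLoc, Ah_eq]
  rfl

theorem actionRef_eq (m2 κ : ℝ) :
    actionRef (Ω := Ω) T m2 κ = (calculus Ω).actionRef T.f m2 κ := by
  funext Φ
  rw [actionRef, Calculus.actionRef, Ah_eq]
  rfl

end GribovZwanziger

end

noncomputable section

namespace GribovZwanziger

variable {d N : ℕ} (T : SUGenerators N) {Ω : Region d}

/-! ### Non-local functionals -/

theorem isPotential_iff (A : Potential Ω N) : IsPotential A ↔ (calculus Ω).EvenPot A :=
  forall_congr' fun μ => forall_congr' fun a => hasParity_zero_iff (A μ a)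

/-- A constant series as a field. -/
def constSer (Ω : Region d) (u : PowerSeries (smoothFun Ω)) : Ser Ω :=
  PowerSeries.map (Algebra.TensorProduct.includeLeft (R := ℝ) (S := ℝ)
    (A := smoothFun Ω) (B := Grassmann)).toRingHom u

theorem coeff_constSer (u : PowerSeries (smoothFun Ω)) (n : ℕ) :
    PowerSeries.coeff n (constSer Ω u) = PowerSeries.coeff n u ⊗ₜ[ℝ] (1 : Grassmann) :=
  PowerSeries.coeff_map _ _ _

theorem constSer_X : constSer Ω PowerSeries.X = (PowerSeries.X : Ser Ω) := PowerSeries.map_X _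

theorem constSer_zero : constSer Ω 0 = (0 : Ser Ω) := map_zero _

theorem hasPar_constSer (u : PowerSeries (smoothFun Ω)) :
    (calculus Ω).HasPar 1 (constSer Ω u) := by
  rw [← hasParity_zero_iff]
  intro n
  rw [mem_grade_zero_iff, coeff_constSer, tensorPar_tmul, map_one]
  exact (one_smul ℝ _).symm

/-- Real multiples are not among the generating operations of non-local polynomials; they are
obtained as the linear operator `r • id`. -/
theorem op_smul_id (r : ℝ) (u : Ser Ω) : op (r • LinearMap.id) u = r • u := by
  refine PowerSeries.ext fun n => ?_
  have h : ∀ x : GFun Ω, (r • LinearMap.id : smoothFun Ω →ₗ[ℝ] smoothFun Ω).rTensor Grassmann x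
      = r • x := by
    intro x
    rw [LinearMap.rTensor_smul, LinearMap.rTensor_id]
    rfl
  exact (PowerSeries.coeff_mk _ _).trans (h _)

/-- A linear operator acts on the function factor alone, so it preserves parity and commutes with
constant Grassmann numbers. -/
theorem IsNonlocalPoly.hasVariations {P : Potential Ω N → Ser Ω} (hP : IsNonlocalPoly P) :
    (calculus Ω).HasVariations P := by
  induction hP with
  | const u => exact Calculus.HasVariations.const (hasPar_constSer u)
  | comp μ a => exact Calculus.HasVariations.comp μ a
  | add _ _ hP hQ => exact hP.add hQ
  | mul _ _ hP hQ => exact hP.mul hQ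
  | linear L _ hP =>
    refine hP.lift (L := L.rTensor Grassmann) (tensorPar_rTensor gpar L) ?_
    rintro _ ⟨θ, -, rfl⟩ x
    exact rTensor_one_tmul_mul L θ x

theorem IsNonlocalSeries.hasVariations {P : Potential Ω N → Ser Ω} (hP : IsNonlocalSeries P) :
    (calculus Ω).HasVariations P := by
  refine Calculus.HasVariations.limit fun n => ?_
  obtain ⟨P', hP', h⟩ := hP n
  exact ⟨P', hP'.hasVariations, fun A hA => h A ((isPotential_iff A).2 hA)⟩

theorem IsNonlocalPoly.isNonlocalSeries {P : Potential Ω N → Ser Ω} (hP : IsNonlocalPoly P) :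
    IsNonlocalSeries P := fun _ => ⟨P, hP, fun _ _ _ _ => rfl⟩

theorem isNonlocalSeries_iff {P : Potential Ω N → Ser Ω} : IsNonlocalSeries P ↔
    ∀ m, ∃ P' : Potential Ω N → Ser Ω, IsNonlocalPoly P' ∧
      ∀ A, (calculus Ω).EvenPot A → TruncEq m (P A) (P' A) := by
  constructor
  · intro h m
    obtain ⟨P', hP', h⟩ := h m
    exact ⟨P', hP', fun A hA k hk => h A ((isPotential_iff A).2 hA) k hk.le⟩
  · intro h n
    obtain ⟨P', hP', h⟩ := h (n + 1)
    exact ⟨P', hP', fun A hA k hk => h A ((isPotential_iff A).1 hA) k (Nat.lt_succ_of_le hk)⟩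

theorem IsNonlocalSeries.mul {P Q : Potential Ω N → Ser Ω} (hP : IsNonlocalSeries P)
    (hQ : IsNonlocalSeries Q) : IsNonlocalSeries fun A => P A * Q A := by
  rw [isNonlocalSeries_iff] at hP hQ ⊢
  intro m
  obtain ⟨P', hP', h⟩ := hP m
  obtain ⟨Q', hQ', h'⟩ := hQ m
  exact ⟨_, hP'.mul hQ', fun A hA => (h A hA).mul (h' A hA)⟩

theorem IsNonlocalSeries.op (L : smoothFun Ω →ₗ[ℝ] smoothFun Ω) {P : Potential Ω N → Ser Ω}
    (hP : IsNonlocalSeries P) : IsNonlocalSeries fun A => op L (P A) := by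
  rw [isNonlocalSeries_iff] at hP ⊢
  intro m
  obtain ⟨P', hP', h⟩ := hP m
  exact ⟨_, hP'.linear L, fun A hA => (h A hA).lift (L.rTensor Grassmann)⟩

/-- Non-local series are closed under the operations of perturbation theory. -/
theorem functionalClass (L : smoothFun Ω →ₗ[ℝ] smoothFun Ω) :
    (calculus Ω).FunctionalClass (N := N) (L.rTensor Grassmann) IsNonlocalSeries where
  zero := by
    have h := (IsNonlocalPoly.const (Ω := Ω) (N := N) 0).isNonlocalSeries
    rwa [show (fun _ : Potential Ω N => (0 : Ser Ω)) = _ from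
      funext fun _ => constSer_zero.symm]
  comp μ a := (IsNonlocalPoly.comp μ a).isNonlocalSeries
  add {P Q} hP hQ := by
    rw [isNonlocalSeries_iff] at hP hQ ⊢
    intro m
    obtain ⟨P', hP', h⟩ := hP m
    obtain ⟨Q', hQ', h'⟩ := hQ m
    exact ⟨_, hP'.add hQ', fun A hA => (h A hA).add (h' A hA)⟩
  mul hP hQ := hP.mul hQ
  X_mul {P} hP := by
    have h := (IsNonlocalPoly.const (Ω := Ω) (N := N) PowerSeries.X).isNonlocalSeries.mul hP
    rwa [show (fun A => PowerSeries.X * P A) = _ from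
      funext fun A => congrArg (· * P A) constSer_X.symm]
  smul r {P} hP := by
    rw [show (fun A => r • P A) = _ from funext fun A => (op_smul_id r (P A)).symm]
    exact hP.op _
  D μ _ hP := hP.op (pdFun Ω μ)
  lift hP := hP.op L
  limit {P} hP := by
    rw [isNonlocalSeries_iff]
    intro m
    obtain ⟨P', hP', h⟩ := hP m
    obtain ⟨P'', hP'', h'⟩ := isNonlocalSeries_iff.1 hP' m
    exact ⟨P'', hP'', fun A hA => (h A hA).trans (h' A hA)⟩

/-! ### Vector fields and actions -/

theorem mem_odd {θ : Grassmann} (hθ : θ ∈ grade 1) :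
    (1 : smoothFun Ω) ⊗ₜ[ℝ] θ ∈ (calculus Ω).odd := ⟨θ, hθ, rfl⟩

theorem hasParity_add_one_iff (i : Comp d N) (u : Ser Ω) :
    HasParity (i.parity + 1) u ↔ (calculus Ω).HasPar (-i.sign) u := by
  cases i
  all_goals
    simp only [Comp.parity, Comp.sign, neg_neg, zero_add]
    first
    | exact hasParity_one_iff u
    | exact hasParity_zero_iff u

theorem isOddVectorField_of {Q : Fields Ω N → Fields Ω N} (hQ : (calculus Ω).IsOddField Q) :
    IsOddVectorField Q := by
  refine ⟨fun Φ hΦ i => ?_, fun Φ hΦ θ hθ => ?_⟩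
  · have h := hQ Φ ((isConfig_iff Φ).1 hΦ) i
    exact ⟨(hasParity_add_one_iff i _).2 h.1, h.2⟩
  · exact (isConfig_iff _).2 (hQ.isConfig_flow ((isConfig_iff Φ).1 hΦ) (mem_odd hθ))

theorem acts_zero_of {ι : Type} {Q : Fields Ω N → Fields Ω N} {Y : Fields Ω N → ι → Ser Ω}
    (h : ∀ Φ, (calculus Ω).IsConfig Φ → ∀ θ ∈ (calculus Ω).odd,
      Y (Calculus.flow Q θ Φ) = Y Φ) : Acts Q Y 0 := by
  intro Φ hΦ θ hθ
  refine (h Φ ((isConfig_iff Φ).1 hΦ) _ (mem_odd hθ)).trans ?_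
  funext i
  exact ((congrArg (Y Φ i + ·) (mul_zero (cst Ω θ))).trans (add_zero _)).symm

theorem actsInt_zero_of {Q : Fields Ω N → Fields Ω N} {S : Fields Ω N → Num}
    (h : ∀ Φ, (calculus Ω).IsConfig Φ → ∀ θ ∈ (calculus Ω).odd,
      S (Calculus.flow Q θ Φ) = S Φ) : ActsInt Q S 0 := by
  intro Φ hΦ θ hθ
  rw [Pi.zero_apply, mul_zero, add_zero]
  exact h Φ ((isConfig_iff Φ).1 hΦ) _ (mem_odd hθ)

theorem isHorizonRemainder_remainder (hΩ : Ω.DirichletSolvable 0) :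
    IsHorizonRemainder T ((calculus Ω).remainder T.f) := by
  refine ⟨(functionalClass (greenFun hΩ)).remainder (isGreen hΩ) T.isStructureConst,
    fun A hA => ?_⟩
  rw [horizon_eq, horizon_eq, Ah_eq]
  exact (isGreen hΩ).horizon_remainder T.isStructureConst ((isPotential_iff A).1 hA)

/-- Non-locality of `R` supplies the evenness required of an `IsVariation`. -/
theorem isVariation_iff {R : Potential Ω N → Colour N → Ser Ω}
    {sR : Fields Ω N → Colour N → Ser Ω} (hR : ∀ a, IsNonlocalSeries fun A => R A a) :
    Acts (brst T) (fun Φ => R (pot Φ)) sR ↔ (calculus Ω).IsVariation T.f R sR := by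
  constructor
  · refine fun h => ⟨fun A hA a => ((hR a).hasVariations A hA).1, ?_⟩
    rintro Φ hΦ _ ⟨θ, hθ, rfl⟩ a
    have := congrFun (h Φ ((isConfig_iff Φ).2 hΦ) θ hθ) a
    rw [brst_eq] at this
    exact this
  · intro h Φ hΦ θ hθ
    funext a
    rw [brst_eq]
    exact h.acts Φ ((isConfig_iff Φ).1 hΦ) _ (mem_odd hθ) a

end GribovZwanziger

end

/-! ### The main theorem -/

open GribovZwanziger
theorem mainTheorem3 {d N : ℕ} (T : SUGenerators N) (Ω : Region d)
    (hΩ : Ω.DirichletSolvable 0) (κ : ℝ) (hκ : Ω.DirichletSolvable κ) :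
    -- the field `A^h` and the inverse of the Faddeev-Popov operator are well defined
    (∀ A : Potential Ω N, IsPotential A → ∃! ξ, IsDressing T A ξ) ∧
    (∀ A : Potential Ω N, IsPotential A → ∀ J, ∃! u, IsFPSolution T 0 A J u) ∧
    (∀ A : Potential Ω N, IsPotential A → ∀ J, ∃! u, IsFPSolution T κ A J u) ∧
    -- invariance of the actions
    (∀ G : ℝ, ActsInt (sGamma T G 0) (actionGZ (Ω := Ω) T G) 0) ∧
    (∀ G α : ℝ, ActsInt (sGamma T G 0) (actionGZ_LCG (Ω := Ω) T G α) 0) ∧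
    (∀ G α : ℝ, ActsInt (sGamma T G 0) (actionGZ_CF (Ω := Ω) T G α) 0) ∧
    (∀ G α m2 : ℝ, ActsInt (sGamma T G κ) (actionRGZ_LCG (Ω := Ω) T G α m2 κ) 0) ∧
    (∀ G α m2 : ℝ, ActsInt (sGamma T G κ) (actionRGZ_CF (Ω := Ω) T G α m2 κ) 0) ∧
    -- nilpotency of the non-perturbative BRST operator
    (∀ G : ℝ, ∀ κ' ∈ ({0, κ} : Set ℝ), IsOddVectorField (Ω := Ω) (sGamma T G κ') ∧
      Acts (Ω := Ω) (sGamma T G κ') (sGamma T G κ') 0) ∧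
    -- its limit as the Gribov parameter tends to zero
    (∀ κ' ∈ ({0, κ} : Set ℝ), ∀ Φ : Fields Ω N, IsConfig Φ →
      sGamma T 0 κ' Φ = brst T Φ ∧
      ∀ (i : Comp d N) (n : ℕ) (L : GFun Ω →ₗ[ℝ] ℝ),
        Tendsto (fun γ : ℝ => L (PowerSeries.coeff n (sGamma T (γ ^ 2) κ' Φ i))) (𝓝 0)
          (𝓝 (L (PowerSeries.coeff n (brst T Φ i))))) ∧
    -- existence of the remainder of the horizon function, and of its BRST variation
    (∃ R : Potential Ω N → Colour N → Ser Ω, IsHorizonRemainder T R) ∧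
    (∀ R : Potential Ω N → Colour N → Ser Ω, IsHorizonRemainder T R →
      ∃ sR : Fields Ω N → Colour N → Ser Ω, Acts (brst T) (fun Φ => R (pot Φ)) sR) ∧
    -- the decomposition `s_{γ²} = s + δ_{γ²}`
    (∀ (R : Potential Ω N → Colour N → Ser Ω) (sR : Fields Ω N → Colour N → Ser Ω),
      IsHorizonRemainder T R → Acts (brst T) (fun Φ => R (pot Φ)) sR →
      ∀ κ' ∈ ({0, κ} : Set ℝ),
        (∀ G : ℝ,
          IsOddVectorField (sBh T G R sR) ∧ IsOddVectorField (deltaGamma T G κ' R sR) ∧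
          (∀ Φ : Fields Ω N, IsConfig Φ →
            IsConfig (toBh G R Φ) ∧
            (∀ θ ∈ grade 1, toBh G R (flow (brst T) θ Φ) = flow (sBh T G R sR) θ (toBh G R Φ)) ∧
            sGamma T G κ' Φ = sBh T G R sR Φ + deltaGamma T G κ' R sR Φ) ∧
          Acts (sBh T G R sR) (sBh T G R sR) 0 ∧
          Acts (deltaGamma T G κ' R sR) (deltaGamma T G κ' R sR) 0 ∧
          ∃ V : Fields Ω N → Fields Ω N,
            Acts (sBh T G R sR) (deltaGamma T G κ' R sR) V ∧
            Acts (deltaGamma T G κ' R sR) (sBh T G R sR) (-V)) ∧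
        ∀ Φ : Fields Ω N, IsConfig Φ →
          sBh T 0 R sR Φ = brst T Φ ∧ deltaGamma T 0 κ' R sR Φ = 0 ∧
          ∀ (i : Comp d N) (n : ℕ) (L : GFun Ω →ₗ[ℝ] ℝ),
            Tendsto (fun γ : ℝ => L (PowerSeries.coeff n (deltaGamma T (γ ^ 2) κ' R sR Φ i)))
              (𝓝 0) (𝓝 0)) := by
  have h0 := isGreen hΩ
  have hf := T.isStructureConst
  have hG : ∀ κ' ∈ ({0, κ} : Set ℝ), ∃ L, (calculus Ω).IsGreen κ' L := by
    rintro κ' (rfl | rfl)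
    · exact ⟨_, h0⟩
    · exact ⟨_, isGreen hκ⟩
  have hYM := fun (G κ' α : ℝ) (Φ : Fields Ω N) (hΦ : (calculus Ω).IsConfig Φ) θ
    (hθ : θ ∈ (calculus Ω).odd) =>
    Calculus.gaugeFixed_invariant (κ := κ') G α hf hΦ hθ
  refine ⟨?_, ?_, ?_, ?_, ?_, ?_, ?_, ?_, ?_, ?_, ?_, ?_, ?_⟩
  · intro A hA
    simp only [isDressing_iff]
    exact h0.existsUnique_dressing ((isPotential_iff A).1 hA)
  · exact fun A _ J => h0.existsUnique_fp hf A J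
  · exact fun A _ J => (isGreen hκ).existsUnique_fp hf A J
  · intro G
    rw [sGamma_eq]
    refine actsInt_zero_of fun Φ hΦ θ hθ => ?_
    obtain ⟨h1, h2, -, -⟩ := hYM G 0 0 Φ hΦ θ hθ
    rw [actionGZ, actionGZ, actionYM_eq, actionLandau_eq, actionLoc_eq, h1, h2,
      Calculus.actionLoc_invariant G h0 hf hΦ hθ]
  · intro G α
    rw [sGamma_eq]
    refine actsInt_zero_of fun Φ hΦ θ hθ => ?_
    obtain ⟨h1, h2, h3, -⟩ := hYM G 0 α Φ hΦ θ hθ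
    rw [actionGZ_LCG, actionGZ_LCG, actionYM_eq, actionLandau_eq, actionAlpha_eq, actionLoc_eq,
      h1, h2, h3, Calculus.actionLoc_invariant G h0 hf hΦ hθ]
  · intro G α
    rw [sGamma_eq]
    refine actsInt_zero_of fun Φ hΦ θ hθ => ?_
    obtain ⟨h1, h2, h3, h4⟩ := hYM G 0 α Φ hΦ θ hθ
    rw [actionGZ_CF, actionGZ_CF, actionYM_eq, actionLandau_eq, actionAlpha_eq,
      actionGhostInt_eq, actionLoc_eq, h1, h2, h3, h4, Calculus.actionLoc_invariant G h0 hf hΦ hθ]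
  · intro G α m2
    rw [sGamma_eq]
    refine actsInt_zero_of fun Φ hΦ θ hθ => ?_
    obtain ⟨h1, h2, h3, -⟩ := hYM G κ α Φ hΦ θ hθ
    rw [actionRGZ_LCG, actionRGZ_LCG, actionGZ_LCG, actionGZ_LCG, actionYM_eq, actionLandau_eq,
      actionAlpha_eq, actionLoc_eq, actionRef_eq, h1, h2, h3]
    -- The localizing and refining terms are regrouped, since the argument establishes their
    -- invariance for the sum.
    exact (add_assoc _ _ _).trans ((congrArg (_ + ·) (Calculus.actionLoc_add_actionRef_invariant
      h0 (isGreen hκ) hf G m2 hΦ hθ)).trans (add_assoc _ _ _).symm)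
  · intro G α m2
    rw [sGamma_eq]
    refine actsInt_zero_of fun Φ hΦ θ hθ => ?_
    obtain ⟨h1, h2, h3, h4⟩ := hYM G κ α Φ hΦ θ hθ
    rw [actionRGZ_CF, actionRGZ_CF, actionGZ_CF, actionGZ_CF, actionYM_eq, actionLandau_eq,
      actionAlpha_eq, actionGhostInt_eq, actionLoc_eq, actionRef_eq, h1, h2, h3, h4]
    exact (add_assoc _ _ _).trans ((congrArg (_ + ·) (Calculus.actionLoc_add_actionRef_invariant
      h0 (isGreen hκ) hf G m2 hΦ hθ)).trans (add_assoc _ _ _).symm)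
  · intro G κ' hκ'
    obtain ⟨L, hL⟩ := hG κ' hκ'
    rw [sGamma_eq]
    exact ⟨isOddVectorField_of (Calculus.isOddField_sGamma h0 hL hf G),
      acts_zero_of fun Φ hΦ θ hθ => Calculus.sGamma_flow h0 hf G hΦ hθ⟩
  · intro κ' _ Φ _
    simp only [sGamma_eq, brst_eq]
    exact ⟨Calculus.sGamma_zero Φ, Calculus.tendsto_sGamma Φ⟩
  · exact ⟨_, isHorizonRemainder_remainder T hΩ⟩
  · intro R hR
    obtain ⟨sR, h⟩ := Calculus.exists_isVariation (f := T.f) fun a => (hR.1 a).hasVariations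
    exact ⟨sR, (isVariation_iff T hR.1).2 h⟩
  · intro R sR hR hs κ' hκ'
    obtain ⟨L, hL⟩ := hG κ' hκ'
    have hV := (isVariation_iff T hR.1).1 hs
    simp only [sGamma_eq, brst_eq, sBh_eq, deltaGamma_eq, toBh_eq]
    refine ⟨fun G => ⟨isOddVectorField_of (hV.isOddField_sBh G),
      isOddVectorField_of (hV.isOddField_deltaGamma G h0 hL hf), fun Φ hΦ => ?_,
      acts_zero_of fun Φ hΦ θ hθ => hV.sBh_flow G hΦ hθ hf,
      acts_zero_of fun Φ hΦ θ hθ => hV.deltaGamma_flow G hΦ hθ hf h0 hL, ?_⟩,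
      fun Φ _ => ⟨Calculus.IsVariation.sBh_zero Φ, Calculus.IsVariation.deltaGamma_zero Φ,
        Calculus.IsVariation.tendsto_deltaGamma Φ⟩⟩
    · rw [isConfig_iff] at hΦ ⊢
      exact ⟨hV.isConfig_toBh G hΦ, fun θ hθ => hV.toBh_flow G hΦ (mem_odd hθ),
        Calculus.IsVariation.sGamma_eq_add G⟩
    -- The witness is `s δ`, whose only nonzero component is `s δ c̄ = -γ⁴ sR`: `sR` and the shift
    -- are invariant.
    · refine ⟨fun Φ i => match i with
        | .cbar a => -(G ^ 2 • sR Φ a)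
        | _ => 0, fun Φ hΦ θ hθ => ?_, fun Φ hΦ θ hθ => ?_⟩
      · exact hV.deltaGamma_flow_sBh G ((isConfig_iff Φ).1 hΦ) (mem_odd hθ) hf h0
      · exact hV.sBh_flow_deltaGamma G ((isConfig_iff Φ).1 hΦ) (mem_odd hθ) hf h0 hL
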